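/- **Notation.** Write $\langle x\rangle=(1+x^2)^{1/2}$ and $\langle k,\xi\rangle=(1+k^2+\xi^2)^{1/2}$ for $x,\xi\in\mathbb{R}$, $k\in\mathbb{Z}$. Fix $\delta_0>0$, $\sigma_0\in(0,1/100]$, and an even smooth function $\varphi:\mathbb{R}\to[0,1]$ supported in $[-8/5,8/5]$ and equal to $1$ on $[-5/4,5/4]$; let $d_0=\int_{\mathbb{R}}\varphi$. Let $\lambda:[0,\infty)\to\mathbb{R}$ be given by $\lambda(0)=\tfrac32\delta_0$, $\lambda'(t)=-\delta_0\sigma_0^2\langle t\rangle^{-1-\sigma_0}$. Let $\delta>0$ and $\delta'\in(0,1]$ be parameters. **The weights $w_{NR},w_R,w_k$** ($t\ge 0$, $\eta\in\mathbb{R}$, $k\in\mathbb{Z}$). If $|\eta|\le\delta^{-10}$, then $w_{NR}(t,\eta)=w_R(t,\eta)=w_k(t,\eta)=1$. For $\eta>\delta^{-10}$ let $k_0(\eta)=\lfloor\sqrt{\delta^3\eta}\rfloor$, $t_{0,\eta}=2\eta$, $t_{l,\eta}=\frac12\big(\frac{\eta}{l+1}+\frac{\eta}{l}\big)$ for $l\ge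 1$, and $I_{l,\eta}=[t_{l,\eta},t_{l-1,\eta}]$. Put $w_{NR}(t,\eta)=w_R(t,\eta)=1$ for $t\ge 2\eta$ and, successively for $k=1,\dots,k_0(\eta)$, $$w_{NR}(t,\eta)=\Big(\frac{1+\delta^2|t-\eta/k|}{1+\delta^2|t_{k-1,\eta}-\eta/k|}\Big)^{\delta_0}w_{NR}(t_{k-1,\eta},\eta)\quad\text{for } t\in[\eta/k,t_{k-1,\eta}],$$ $$w_{NR}(t,\eta)=\Big(\frac{1}{1+\delta^2|t-\eta/k|}\Big)^{1+\delta_0}w_{NR}(\eta/k,\eta)\quad\text{for } t\in[t_{k,\eta},\eta/k].$$ For $t\in I_{k,\eta}$, $1\le k\le k_0(\eta)$, put $w_R(t,\eta)=w_{NR}(t,\eta)\frac{1+\delta^2|t-\eta/k|}{1+\delta^2\eta/(8k^2)}$ if $|t-\eta/k|\le\eta/(8k^2)$, and $w_R(t,\eta)=w_{NR}(t,\eta)$ otherwise. For $t=(1-\beta)t_{k_0(\eta),\eta}$ with $\beta\in[0,1]$ put $w_{NR}(t,\eta)=w_R(t,\eta)=(e^{-\delta\sqrt\eta})^{\beta}\,w_{NR}(t_{k_0(\eta),\eta},\eta)^{1-\beta}$.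 Finally, let $w_k(t,\eta)=w_R(t,\eta)$ if $1\le k\le\sqrt{\delta^3\eta}$ and $t\in I_{k,\eta}$, and $w_k(t,\eta)=w_{NR}(t,\eta)$ otherwise. For $\eta<-\delta^{-10}$ let $w_{NR}(t,\eta)=w_{NR}(t,|\eta|)$, $w_R(t,\eta)=w_R(t,|\eta|)$ and $w_k(t,\eta)=w_{-k}(t,-\eta)$. **The weights $b_*$, $A_R$, $A_k$.** Let $L_{\delta'}(t,\xi)=1+\frac{\delta'\langle\xi\rangle}{\langle\xi\rangle^{1/2}+\delta' t}$ and, for $*\in\{R,k\}$, $$b_*(t,\xi)=\int_{\mathbb{R}}w_*(t,\rho)\,\varphi\Big(\frac{\xi-\rho}{L_{\delta'}(t,\xi)}\Big)\frac{1}{d_0L_{\delta'}(t,\xi)}\,d\rho,$$ $$A_R(t,\xi)=\frac{e^{\lambda(t)\langle\xi\rangle^{1/2}}}{b_R(t,\xi)}e^{\sqrt\delta\langle\xi\rangle^{1/2}},\qquad A_k(t,\xi)=e^{\lambda(t)\langle k,\xi\rangle^{1/2}}\Big(\frac{e^{\sqrt\delta\langle\xi\rangle^{1/2}}}{b_k(t,\xi)}+e^{\sqrt\delta|k|^{1/2}}\Big).$$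 **Lemma (refined smoothness of the weights).** There are a constant $C>0$, independent of $\delta$ and $\delta'$, and a $\overline\delta>0$ (both depending only on $\delta_0,\sigma_0,\varphi$) such that for every $\delta\in(0,\overline\delta]$ there is $\overline{\delta'}=\overline{\delta'}(\delta)\in(0,1]$ with the following property. For every $\delta'\in(0,\overline{\delta'}]$ there is a constant $C_0\ge 1$ (depending on $\delta$ and on the choice of $\delta'=\delta'(\delta)$) such that for all $t\ge 0$, $k\in\mathbb{Z}$ and $\xi,\eta\in\mathbb{R}$ with $\langle\xi-\eta\rangle\le(\langle k,\xi\rangle+\langle k,\eta\rangle)/8$, $$\big|A_k(t,\xi)-A_k(t,\eta)\big|\le C\,A_R(t,\xi-\eta)\,A_k(t,\eta)\,e^{-(\lambda(t)/40)\langle\xi-\eta\rangle^{1/2}}\Big[\frac{C_0}{\langle k,\xi\rangle^{1/8}}+\sqrt\delta\Big].$$ -/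

import Mathlib

open scoped ContDiff

noncomputable section

namespace ImbalancedWeights

/-- The Japanese bracket `⟨x⟩ = (1 + x²)^{1/2}` of a real number. -/
def jap (x : ℝ) : ℝ := √(1 + x ^ 2)

/-- The Japanese bracket `⟨k, ξ⟩ = (1 + k² + ξ²)^{1/2}` of `(k, ξ) ∈ ℤ × ℝ`. -/
def jap₂ (k : ℤ) (ξ : ℝ) : ℝ := √(1 + (k : ℝ) ^ 2 + ξ ^ 2)

/-- `k₀(η) = ⌊√(δ³ η)⌋`. -/
def kMax (δ η : ℝ) : ℕ := ⌊√(δ ^ 3 * η)⌋₊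

/-- The times `t_{0,η} = 2η` and `t_{l,η} = (η/(l+1) + η/l)/2` for `l ≥ 1`. -/
def tCrit (l : ℕ) (η : ℝ) : ℝ :=
  if l = 0 then 2 * η else 1 / 2 * (η / ((l : ℝ) + 1) + η / (l : ℝ))

/-- The interval `I_{l,η} = [t_{l,η}, t_{l-1,η}]` (used for `l ≥ 1`). -/
def resInterval (l : ℕ) (η : ℝ) : Set ℝ := Set.Icc (tCrit l η) (tCrit (l - 1) η)

/-- For `η > δ^{-10}`, the weight `w_NR(t, η)` at times `t ≥ t_{n,η}`, constructed backwards in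
time, one interval `I_{k,η}` at a time. It is `1` for `t ≥ t_{0,η} = 2η`. With `k = n + 1`, on
`[η/k, t_{k-1,η}]` it is
`((1 + δ²|t - η/k|) / (1 + δ²|t_{k-1,η} - η/k|))^{δ₀} w_NR(t_{k-1,η}, η)`,
and on `[t_{k,η}, η/k]` it is `(1 / (1 + δ²|t - η/k|))^{1+δ₀} w_NR(η/k, η)`, where `w_NR(η/k, η)`
is the value of the previous formula at `t = η/k`. -/
def wNRFrom (δ₀ δ η : ℝ) : ℕ → ℝ → ℝ
  | 0, _ => 1
  | n + 1, t =>
    if tCrit n η ≤ t then wNRFrom δ₀ δ η n t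
    else if η / ((n : ℝ) + 1) ≤ t then
      ((1 + δ ^ 2 * |t - η / ((n : ℝ) + 1)|)
          / (1 + δ ^ 2 * |tCrit n η - η / ((n : ℝ) + 1)|)) ^ δ₀
        * wNRFrom δ₀ δ η n (tCrit n η)
    else
      (1 / (1 + δ ^ 2 * |t - η / ((n : ℝ) + 1)|)) ^ (1 + δ₀)
        * ((1 / (1 + δ ^ 2 * |tCrit n η - η / ((n : ℝ) + 1)|)) ^ δ₀
          * wNRFrom δ₀ δ η n (tCrit n η))

/-- The quotient `w_R(t, η) / w_NR(t, η)` for `t ∈ I_{k,η}`. -/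
def resFactor (δ η : ℝ) (k : ℕ) (t : ℝ) : ℝ :=
  if |t - η / (k : ℝ)| ≤ η / (8 * (k : ℝ) ^ 2) then
    (1 + δ ^ 2 * |t - η / (k : ℝ)|) / (1 + δ ^ 2 * (η / (8 * (k : ℝ) ^ 2)))
  else 1

/-- For `η > δ^{-10}`, the weight `w_R(t, η)` at times `t ≥ t_{n,η}`. -/
def wRFrom (δ₀ δ η : ℝ) : ℕ → ℝ → ℝ
  | 0, _ => 1
  | n + 1, t =>
    if tCrit n η ≤ t then wRFrom δ₀ δ η n t
    else wNRFrom δ₀ δ η (n + 1) t * resFactor δ η (n + 1) t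

/-- For `η > δ^{-10}` and `t = (1 - β) t_{k₀(η),η}`, `β ∈ [0, 1]`, the common value
`(e^{-δ√η})^β w_NR(t_{k₀(η),η}, η)^{1-β}` of `w_NR(t, η)` and `w_R(t, η)`. -/
def wEarly (δ₀ δ t η : ℝ) : ℝ :=
  Real.exp (-δ * √η) ^ (1 - t / tCrit (kMax δ η) η)
    * wNRFrom δ₀ δ η (kMax δ η) (tCrit (kMax δ η) η) ^ (t / tCrit (kMax δ η) η)

/-- The non-resonant weight `w_NR(t, η)`, `t ≥ 0`, `η ∈ ℝ`. -/
def wNR (δ₀ δ t η : ℝ) : ℝ :=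
  if |η| ≤ δ ^ (-10 : ℤ) then 1
  else if tCrit (kMax δ |η|) |η| ≤ t then wNRFrom δ₀ δ |η| (kMax δ |η|) t
  else wEarly δ₀ δ t |η|

/-- The resonant weight `w_R(t, η)`, `t ≥ 0`, `η ∈ ℝ`. -/
def wR (δ₀ δ t η : ℝ) : ℝ :=
  if |η| ≤ δ ^ (-10 : ℤ) then 1
  else if tCrit (kMax δ |η|) |η| ≤ t then wRFrom δ₀ δ |η| (kMax δ |η|) t
  else wEarly δ₀ δ t |η|

open Classical in
/-- The weight `w_k(t, η)` for `η > δ^{-10}`: it is `w_R` if `1 ≤ k ≤ √(δ³η)` and `t ∈ I_{k,η}`,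
and `w_NR` otherwise. -/
def wKPos (δ₀ δ : ℝ) (k : ℤ) (t η : ℝ) : ℝ :=
  if 1 ≤ k ∧ (k : ℝ) ≤ √(δ ^ 3 * η) ∧ t ∈ resInterval k.toNat η then wR δ₀ δ t η
  else wNR δ₀ δ t η

/-- The weight `w_k(t, η)`, `k ∈ ℤ`, with `w_k(t, η) = w_{-k}(t, -η)` for `η < -δ^{-10}`. -/
def wK (δ₀ δ : ℝ) (k : ℤ) (t η : ℝ) : ℝ :=
  if |η| ≤ δ ^ (-10 : ℤ) then 1
  else if 0 < η then wKPos δ₀ δ k t η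
  else wKPos δ₀ δ (-k) t (-η)

/-- The admissible mollifiers: even smooth functions `φ : ℝ → [0, 1]` supported in `[-8/5, 8/5]`
and equal to `1` on `[-5/4, 5/4]`. -/
structure IsMollifier (φ : ℝ → ℝ) : Prop where
  smooth : ContDiff ℝ ∞ φ
  even : ∀ x, φ (-x) = φ x
  mem_Icc : ∀ x, φ x ∈ Set.Icc (0 : ℝ) 1
  support : tsupport φ ⊆ Set.Icc (-(8 / 5)) (8 / 5)
  eq_one : ∀ x ∈ Set.Icc (-(5 / 4) : ℝ) (5 / 4), φ x = 1

/-- The averaging length `L_{δ'}(t, ξ) = 1 + δ'⟨ξ⟩ / (⟨ξ⟩^{1/2} + δ' t)`. -/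
def avgLength (δ' t ξ : ℝ) : ℝ := 1 + δ' * jap ξ / (√(jap ξ) + δ' * t)

/-- The mollified weight
`b(t, ξ) = ∫ w(t, ρ) φ((ξ - ρ) / L_{δ'}(t, ξ)) / (d₀ L_{δ'}(t, ξ)) dρ`, with `d₀ = ∫ φ`. -/
def mollify (φ : ℝ → ℝ) (δ' : ℝ) (w : ℝ → ℝ → ℝ) (t ξ : ℝ) : ℝ :=
  ∫ ρ : ℝ, w t ρ * φ ((ξ - ρ) / avgLength δ' t ξ) * (1 / ((∫ x : ℝ, φ x) * avgLength δ' t ξ))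

/-- The resonant mollified weight `b_R(t, ξ)`. -/
def bR (δ₀ δ δ' : ℝ) (φ : ℝ → ℝ) (t ξ : ℝ) : ℝ := mollify φ δ' (wR δ₀ δ) t ξ

/-- The mollified weight `b_k(t, ξ)`. -/
def bK (δ₀ δ δ' : ℝ) (φ : ℝ → ℝ) (k : ℤ) (t ξ : ℝ) : ℝ := mollify φ δ' (wK δ₀ δ k) t ξ

/-- The function `λ` with `λ(0) = 3δ₀/2` and `λ'(t) = -δ₀ σ₀² / ⟨t⟩^{1+σ₀}`. -/
def lam (δ₀ σ₀ t : ℝ) : ℝ :=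
  3 / 2 * δ₀ - ∫ s in (0 : ℝ)..t, δ₀ * σ₀ ^ 2 / jap s ^ (1 + σ₀)

/-- The weight `A_R(t, ξ) = e^{λ(t)⟨ξ⟩^{1/2}} e^{√δ⟨ξ⟩^{1/2}} / b_R(t, ξ)`. -/
def AR (δ₀ σ₀ δ δ' : ℝ) (φ : ℝ → ℝ) (t ξ : ℝ) : ℝ :=
  Real.exp (lam δ₀ σ₀ t * √(jap ξ)) / bR δ₀ δ δ' φ t ξ * Real.exp (√δ * √(jap ξ))

/-- The weight
`A_k(t, ξ) = e^{λ(t)⟨k,ξ⟩^{1/2}} (e^{√δ⟨ξ⟩^{1/2}} / b_k(t, ξ) + e^{√δ|k|^{1/2}})`. -/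
def AK (δ₀ σ₀ δ δ' : ℝ) (φ : ℝ → ℝ) (k : ℤ) (t ξ : ℝ) : ℝ :=
  Real.exp (lam δ₀ σ₀ t * √(jap₂ k ξ))
    * (Real.exp (√δ * √(jap ξ)) / bK δ₀ δ δ' φ k t ξ + Real.exp (√δ * √|(k : ℝ)|))

end ImbalancedWeights

end

namespace ImbalancedWeights

/-! Write z = ⟨ξ-η⟩, X = ⟨k,ξ⟩, B(ξ) = e^{√δ⟨ξ⟩^{1/2}}/b_k(t,ξ) and D = e^{√δ|k|^{1/2}}. Since b_R ≤
1 and λ ≥ δ₀, the factor A_R(t,ξ-η) is at least e^{λ√z}. Even after e^{-(λ/40)√z} is paid, powers of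
z and losses e^{3a√z} with a = δ₀/20 can be absorbed. The change of e^{λ⟨k,·⟩^{1/2}} costs about
z/√X times e^{(9/25)λ√z}. What remains is to bound |B(ξ)-B(η)|/(B(η)+D) by e^{3a√z}(C₀X^{-1/8} +
C√δ), which is `exists_abs_expDivB_sub_div_le`.

Three regimes occur. If X ≲ z⁴, then X^{1/8} ≲ √z, and a crude comparison of B(ξ) with B(η)
suffices. If |k| ≫ ⟨ξ⟩, then D dominates both values of B exponentially. Otherwise ξ is large, z is
small against √⟨ξ⟩, and b_k must vary little. This is split at t ~ δ^{-3/2}√|ξ|, the order of the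
last critical time. Before it, the averaging length is at least a multiple (depending on δ, δ') of
√⟨ξ⟩, the weight varies by a bounded factor over such windows, and moving the kernel costs z/√⟨ξ⟩
(`exists_abs_bK_sub_le_of_le`). After it, the two averages are compared pointwise: log w_k changes
by O(δ√z) with no additive constant, and e^{O(δ√z)} - 1 produces the √δ term
(`abs_bK_sub_le_of_ge`).

The bounds on log w_k start from closed formulas (`wNRFrom_eq`, `wK_eq`): -log w_NR is a sum over
critical intervals of logarithms log(1+δ²x) of clamped distances, followed by an affine piece at
early times. These logarithms are subadditive and at most 2δ√x. To change the frequency from ρ to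
ρ', first keep t/ρ fixed, which costs (ρ'-ρ)/ρ for each of at most δ√ρ' intervals, and then correct
the time. The time variation (`fsum_sub_le`) is controlled because the complete intervals crossed
are not too short. This gives `abs_psiK_sub_le`, valid at all times with an additive constant, and
its early and late versions `abs_psiK_sub_le_of_le` and `abs_psiK_sub_le_of_ge`. -/

/-! ### The logarithm log(1+δ²x): subadditivity and growth. -/

/-- `ℓ(x) = log (1 + δ² x)`. -/
noncomputable def ell (δ x : ℝ) : ℝ := Real.log (1 + δ ^ 2 * x)

theorem one_le_ell_arg (δ : ℝ) {x : ℝ} (hx : 0 ≤ x) : 1 ≤ 1 + δ ^ 2 * x := by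
  have := mul_nonneg (sq_nonneg δ) hx
  linarith

@[simp] theorem ell_zero (δ : ℝ) : ell δ 0 = 0 := by simp [ell]

theorem ell_nonneg (δ : ℝ) {x : ℝ} (hx : 0 ≤ x) : 0 ≤ ell δ x :=
  Real.log_nonneg (one_le_ell_arg δ hx)

theorem ell_mono (δ : ℝ) {x y : ℝ} (hx : 0 ≤ x) (hxy : x ≤ y) : ell δ x ≤ ell δ y := by
  have := one_le_ell_arg δ hx
  apply Real.log_le_log (by linarith)
  gcongr

/-- Subadditivity: 1 + δ²(y+d) ≤ (1+δ²y)(1+δ²d). -/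
theorem ell_le_ell_abs_sub_add (δ : ℝ) {x y : ℝ} (hx : 0 ≤ x) (hy : 0 ≤ y) :
    ell δ x - ell δ y ≤ ell δ |x - y| := by
  have h1 := one_le_ell_arg δ hx
  have h2 := one_le_ell_arg δ hy
  have h3 := one_le_ell_arg δ (abs_nonneg (x - y))
  have : ell δ x ≤ ell δ y + ell δ |x - y| := by
    unfold ell
    rw [← Real.log_mul (by linarith) (by linarith)]
    apply Real.log_le_log (by linarith)
    have : δ ^ 2 * x ≤ δ ^ 2 * (y + |x - y|) := by
      gcongr
      linarith [le_abs_self (x - y)]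
    have := mul_nonneg (mul_nonneg (sq_nonneg δ) hy) (mul_nonneg (sq_nonneg δ) (abs_nonneg (x - y)))
    nlinarith
  linarith

theorem abs_ell_sub_le (δ : ℝ) {x y : ℝ} (hx : 0 ≤ x) (hy : 0 ≤ y) :
    |ell δ x - ell δ y| ≤ ell δ |x - y| := by
  rw [abs_le]
  have h1 := ell_le_ell_abs_sub_add δ hx hy
  have h2 := ell_le_ell_abs_sub_add δ hy hx
  rw [abs_sub_comm] at h2
  constructor <;> linarith

theorem log_one_add_sq_le {y : ℝ} (hy : 0 ≤ y) : Real.log (1 + y ^ 2) ≤ 2 * Real.log (1 + y) := by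
  rw [← Real.log_rpow (by linarith)]
  apply Real.log_le_log (by positivity)
  norm_cast
  nlinarith

theorem ell_le_sqrt {δ : ℝ} (hδ : 0 ≤ δ) {x : ℝ} (hx : 0 ≤ x) : ell δ x ≤ 2 * δ * √x := by
  have h := log_one_add_sq_le (y := δ * √x) (by positivity)
  have h2 := Real.log_le_sub_one_of_pos (x := 1 + δ * √x) (by positivity)
  rw [mul_pow, Real.sq_sqrt hx] at h
  unfold ell
  linarith

/-- The inequality 1+y² ≤ (1+y)² is applied twice. With y = √ρ/(n+1), the resulting power 1/2 of y
gives terms (n+1)^{-1/2}, whose sum over N intervals is only of order √N. -/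
theorem ell_sq_le_sqrt {δ : ℝ} {y : ℝ} (hδ : 0 ≤ δ) (hy : 0 ≤ y) :
    ell δ (y ^ 2) ≤ 4 * √(δ * y) := by
  have h0 : 0 ≤ δ * y := by positivity
  have h := log_one_add_sq_le h0
  have h1 := log_one_add_sq_le (Real.sqrt_nonneg (δ * y))
  rw [Real.sq_sqrt h0] at h1
  have h2 := Real.log_le_sub_one_of_pos (x := 1 + √(δ * y)) (by positivity)
  rw [mul_pow] at h
  unfold ell
  linarith

/-- A dilation costs only its relative size, uniformly in `a` and `δ`, because (1+δ²ρ'a)/(1+δ²ρa) ≤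
ρ'/ρ. -/
theorem ell_mul_sub_le (δ : ℝ) {a ρ ρ' : ℝ} (ha : 0 ≤ a) (hρ : 0 < ρ) (h : ρ ≤ ρ') :
    ell δ (ρ' * a) - ell δ (ρ * a) ≤ (ρ' - ρ) / ρ := by
  have h1 := one_le_ell_arg δ (mul_nonneg hρ.le ha)
  have h2 := one_le_ell_arg δ (mul_nonneg (hρ.le.trans h) ha)
  unfold ell
  rw [← Real.log_div (by linarith) (by linarith)]
  have h3 := Real.log_le_sub_one_of_pos
    (x := (1 + δ ^ 2 * (ρ' * a)) / (1 + δ ^ 2 * (ρ * a))) (by positivity)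
  refine h3.trans ?_
  rw [div_sub_one (by linarith), div_le_div_iff₀ (by linarith) hρ]
  have : 0 ≤ (ρ' - ρ) := by linarith
  nlinarith

/-! ### The critical times -/

/-- `(t_{n,η} - η/(n+1))/η`. -/
noncomputable def gapR (n : ℕ) : ℝ := if n = 0 then 1 else 1 / (2 * n * (n + 1))

/-- `(η/(n+1) - t_{n+1,η})/η`. -/
noncomputable def gapL (n : ℕ) : ℝ := 1 / (2 * (n + 1) * (n + 2))

theorem tCrit_sub (n : ℕ) (ρ : ℝ) : tCrit n ρ - ρ / (n + 1) = ρ * gapR n := by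
  rcases n with _ | n
  · simp [tCrit, gapR]; ring
  · simp only [tCrit, gapR, Nat.succ_ne_zero, if_false]
    push_cast
    field_simp
    ring

theorem sub_tCrit_succ (n : ℕ) (ρ : ℝ) : ρ / (n + 1) - tCrit (n + 1) ρ = ρ * gapL n := by
  simp only [tCrit, gapL, Nat.succ_ne_zero, if_false]
  push_cast
  field_simp
  ring

theorem gapR_pos (n : ℕ) : 0 < gapR n := by
  unfold gapR
  split_ifs with h
  · norm_num
  · have : (0 : ℝ) < n := by exact_mod_cast Nat.pos_of_ne_zero h
    positivity

theorem gapL_pos (n : ℕ) : 0 < gapL n := by unfold gapL; positivity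

theorem gapR_le (n : ℕ) : gapR n ≤ 1 / ((n : ℝ) + 1) ^ 2 := by
  unfold gapR
  split_ifs with h
  · simp [h]
  · have : (1 : ℝ) ≤ n := by exact_mod_cast Nat.pos_of_ne_zero h
    apply one_div_le_one_div_of_le (by positivity)
    nlinarith

theorem gapL_le (n : ℕ) : gapL n ≤ 1 / ((n : ℝ) + 1) ^ 2 := by
  unfold gapL
  have : (0 : ℝ) ≤ n := by positivity
  apply one_div_le_one_div_of_le (by positivity)
  nlinarith

/-- The right side is the length of the interval around ρ/(n+1), relative to ρ; a lower bound limits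
how many intervals a time step can cross. -/
theorem one_div_le_gapR_add_gapL (n : ℕ) : 1 / ((n : ℝ) + 1) ^ 2 ≤ gapR n + gapL n := by
  unfold gapR gapL
  split_ifs with h
  · simp [h]
  · have : (1 : ℝ) ≤ n := by exact_mod_cast Nat.pos_of_ne_zero h
    rw [div_add_div _ _ (by positivity) (by positivity), div_le_div_iff₀ (by positivity) (by positivity)]
    nlinarith [mul_pos (by linarith : (0:ℝ) < n) (by linarith : (0:ℝ) < n),
      mul_nonneg (by linarith : (0:ℝ) ≤ n) (sq_nonneg (n : ℝ))]

/-- With `gapL_ge`, this keeps the resonant window |t-ρ/k| ≤ ρ/(8k²) inside the critical interval,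
so the resonant correction vanishes at its endpoints. -/
theorem gapR_ge (n : ℕ) : 1 / (8 * ((n : ℝ) + 1) ^ 2) ≤ gapR n := by
  unfold gapR
  split_ifs with h
  · simp [h]; norm_num
  · have : (1 : ℝ) ≤ n := by exact_mod_cast Nat.pos_of_ne_zero h
    apply one_div_le_one_div_of_le (by positivity)
    nlinarith

theorem gapL_ge (n : ℕ) : 1 / (8 * ((n : ℝ) + 1) ^ 2) ≤ gapL n := by
  unfold gapL
  have : (0 : ℝ) ≤ n := by positivity
  apply one_div_le_one_div_of_le (by positivity)
  nlinarith

theorem div_lt_tCrit {ρ : ℝ} (hρ : 0 < ρ) (n : ℕ) : ρ / (n + 1) < tCrit n ρ := by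
  have := tCrit_sub n ρ
  have := mul_pos hρ (gapR_pos n)
  linarith

theorem tCrit_succ_lt {ρ : ℝ} (hρ : 0 < ρ) (n : ℕ) : tCrit (n + 1) ρ < ρ / (n + 1) := by
  have := sub_tCrit_succ n ρ
  have := mul_pos hρ (gapL_pos n)
  linarith

theorem tCrit_antitone {ρ : ℝ} (hρ : 0 < ρ) : Antitone fun n => tCrit n ρ :=
  antitone_nat_of_succ_le fun n => ((tCrit_succ_lt hρ n).trans (div_lt_tCrit hρ n)).le

theorem tCrit_pos {ρ : ℝ} (hρ : 0 < ρ) (n : ℕ) : 0 < tCrit n ρ :=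
  (by positivity : (0 : ℝ) < ρ / (n + 1)).trans (div_lt_tCrit hρ n)

/-! ### The contribution of one interval to `-log w_NR` -/

/-- The contribution of `I_{n+1,ρ}` to `-log w_NR(t, ρ)`. -/
noncomputable def fpart (δ₀ δ : ℝ) (n : ℕ) (t ρ : ℝ) : ℝ :=
  δ₀ * (ell δ (ρ * gapR n) - ell δ (min (max (t - ρ / (n + 1)) 0) (ρ * gapR n)))
    + (1 + δ₀) * ell δ (min (max (ρ / (n + 1) - t) 0) (ρ * gapL n))

/-- The sum of the contributions of the first `N` intervals. -/
noncomputable def fsum (δ₀ δ : ℝ) (N : ℕ) (t ρ : ℝ) : ℝ :=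
  ∑ n ∈ Finset.range N, fpart δ₀ δ n t ρ

theorem fpart_eq_zero {δ₀ δ : ℝ} {n : ℕ} {t ρ : ℝ} (hρ : 0 < ρ) (h : tCrit n ρ ≤ t) :
    fpart δ₀ δ n t ρ = 0 := by
  have h1 := tCrit_sub n ρ
  have h2 := mul_pos hρ (gapR_pos n)
  have h3 := mul_pos hρ (gapL_pos n)
  unfold fpart
  rw [max_eq_left (by linarith), min_eq_right (by linarith), max_eq_right (by linarith),
    min_eq_left h3.le]
  simp

theorem fpart_of_le {δ₀ δ : ℝ} {n : ℕ} {t ρ : ℝ} (hρ : 0 < ρ) (h : t ≤ tCrit (n + 1) ρ) :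
    fpart δ₀ δ n t ρ = δ₀ * ell δ (ρ * gapR n) + (1 + δ₀) * ell δ (ρ * gapL n) := by
  have h1 := sub_tCrit_succ n ρ
  have h2 := mul_pos hρ (gapR_pos n)
  have h3 := mul_pos hρ (gapL_pos n)
  unfold fpart
  rw [max_eq_right (by linarith), min_eq_left h2.le, max_eq_left (by linarith),
    min_eq_right (by linarith)]
  simp

theorem fpart_nonneg {δ₀ δ : ℝ} (hδ₀ : 0 ≤ δ₀) {n : ℕ} {t ρ : ℝ} (hρ : 0 < ρ) :
    0 ≤ fpart δ₀ δ n t ρ := by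
  have h2 := mul_pos hρ (gapR_pos n)
  have h3 := mul_pos hρ (gapL_pos n)
  have h4 : ell δ (min (max (t - ρ / (n + 1)) 0) (ρ * gapR n)) ≤ ell δ (ρ * gapR n) :=
    ell_mono δ (by positivity) (min_le_right _ _)
  have h5 := ell_nonneg δ (x := min (max (ρ / (n + 1) - t) 0) (ρ * gapL n)) (by positivity)
  unfold fpart
  have := mul_nonneg hδ₀ (sub_nonneg.2 h4)
  positivity

theorem fpart_le {δ₀ δ : ℝ} (hδ₀ : 0 ≤ δ₀) {n : ℕ} {t ρ : ℝ} (hρ : 0 < ρ) :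
    fpart δ₀ δ n t ρ ≤ (1 + 2 * δ₀) * ell δ (ρ * (1 / ((n : ℝ) + 1) ^ 2)) := by
  have h2 := mul_pos hρ (gapR_pos n)
  have h3 := mul_pos hρ (gapL_pos n)
  have h1 : ell δ (ρ * gapR n) ≤ ell δ (ρ * (1 / ((n : ℝ) + 1) ^ 2)) :=
    ell_mono δ h2.le (by gcongr; exact gapR_le n)
  have h4 := ell_nonneg δ (x := min (max (t - ρ / (n + 1)) 0) (ρ * gapR n)) (by positivity)
  have h5 : ell δ (min (max (ρ / (n + 1) - t) 0) (ρ * gapL n)) ≤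
      ell δ (ρ * (1 / ((n : ℝ) + 1) ^ 2)) :=
    ell_mono δ (by positivity) ((min_le_right _ _).trans (by gcongr; exact gapL_le n))
  unfold fpart
  have := mul_le_mul_of_nonneg_left h5 (by linarith : 0 ≤ 1 + δ₀)
  have := mul_le_mul_of_nonneg_left (sub_le_sub h1 h4) hδ₀
  linarith

theorem fpart_antitone {δ₀ δ : ℝ} (hδ₀ : 0 ≤ δ₀) {n : ℕ} {s t ρ : ℝ} (hρ : 0 < ρ) (hst : s ≤ t) :
    fpart δ₀ δ n t ρ ≤ fpart δ₀ δ n s ρ := by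
  have h2 := mul_pos hρ (gapR_pos n)
  have h3 := mul_pos hρ (gapL_pos n)
  unfold fpart
  gcongr
  · exact ell_mono δ (by positivity) (by gcongr)
  · exact ell_mono δ (by positivity) (by gcongr)

/-- Clamping is 1-Lipschitz, so subadditivity applies to each half; the exponents δ₀ and 1+δ₀ add up
to 1+2δ₀. -/
theorem fpart_sub_le {δ₀ δ : ℝ} (hδ₀ : 0 ≤ δ₀) {n : ℕ} {s t ρ : ℝ} (hρ : 0 < ρ) (hst : s ≤ t) :
    fpart δ₀ δ n s ρ - fpart δ₀ δ n t ρ ≤ (1 + 2 * δ₀) * ell δ (t - s) := by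
  have h2 := mul_pos hρ (gapR_pos n)
  have h3 := mul_pos hρ (gapL_pos n)
  have key : ∀ a b c : ℝ, |min (max a 0) c - min (max b 0) c| ≤ |a - b| := fun a b c =>
    
    (abs_min_sub_min_le_max _ _ _ _).trans
      (max_le (abs_max_sub_max_le_abs _ _ _) (by simp))
  have e1 : ell δ (min (max (t - ρ / (n + 1)) 0) (ρ * gapR n)) -
      ell δ (min (max (s - ρ / (n + 1)) 0) (ρ * gapR n)) ≤ ell δ (t - s) := by
    refine (ell_le_ell_abs_sub_add δ (by positivity) (by positivity)).trans
      (ell_mono δ (abs_nonneg _) ((key _ _ _).trans (le_of_eq ?_)))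
    rw [abs_of_nonneg] <;> linarith
  have e2 : ell δ (min (max (ρ / (n + 1) - s) 0) (ρ * gapL n)) -
      ell δ (min (max (ρ / (n + 1) - t) 0) (ρ * gapL n)) ≤ ell δ (t - s) := by
    refine (ell_le_ell_abs_sub_add δ (by positivity) (by positivity)).trans
      (ell_mono δ (abs_nonneg _) ((key _ _ _).trans (le_of_eq ?_)))
    rw [abs_of_nonneg] <;> linarith
  unfold fpart
  have := mul_le_mul_of_nonneg_left e1 hδ₀
  have := mul_le_mul_of_nonneg_left e2 (by linarith : 0 ≤ 1 + δ₀)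
  linarith

/-- At times proportional to the frequency, every argument of the logarithm is the frequency times a
fixed number, so only a dilation is felt. -/
theorem abs_fpart_scale_sub_le {δ₀ δ : ℝ} (hδ₀ : 0 ≤ δ₀) {n : ℕ} {s ρ ρ' : ℝ} (hρ : 0 < ρ)
    (h : ρ ≤ ρ') :
    |fpart δ₀ δ n (ρ' * s) ρ' - fpart δ₀ δ n (ρ * s) ρ| ≤ (1 + 2 * δ₀) * ((ρ' - ρ) / ρ) := by
  have hρ' := hρ.trans_le h
  have sc : ∀ r : ℝ, 0 < r → fpart δ₀ δ n (r * s) r =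
      δ₀ * (ell δ (r * gapR n) - ell δ (r * min (max (s - 1 / (n + 1)) 0) (gapR n)))
      + (1 + δ₀) * ell δ (r * min (max (1 / (n + 1) - s) 0) (gapL n)) := by
    intro r hr
    unfold fpart
    rw [mul_min_of_nonneg _ _ hr.le, mul_min_of_nonneg _ _ hr.le, mul_max_of_nonneg _ _ hr.le,
      mul_max_of_nonneg _ _ hr.le]
    congr 6 <;> ring_nf
  rw [sc _ hρ, sc _ hρ']
  have g1 := (gapR_pos n).le
  have g2 := (gapL_pos n).le
  have bd : ∀ a : ℝ, 0 ≤ a → 0 ≤ ell δ (ρ' * a) - ell δ (ρ * a) ∧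
      ell δ (ρ' * a) - ell δ (ρ * a) ≤ (ρ' - ρ) / ρ := fun a ha =>
    ⟨sub_nonneg.2 (ell_mono δ (by positivity) (by gcongr)), ell_mul_sub_le δ ha hρ h⟩
  obtain ⟨a1, a2⟩ := bd _ g1
  obtain ⟨b1, b2⟩ := bd (min (max (s - 1 / (n + 1)) 0) (gapR n)) (by positivity)
  obtain ⟨c1, c2⟩ := bd (min (max (1 / (n + 1) - s) 0) (gapL n)) (by positivity)
  have := mul_le_mul_of_nonneg_left c2 (by linarith : 0 ≤ 1 + δ₀)
  have := mul_nonneg (by linarith : 0 ≤ 1 + δ₀) c1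
  have := mul_le_mul_of_nonneg_left (sub_le_sub a2 b1) hδ₀
  have := mul_le_mul_of_nonneg_left (sub_le_sub b2 a1) hδ₀
  rw [abs_le]
  constructor <;> nlinarith

/-! ### Formulas for the weights -/

/-- The clamps unroll the backward recursion: intervals lying after t contribute their saturated
total, intervals lying before t contribute nothing. -/
theorem wNRFrom_eq {δ₀ δ : ℝ} {ρ : ℝ} (hρ : 0 < ρ) (n : ℕ) :
    ∀ t, tCrit n ρ ≤ t → wNRFrom δ₀ δ ρ n t = Real.exp (-fsum δ₀ δ n t ρ) := by
  induction n with
  | zero => intro t _; simp [wNRFrom, fsum]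
  | succ n ih =>
    intro t ht
    have g2 := mul_pos hρ (gapR_pos n)
    have g3 := mul_pos hρ (gapL_pos n)
    have hc := tCrit_sub n ρ
    have hs := sub_tCrit_succ n ρ
    rw [wNRFrom, fsum, Finset.sum_range_succ]
    split_ifs with h1 h2
    · rw [ih t h1, fpart_eq_zero hρ h1, add_zero, fsum]
    all_goals
      push Not at h1
      have hsat : fsum δ₀ δ n (tCrit n ρ) ρ = ∑ i ∈ Finset.range n, fpart δ₀ δ i t ρ := by
        refine Finset.sum_congr rfl fun i hi => ?_
        have : tCrit n ρ ≤ tCrit (i + 1) ρ := tCrit_antitone hρ (Finset.mem_range.1 hi)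
        rw [fpart_of_le hρ this, fpart_of_le hρ (h1.le.trans this)]
      have p1 := one_le_ell_arg δ g2.le
      have p2 := one_le_ell_arg δ (abs_nonneg (t - ρ / (n + 1)))
      rw [ih _ le_rfl, hsat, hc, abs_of_pos g2]
    · rw [Real.rpow_def_of_pos (by positivity), Real.log_div (by linarith) (by linarith),
        ← Real.exp_add, fpart, max_eq_left (by linarith), min_eq_left (by linarith),
        max_eq_right (by linarith), min_eq_left g3.le, ell_zero, abs_of_nonneg (by linarith)]
      congr 1
      unfold ell
      ring
    · push Not at h2
      rw [Real.rpow_def_of_pos (by positivity), Real.rpow_def_of_pos (by positivity),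
        Real.log_div one_ne_zero (by linarith), Real.log_div one_ne_zero (by linarith),
        ← Real.exp_add, ← Real.exp_add, fpart, max_eq_right (by linarith), min_eq_left g2.le,
        max_eq_left (by linarith), min_eq_left (by linarith), ell_zero, abs_of_neg (by linarith),
        Real.log_one]
      congr 1
      unfold ell
      ring_nf

/-- `-log (w_R / w_NR)` on `I_{k,ρ}`, extended by zero. -/
noncomputable def res (δ k t ρ : ℝ) : ℝ :=
  ell δ (ρ / (8 * k ^ 2)) - ell δ (min |t - ρ / k| (ρ / (8 * k ^ 2)))

theorem resFactor_eq {δ ρ : ℝ} (hρ : 0 < ρ) (k : ℕ) (t : ℝ) :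
    resFactor δ ρ k t = Real.exp (-res δ k t ρ) := by
  have h0 : 0 ≤ ρ / (8 * (k : ℝ) ^ 2) := by positivity
  have p1 := one_le_ell_arg δ h0
  have p2 := one_le_ell_arg δ (abs_nonneg (t - ρ / k))
  unfold resFactor res
  split_ifs with h
  · rw [min_eq_left h, neg_sub]
    unfold ell
    rw [← Real.log_div (by linarith) (by linarith), Real.exp_log (by positivity)]
  · rw [min_eq_right (by linarith)]
    simp

theorem res_nonneg {δ ρ : ℝ} (hρ : 0 < ρ) (k t : ℝ) : 0 ≤ res δ k t ρ := by
  unfold res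
  exact sub_nonneg.2 (ell_mono δ (by positivity) (min_le_right _ _))

theorem res_le {δ ρ : ℝ} (hρ : 0 < ρ) (k t : ℝ) : res δ k t ρ ≤ ell δ (ρ / (8 * k ^ 2)) := by
  unfold res
  have := ell_nonneg δ (x := min |t - ρ / k| (ρ / (8 * k ^ 2))) (by positivity)
  linarith

theorem res_eq_zero {δ k t ρ : ℝ} (h : ρ / (8 * k ^ 2) ≤ |t - ρ / k|) : res δ k t ρ = 0 := by
  unfold res
  rw [min_eq_right h, sub_self]

theorem res_succ_eq_zero {δ ρ t : ℝ} (hρ : 0 < ρ) {n : ℕ}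
    (h : t ≤ tCrit (n + 1) ρ ∨ tCrit n ρ ≤ t) : res δ ((n + 1 : ℕ) : ℝ) t ρ = 0 := by
  apply res_eq_zero
  push_cast
  have e : ρ / (8 * ((n : ℝ) + 1) ^ 2) = ρ * (1 / (8 * ((n : ℝ) + 1) ^ 2)) := by ring
  rw [e]
  rcases h with h | h
  · have := sub_tCrit_succ n ρ
    have := mul_le_mul_of_nonneg_left (gapL_ge n) hρ.le
    rw [abs_sub_comm]
    exact le_trans (by linarith) (le_abs_self _)
  · have := tCrit_sub n ρ
    have := mul_le_mul_of_nonneg_left (gapR_ge n) hρ.le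
    exact le_trans (by linarith) (le_abs_self _)

/-- The resonant corrections live on different critical intervals, so the case distinction can be
replaced by a sum. -/
theorem wRFrom_eq {δ₀ δ : ℝ} {ρ : ℝ} (hρ : 0 < ρ) (n : ℕ) :
    ∀ t, tCrit n ρ ≤ t → wRFrom δ₀ δ ρ n t =
      wNRFrom δ₀ δ ρ n t * Real.exp (-∑ i ∈ Finset.range n, res δ ((i + 1 : ℕ) : ℝ) t ρ) := by
  induction n with
  | zero => intro t _; simp [wNRFrom, wRFrom]
  | succ n ih =>
    intro t ht
    rw [wRFrom, Finset.sum_range_succ]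
    split_ifs with h1
    · rw [res_succ_eq_zero hρ (Or.inr h1), add_zero, ih t h1, wNRFrom, if_pos h1]
    · push Not at h1
      rw [Finset.sum_eq_zero, zero_add, resFactor_eq hρ]
      intro i hi
      exact res_succ_eq_zero hρ (Or.inl (h1.le.trans (tCrit_antitone hρ (Finset.mem_range.1 hi))))

theorem wRFrom_eq_of_mem {δ₀ δ : ℝ} {ρ : ℝ} (hρ : 0 < ρ) {n m : ℕ} {t : ℝ} (ht : tCrit n ρ ≤ t)
    (hm : m < n) (h1 : tCrit (m + 1) ρ ≤ t) (h2 : t ≤ tCrit m ρ) :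
    wRFrom δ₀ δ ρ n t = wNRFrom δ₀ δ ρ n t * Real.exp (-res δ ((m + 1 : ℕ) : ℝ) t ρ) := by
  rw [wRFrom_eq hρ n t ht, Finset.sum_eq_single m]
  · intro i _ him
    rcases lt_or_gt_of_ne him with h | h
    · exact res_succ_eq_zero hρ (Or.inl (h2.trans (tCrit_antitone hρ h)))
    · exact res_succ_eq_zero hρ (Or.inr (le_trans (tCrit_antitone hρ h) h1))
  · intro h
    exact absurd (Finset.mem_range.2 hm) h


/-! ### Variation of the sum in time -/

theorem fsum_nonneg {δ₀ δ : ℝ} (hδ₀ : 0 ≤ δ₀) (N : ℕ) {t ρ : ℝ} (hρ : 0 < ρ) :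
    0 ≤ fsum δ₀ δ N t ρ :=
  Finset.sum_nonneg fun _ _ => fpart_nonneg hδ₀ hρ

theorem fsum_antitone {δ₀ δ : ℝ} (hδ₀ : 0 ≤ δ₀) (N : ℕ) {s t ρ : ℝ} (hρ : 0 < ρ) (hst : s ≤ t) :
    fsum δ₀ δ N t ρ ≤ fsum δ₀ δ N s ρ :=
  Finset.sum_le_sum fun _ _ => fpart_antitone hδ₀ hρ hst

theorem fsum_eq_of_le {δ₀ δ : ℝ} {N M : ℕ} {t ρ : ℝ} (hρ : 0 < ρ) (hNM : N ≤ M)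
    (ht : tCrit N ρ ≤ t) : fsum δ₀ δ M t ρ = fsum δ₀ δ N t ρ := by
  unfold fsum
  symm
  apply Finset.sum_subset (Finset.range_mono hNM)
  intro i _ hi
  exact fpart_eq_zero hρ (le_trans (tCrit_antitone hρ (by simpa using hi)) ht)

theorem fsum_eq_zero {δ₀ δ : ℝ} {N : ℕ} {t ρ : ℝ} (hρ : 0 < ρ) (ht : tCrit 0 ρ ≤ t) :
    fsum δ₀ δ N t ρ = 0 := by
  rw [fsum_eq_of_le hρ (Nat.zero_le N) ht]
  simp [fsum]

/-- Within one critical interval only its own term moves; all others are saturated or zero. -/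
theorem fsum_sub_le_of_mem {δ₀ δ : ℝ} (hδ₀ : 0 ≤ δ₀) (hδ : 0 ≤ δ) {N n : ℕ} {s t ρ : ℝ} (hρ : 0 < ρ)
    (hs : tCrit (n + 1) ρ ≤ s) (hst : s ≤ t) (ht : t ≤ tCrit n ρ) :
    fsum δ₀ δ N s ρ - fsum δ₀ δ N t ρ ≤ 2 * (1 + 2 * δ₀) * δ * √(t - s) := by
  have h0 : fpart δ₀ δ n s ρ - fpart δ₀ δ n t ρ ≤ 2 * (1 + 2 * δ₀) * δ * √(t - s) := by
    have := fpart_sub_le (δ := δ) hδ₀ (n := n) hρ hst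
    have := mul_le_mul_of_nonneg_left (ell_le_sqrt hδ (sub_nonneg.2 hst))
      (by linarith : 0 ≤ 1 + 2 * δ₀)
    linarith
  unfold fsum
  rw [← Finset.sum_sub_distrib]
  have hne : ∀ i ≠ n, fpart δ₀ δ i s ρ - fpart δ₀ δ i t ρ = 0 := by
    intro i hi
    rcases lt_or_gt_of_ne hi with h | h
    · have h1 : tCrit n ρ ≤ tCrit (i + 1) ρ := tCrit_antitone hρ h
      rw [fpart_of_le hρ (by linarith), fpart_of_le hρ (by linarith), sub_self]
    · have h1 : tCrit i ρ ≤ tCrit (n + 1) ρ := tCrit_antitone hρ h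
      rw [fpart_eq_zero hρ (by linarith), fpart_eq_zero hρ (by linarith), sub_self]
  by_cases hn : n ∈ Finset.range N
  · rw [Finset.sum_eq_single_of_mem n hn fun i _ hi => hne i hi]
    exact h0
  · rw [Finset.sum_eq_zero fun i hi => hne i (by rintro rfl; exact hn hi)]
    positivity

theorem sqrt_le_div_sqrt {w x : ℝ} (hw : 0 < w) (h : w ≤ x) : √x ≤ x / √w := by
  rw [le_div_iff₀ (Real.sqrt_pos.2 hw)]
  calc √x * √w ≤ √x * √x := by gcongr
    _ = x := Real.mul_self_sqrt (by linarith)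

/-- On intervals of length x ≥ w, the bound √x ≤ x/√w turns square roots into lengths, which
telescope. -/
theorem fsum_tCrit_sub_le {δ₀ δ : ℝ} (hδ₀ : 0 ≤ δ₀) (hδ : 0 ≤ δ) {N n m : ℕ} {w ρ : ℝ}
    (hρ : 0 < ρ) (hw : 0 < w) (hnm : n ≤ m)
    (hwid : ∀ j < m, w ≤ tCrit j ρ - tCrit (j + 1) ρ) :
    fsum δ₀ δ N (tCrit m ρ) ρ - fsum δ₀ δ N (tCrit n ρ) ρ ≤
      2 * (1 + 2 * δ₀) * δ * ((tCrit n ρ - tCrit m ρ) / √w) := by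
  induction m, hnm using Nat.le_induction with
  | base => simp
  | succ m hm ih =>
    have h1 := ih fun j hj => hwid j (by omega)
    have h2 := fsum_sub_le_of_mem (N := N) hδ₀ hδ hρ le_rfl
      (tCrit_antitone hρ (Nat.le_succ m)) (le_refl (tCrit m ρ))
    have h3 := mul_le_mul_of_nonneg_left (sqrt_le_div_sqrt hw (hwid m (by omega)))
      (by positivity : 0 ≤ 2 * (1 + 2 * δ₀) * δ)
    simp only at h2
    have h4 : (tCrit n ρ - tCrit (m + 1) ρ) / √w =
      (tCrit n ρ - tCrit m ρ) / √w + (tCrit m ρ - tCrit (m + 1) ρ) / √w := by ring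
    rw [h4, mul_add]
    linarith

theorem exists_mem_interval {ρ t : ℝ} {N : ℕ} (hN : 1 ≤ N) (h1 : tCrit N ρ ≤ t)
    (h2 : t ≤ tCrit 0 ρ) : ∃ m < N, tCrit (m + 1) ρ ≤ t ∧ t ≤ tCrit m ρ := by
  induction N, hN using Nat.le_induction with
  | base => exact ⟨0, by simp, h1, h2⟩
  | succ n hn ih =>
    by_cases h : tCrit n ρ ≤ t
    · obtain ⟨m, hm, h⟩ := ih h
      exact ⟨m, by omega, h⟩
    · exact ⟨n, by omega, h1, by linarith⟩

/-- Here t ≤ ρ/(j+1), while the interval has length at least ρ/(j+1)². -/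
theorem sq_div_le_width {ρ t : ℝ} (hρ : 0 < ρ) (ht : 0 < t) {m j : ℕ} (h : t ≤ tCrit m ρ)
    (hj : j < m) : t ^ 2 / ρ ≤ tCrit j ρ - tCrit (j + 1) ρ := by
  obtain ⟨m, rfl⟩ : ∃ m', m = m' + 1 := ⟨m - 1, by omega⟩
  have h1 := tCrit_succ_lt hρ m
  have h2 : (j : ℝ) + 1 ≤ m + 1 := by exact_mod_cast hj
  have h3 : t ≤ ρ / (j + 1) := (h.trans h1.le).trans (by gcongr)
  have h4 := mul_le_mul_of_nonneg_left (one_div_le_gapR_add_gapL j) hρ.le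
  have h5 := tCrit_sub j ρ
  have h6 := sub_tCrit_succ j ρ
  calc t ^ 2 / ρ ≤ (ρ / (j + 1)) ^ 2 / ρ := by gcongr
    _ = ρ * (1 / ((j : ℝ) + 1) ^ 2) := by field_simp
    _ ≤ _ := by linarith

/-- The path from s to t has at most two partial intervals, giving 2√(t-s), and complete intervals
of length at least s²/ρ between them, giving the linear term. -/
theorem fsum_sub_le {δ₀ δ : ℝ} (hδ₀ : 0 ≤ δ₀) (hδ : 0 ≤ δ) {N : ℕ} (hN : 1 ≤ N) {s t ρ : ℝ}
    (hρ : 0 < ρ) (hs : tCrit N ρ ≤ s) (hst : s ≤ t) :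
    fsum δ₀ δ N s ρ - fsum δ₀ δ N t ρ ≤
      2 * (1 + 2 * δ₀) * δ * ((t - s) * √ρ / s + 2 * √(t - s)) := by
  have hs0 : 0 < s := (tCrit_pos hρ N).trans_le hs
  have hK : 0 ≤ 2 * (1 + 2 * δ₀) * δ := by positivity
  have hts := sub_nonneg.2 hst
  wlog ht : t ≤ tCrit 0 ρ generalizing t
  · push Not at ht
    rw [fsum_eq_zero hρ ht.le]
    rcases le_or_gt (tCrit 0 ρ) s with h | h
    · rw [fsum_eq_zero hρ h, sub_zero]
      positivity
    · have := this h.le (sub_nonneg.2 h.le) le_rfl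
      rw [fsum_eq_zero hρ le_rfl] at this
      refine this.trans ?_
      gcongr
  obtain ⟨m, hm, m1, m2⟩ := exists_mem_interval hN hs (hst.trans ht)
  obtain ⟨n, hn, n1, n2⟩ := exists_mem_interval hN (hs.trans hst) ht
  rcases le_or_gt t (tCrit m ρ) with h | h
  · refine (fsum_sub_le_of_mem hδ₀ hδ hρ m1 hst h).trans ?_
    have : 0 ≤ (t - s) * √ρ / s := by positivity
    gcongr
    linarith [Real.sqrt_nonneg (t - s)]
  have hnm : n + 1 ≤ m := by
    by_contra hc
    have : tCrit n ρ ≤ tCrit m ρ := tCrit_antitone hρ (by omega : m ≤ n)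
    linarith
  have hw : 0 < s ^ 2 / ρ := by positivity
  have hu : tCrit m ρ ≤ tCrit (n + 1) ρ := tCrit_antitone hρ hnm
  have e1 := fsum_sub_le_of_mem (N := N) hδ₀ hδ hρ m1 m2 le_rfl
  have e2 := fsum_tCrit_sub_le (N := N) hδ₀ hδ hρ hw hnm fun j hj => sq_div_le_width hρ hs0 m2 hj
  have e3 := fsum_sub_le_of_mem (N := N) hδ₀ hδ hρ le_rfl n1 n2
  have hsq : √(s ^ 2 / ρ) = s / √ρ := by
    rw [Real.sqrt_div (sq_nonneg s), Real.sqrt_sq hs0.le]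
  rw [hsq, div_div_eq_mul_div] at e2
  have f1 : √(tCrit m ρ - s) ≤ √(t - s) := Real.sqrt_le_sqrt (by linarith)
  have f2 : (tCrit (n + 1) ρ - tCrit m ρ) * √ρ / s ≤ (t - s) * √ρ / s := by
    gcongr
  have f3 : √(t - tCrit (n + 1) ρ) ≤ √(t - s) := Real.sqrt_le_sqrt (by linarith)
  have := mul_le_mul_of_nonneg_left f1 hK
  have := mul_le_mul_of_nonneg_left f2 hK
  have := mul_le_mul_of_nonneg_left f3 hK
  rw [mul_add]
  linarith

theorem abs_fsum_scale_sub_le {δ₀ δ : ℝ} (hδ₀ : 0 ≤ δ₀) {N : ℕ} {s ρ ρ' : ℝ} (hρ : 0 < ρ)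
    (h : ρ ≤ ρ') :
    |fsum δ₀ δ N (ρ' * s) ρ' - fsum δ₀ δ N (ρ * s) ρ| ≤
      N * ((1 + 2 * δ₀) * ((ρ' - ρ) / ρ)) := by
  unfold fsum
  rw [← Finset.sum_sub_distrib]
  refine (Finset.abs_sum_le_sum_abs _ _).trans ?_
  refine (Finset.sum_le_sum fun n _ => abs_fpart_scale_sub_le hδ₀ hρ h).trans ?_
  simp

theorem abs_fsum_sub_le {δ₀ δ : ℝ} (hδ₀ : 0 ≤ δ₀) (hδ : 0 ≤ δ) {N : ℕ} (hN : 1 ≤ N) {t ρ ρ' : ℝ}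
    (hρ : 0 < ρ) (h : ρ ≤ ρ') (h4 : ρ' ≤ 4 * ρ) (hNδ : N ≤ δ * √ρ') (ht : tCrit N ρ' ≤ t) :
    |fsum δ₀ δ N t ρ - fsum δ₀ δ N t ρ'| ≤
      12 * (1 + 2 * δ₀) * δ * ((ρ' - ρ) / √ρ' + √(t * (ρ' - ρ) / ρ')) := by
  have hρ' := hρ.trans_le h
  have ht0 : 0 < t := (tCrit_pos hρ' N).trans_le ht
  -- Keeping t/ρ fixed moves the time from t to ρ't/ρ; the displacement t(ρ'-ρ)/ρ is then undone at
  -- frequency ρ'.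
  have e1 := abs_fsum_scale_sub_le (δ := δ) (N := N) (s := t / ρ) hδ₀ hρ h
  rw [mul_div_cancel₀ _ hρ.ne'] at e1
  have hsub : ρ' * (t / ρ) - t = t * (ρ' - ρ) / ρ := by field_simp
  have hζ : 0 ≤ ρ' - ρ := by linarith
  have htt : t ≤ ρ' * (t / ρ) := by
    have : 0 ≤ t * (ρ' - ρ) / ρ := by positivity
    linarith
  have e2 := fsum_sub_le hδ₀ hδ hN hρ' ht htt
  have e3 := fsum_antitone (δ := δ) hδ₀ N hρ' htt
  rw [hsub] at e2
  have hinv : 1 / ρ ≤ 4 / ρ' := by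
    rw [div_le_div_iff₀ hρ hρ']
    linarith
  have hsq : √ρ' * √ρ' = ρ' := Real.mul_self_sqrt hρ'.le
  have hr : 0 < √ρ' := Real.sqrt_pos.2 hρ'
  have hd : √ρ' * (4 / ρ') = 4 * (1 / √ρ') := by
    rw [mul_div_assoc', div_eq_iff hρ'.ne']
    field_simp
    rw [sq, hsq]
  have a1 : t * (ρ' - ρ) / ρ * √ρ' / t ≤ 4 * ((ρ' - ρ) / √ρ') := by
    calc t * (ρ' - ρ) / ρ * √ρ' / t = (ρ' - ρ) * √ρ' * (1 / ρ) := by field_simp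
      _ ≤ (ρ' - ρ) * √ρ' * (4 / ρ') := by gcongr
      _ = 4 * ((ρ' - ρ) / √ρ') := by linear_combination (ρ' - ρ) * hd
  have a2 : √(t * (ρ' - ρ) / ρ) ≤ 2 * √(t * (ρ' - ρ) / ρ') := by
    calc √(t * (ρ' - ρ) / ρ) = √(t * (ρ' - ρ) * (1 / ρ)) := by ring_nf
      _ ≤ √(t * (ρ' - ρ) * (4 / ρ')) := by gcongr
      _ = √(2 ^ 2 * (t * (ρ' - ρ) / ρ')) := by ring_nf
      _ = 2 * √(t * (ρ' - ρ) / ρ') := by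
        rw [Real.sqrt_mul (by norm_num), Real.sqrt_sq (by norm_num)]
  have a3 : (N : ℝ) * ((1 + 2 * δ₀) * ((ρ' - ρ) / ρ)) ≤
      4 * (1 + 2 * δ₀) * δ * ((ρ' - ρ) / √ρ') := by
    calc (N : ℝ) * ((1 + 2 * δ₀) * ((ρ' - ρ) / ρ))
        = N * ((1 + 2 * δ₀) * ((ρ' - ρ) * (1 / ρ))) := by ring
      _ ≤ (δ * √ρ') * ((1 + 2 * δ₀) * ((ρ' - ρ) * (4 / ρ'))) := by gcongr
      _ = 4 * (1 + 2 * δ₀) * δ * ((ρ' - ρ) / √ρ') := by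
        linear_combination δ * (1 + 2 * δ₀) * (ρ' - ρ) * hd
  have hK : 0 ≤ 2 * (1 + 2 * δ₀) * δ := by positivity
  have b := mul_le_mul_of_nonneg_left (add_le_add a1 (mul_le_mul_of_nonneg_left a2 zero_le_two)) hK
  have b2 : 0 ≤ 2 * (1 + 2 * δ₀) * δ * √(t * (ρ' - ρ) / ρ') := by positivity
  have b3 : 0 ≤ 2 * (1 + 2 * δ₀) * δ * ((ρ' - ρ) / √ρ') := by positivity
  rw [abs_le] at e1 ⊢
  obtain ⟨e1, e1'⟩ := e1
  constructor <;> nlinarith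

theorem sum_one_div_sqrt_le (N : ℕ) :
    ∑ n ∈ Finset.range N, 1 / √((n : ℝ) + 1) ≤ 2 * √(N : ℝ) := by
  induction N with
  | zero => simp
  | succ n ih =>
    rw [Finset.sum_range_succ]
    push_cast
    have h1 : √(n : ℝ) * √(n : ℝ) = n := Real.mul_self_sqrt (by positivity)
    have h2 : √((n : ℝ) + 1) * √((n : ℝ) + 1) = n + 1 := Real.mul_self_sqrt (by positivity)
    have h3 : 0 < √((n : ℝ) + 1) := Real.sqrt_pos.2 (by positivity)
    have h4 : 1 / √((n : ℝ) + 1) ≤ 2 * √((n : ℝ) + 1) - 2 * √(n : ℝ) := by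
      rw [div_le_iff₀ h3]
      nlinarith [sq_nonneg (√((n : ℝ) + 1) - √(n : ℝ))]
    linarith

/-- Each term is O(√(δ√ρ)/√(n+1)), so the sum is O(√(δ√ρ)·√N), and N ≤ δ√ρ closes the bound. -/
theorem fsum_le {δ₀ δ : ℝ} (hδ₀ : 0 ≤ δ₀) (hδ : 0 ≤ δ) {N : ℕ} {t ρ : ℝ} (hρ : 0 < ρ)
    (hN : N ≤ δ * √ρ) : fsum δ₀ δ N t ρ ≤ 8 * (1 + 2 * δ₀) * δ * √ρ := by
  have h1 : ∀ n : ℕ, fpart δ₀ δ n t ρ ≤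
      4 * (1 + 2 * δ₀) * √(δ * √ρ) * (1 / √((n : ℝ) + 1)) := by
    intro n
    refine (fpart_le hδ₀ hρ).trans ?_
    have e : ρ * (1 / ((n : ℝ) + 1) ^ 2) = (√ρ / (n + 1)) ^ 2 := by
      rw [div_pow, Real.sq_sqrt hρ.le]; ring
    rw [e]
    have := ell_sq_le_sqrt (y := √ρ / ((n : ℝ) + 1)) hδ (by positivity)
    rw [← mul_div_assoc, Real.sqrt_div (by positivity)] at this
    have := mul_le_mul_of_nonneg_left this (by linarith : 0 ≤ 1 + 2 * δ₀)
    refine this.trans (le_of_eq ?_)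
    ring
  refine (Finset.sum_le_sum fun n _ => h1 n).trans ?_
  rw [← Finset.mul_sum]
  calc _ ≤ 4 * (1 + 2 * δ₀) * √(δ * √ρ) * (2 * √(N : ℝ)) := by
        gcongr; exact sum_one_div_sqrt_le N
    _ ≤ 4 * (1 + 2 * δ₀) * √(δ * √ρ) * (2 * √(δ * √ρ)) := by gcongr
    _ = 8 * (1 + 2 * δ₀) * (√(δ * √ρ) * √(δ * √ρ)) := by ring
    _ = _ := by rw [Real.mul_self_sqrt (by positivity)]; ring


/-! ### The logarithm of the non-resonant weight -/

/-- The last critical time `t_{k₀(ρ),ρ}`. -/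
noncomputable def tEnd (δ ρ : ℝ) : ℝ := tCrit (kMax δ ρ) ρ

/-- `-log w_NR(t, ρ)` for `ρ > δ^{-10}`. -/
noncomputable def psi (δ₀ δ t ρ : ℝ) : ℝ :=
  if tEnd δ ρ ≤ t then fsum δ₀ δ (kMax δ ρ) t ρ
  else (1 - t / tEnd δ ρ) * (δ * √ρ) + t / tEnd δ ρ * fsum δ₀ δ (kMax δ ρ) (tEnd δ ρ) ρ

theorem wEarly_eq {δ₀ δ t ρ : ℝ} (hρ : 0 < ρ) : wEarly δ₀ δ t ρ =
    Real.exp (-((1 - t / tEnd δ ρ) * (δ * √ρ)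
      + t / tEnd δ ρ * fsum δ₀ δ (kMax δ ρ) (tEnd δ ρ) ρ)) := by
  unfold wEarly
  rw [wNRFrom_eq hρ _ _ le_rfl, ← Real.exp_mul, ← Real.exp_mul, ← Real.exp_add]
  unfold tEnd
  congr 1
  ring

theorem sqrt_cube_mul {δ : ℝ} (hδ : 0 ≤ δ) (ρ : ℝ) : √(δ ^ 3 * ρ) = δ * √δ * √ρ := by
  rw [Real.sqrt_mul (by positivity), show δ ^ 3 = δ ^ 2 * δ by ring, Real.sqrt_mul (by positivity),
    Real.sqrt_sq hδ]

section
variable {δ₀ δ ρ : ℝ}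

theorem pos_of_four_le (hδ : 0 < δ) (hρ : 4 ≤ δ ^ 3 * ρ) : 0 < ρ :=
  pos_of_mul_pos_right (by linarith : 0 < δ ^ 3 * ρ) (by positivity)

theorem two_le_of_four_le (hδ : 0 < δ) (hρ : 4 ≤ δ ^ 3 * ρ) : 2 ≤ δ * √δ * √ρ := by
  rw [← sqrt_cube_mul hδ.le]
  exact Real.le_sqrt_of_sq_le (by linarith)

theorem kMax_le (hδ : 0 ≤ δ) : (kMax δ ρ : ℝ) ≤ δ * √δ * √ρ := by
  rw [← sqrt_cube_mul hδ]
  exact Nat.floor_le (Real.sqrt_nonneg _)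

theorem lt_kMax_add_one (hδ : 0 ≤ δ) : δ * √δ * √ρ < kMax δ ρ + 1 := by
  rw [← sqrt_cube_mul hδ]
  exact Nat.lt_floor_add_one _

theorem kMax_le_mul_sqrt (hδ : 0 ≤ δ) (hδ1 : δ ≤ 1) : (kMax δ ρ : ℝ) ≤ δ * √ρ := by
  refine (kMax_le hδ).trans ?_
  gcongr
  exact mul_le_of_le_one_right hδ (Real.sqrt_le_one.2 hδ1)

theorem one_le_kMax (hδ : 0 < δ) (hρ : 4 ≤ δ ^ 3 * ρ) : 1 ≤ kMax δ ρ := by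
  have h1 := two_le_of_four_le hδ hρ
  have h2 := lt_kMax_add_one (ρ := ρ) hδ.le
  have : (0 : ℝ) < kMax δ ρ := by linarith
  exact_mod_cast this

theorem kMax_mono {ρ' : ℝ} (hδ : 0 ≤ δ) (h : ρ ≤ ρ') : kMax δ ρ ≤ kMax δ ρ' :=
  Nat.floor_mono (Real.sqrt_le_sqrt (by gcongr))

theorem tEnd_pos (hρ : 0 < ρ) : 0 < tEnd δ ρ := tCrit_pos hρ _

/-- The last critical time lies between ρ/(k₀+1) and ρ/k₀, and k₀ is within 1 of δ^{3/2}√ρ ≥ 2. The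
O(δ^{-3}) error absorbs the jumps of the floor function. -/
theorem abs_tEnd_sub_le (hδ : 0 < δ) (hρ : 4 ≤ δ ^ 3 * ρ) :
    |tEnd δ ρ - √ρ / (δ * √δ)| ≤ 2 / (δ * √δ) ^ 2 ∧ √ρ / (2 * (δ * √δ)) ≤ tEnd δ ρ ∧
      tEnd δ ρ ≤ 2 * √ρ / (δ * √δ) := by
  have hρ0 := pos_of_four_le hδ hρ
  have q2 := two_le_of_four_le hδ hρ
  have k1 := kMax_le (ρ := ρ) hδ.le
  have k2 := lt_kMax_add_one (ρ := ρ) hδ.le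
  have h1 := div_lt_tCrit hρ0 (kMax δ ρ)
  have h2 : tEnd δ ρ < ρ / kMax δ ρ := by
    unfold tEnd
    obtain ⟨m, hm⟩ : ∃ m, kMax δ ρ = m + 1 :=
      ⟨kMax δ ρ - 1, by have := one_le_kMax hδ hρ; omega⟩
    rw [hm]
    push_cast
    exact tCrit_succ_lt hρ0 m
  change _ < tEnd δ ρ at h1
  generalize tEnd δ ρ = T at *
  generalize (kMax δ ρ : ℝ) = N at *
  have he : 0 < δ * √δ := by positivity
  generalize δ * √δ = e at *
  have hr := Real.mul_self_sqrt hρ0.le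
  have hr0 := Real.sqrt_pos.2 hρ0
  generalize √ρ = r at *
  rw [div_lt_iff₀ (by linarith)] at h1
  rw [lt_div_iff₀ (by linarith)] at h2
  have hT : 0 < T := by nlinarith
  have h3 : ρ ≤ T * (e * r + 1) := by nlinarith
  have h4 : T * (e * r - 1) ≤ ρ := by nlinarith
  subst hr
  have g1 : e * r - 1 ≤ T * e ^ 2 := by
    have : (e * r) ^ 2 ≤ T * e ^ 2 * (e * r + 1) := by nlinarith [mul_le_mul_of_nonneg_left h3 (sq_nonneg e)]
    have h5 : (e * r - 1) * (e * r + 1) ≤ T * e ^ 2 * (e * r + 1) := by nlinarith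
    exact le_of_mul_le_mul_right h5 (by linarith)
  have g2 : T * e ^ 2 ≤ e * r + 2 := by
    have : T * e ^ 2 * (e * r - 1) ≤ (e * r) ^ 2 := by nlinarith [mul_le_mul_of_nonneg_left h4 (sq_nonneg e)]
    have h5 : T * e ^ 2 * (e * r - 1) ≤ (e * r + 2) * (e * r - 1) := by nlinarith
    exact le_of_mul_le_mul_right h5 (by linarith)
  have g3 : T - r / e = (T * e ^ 2 - e * r) / e ^ 2 := by field_simp
  refine ⟨?_, ?_, ?_⟩
  · rw [g3, abs_div, abs_of_pos (by positivity : 0 < e ^ 2)]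
    gcongr
    rw [abs_le]
    constructor <;> linarith
  · rw [div_le_iff₀ (by positivity)]
    have : r * e ≤ T * (2 * e) * e := by nlinarith
    exact le_of_mul_le_mul_right this he
  · rw [le_div_iff₀ he]
    have : T * e * e ≤ 2 * r * e := by nlinarith
    exact le_of_mul_le_mul_right this he

theorem psi_of_le (hρ : 0 < ρ) {t : ℝ} (ht : t ≤ tEnd δ ρ) : psi δ₀ δ t ρ = δ * √ρ +
    t * ((fsum δ₀ δ (kMax δ ρ) (tEnd δ ρ) ρ - δ * √ρ) / tEnd δ ρ) := by
  have := (tEnd_pos (δ := δ) hρ).ne'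
  unfold psi
  split_ifs with h
  · rw [le_antisymm ht h]
    field_simp
    ring
  · field_simp
    ring

theorem psi_of_ge {t : ℝ} (ht : tEnd δ ρ ≤ t) :
    psi δ₀ δ t ρ = fsum δ₀ δ (kMax δ ρ) t ρ := if_pos ht

theorem psi_nonneg (hδ₀ : 0 ≤ δ₀) (hδ : 0 ≤ δ) (hρ : 0 < ρ) {t : ℝ} (ht : 0 ≤ t) :
    0 ≤ psi δ₀ δ t ρ := by
  have hT := tEnd_pos (δ := δ) hρ
  have h1 := fsum_nonneg (δ := δ) hδ₀ (kMax δ ρ) (t := t) hρ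
  have h2 := fsum_nonneg (δ := δ) hδ₀ (kMax δ ρ) (t := tEnd δ ρ) hρ
  unfold psi
  split_ifs with h
  · exact h1
  · push Not at h
    have : t / tEnd δ ρ ≤ 1 := (div_le_one hT).2 h.le
    have : 0 ≤ 1 - t / tEnd δ ρ := by linarith
    positivity

theorem psi_le (hδ₀ : 0 ≤ δ₀) (hδ : 0 < δ) (hδ1 : δ ≤ 1) (hρ : 0 < ρ) {t : ℝ}
    (ht : 0 ≤ t) : psi δ₀ δ t ρ ≤ 8 * (1 + 2 * δ₀) * δ * √ρ := by
  have hT := tEnd_pos (δ := δ) hρ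
  have hN := kMax_le_mul_sqrt (ρ := ρ) hδ.le hδ1
  have h1 := fsum_le hδ₀ hδ.le (t := t) hρ hN
  have h2 := fsum_le hδ₀ hδ.le (t := tEnd δ ρ) hρ hN
  have h3 : δ * √ρ ≤ 8 * (1 + 2 * δ₀) * δ * √ρ := by
    have : 0 ≤ δ * √ρ := by positivity
    nlinarith
  unfold psi
  split_ifs with h
  · exact h1
  · push Not at h
    have a1 : t / tEnd δ ρ ≤ 1 := (div_le_one hT).2 h.le
    have a2 : 0 ≤ 1 - t / tEnd δ ρ := by linarith
    have a3 : 0 ≤ t / tEnd δ ρ := by positivity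
    have := mul_le_mul_of_nonneg_left h2 a3
    have := mul_le_mul_of_nonneg_left h3 a2
    linarith

theorem psi_eq_zero (hρ : 0 < ρ) {t : ℝ} (ht : 2 * ρ ≤ t) : psi δ₀ δ t ρ = 0 := by
  have h0 : tCrit 0 ρ ≤ t := by simpa [tCrit] using ht
  rw [psi_of_ge ((tCrit_antitone hρ (Nat.zero_le _)).trans h0), fsum_eq_zero hρ h0]

/-- Beyond the last critical time √ρ/s ≤ 2δ, and 2δ√(t-s) ≤ δ²(t-s)+1 trades the square root for a
constant. Before it the function is affine, with slope O(δ√ρ) divided by a time of size at least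
√ρ/(2δ). -/
theorem abs_psi_time_sub_le (hδ₀ : 0 ≤ δ₀) (hδ : 0 < δ) (hδ1 : δ ≤ 1) (hρ : 4 ≤ δ ^ 3 * ρ) {s t : ℝ}
    (hs : 0 ≤ s) (hst : s ≤ t) :
    |psi δ₀ δ s ρ - psi δ₀ δ t ρ| ≤ 24 * (1 + 2 * δ₀) * δ ^ 2 * (t - s) + 2 * (1 + 2 * δ₀) := by
  have hρ0 := pos_of_four_le hδ hρ
  have hT := tEnd_pos (δ := δ) hρ0
  obtain ⟨-, hT1, -⟩ := abs_tEnd_sub_le hδ hρ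
  have hr := Real.sqrt_pos.2 hρ0
  have hsδ := Real.sqrt_pos.2 hδ
  have hTr : √ρ ≤ 2 * δ * tEnd δ ρ := by
    rw [div_le_iff₀ (by positivity)] at hT1
    refine hT1.trans ?_
    have : δ * √δ ≤ δ := mul_le_of_le_one_right hδ.le (Real.sqrt_le_one.2 hδ1)
    nlinarith
  have late : ∀ s t, tEnd δ ρ ≤ s → s ≤ t → |psi δ₀ δ s ρ - psi δ₀ δ t ρ| ≤
      6 * (1 + 2 * δ₀) * δ ^ 2 * (t - s) + 2 * (1 + 2 * δ₀) := by
    intro s t h1 h2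
    have hs0 : 0 < s := hT.trans_le h1
    have hN := one_le_kMax hδ hρ
    rw [psi_of_ge h1, psi_of_ge (h1.trans h2),
      abs_of_nonneg (sub_nonneg.2 (fsum_antitone hδ₀ _ hρ0 h2))]
    refine (fsum_sub_le hδ₀ hδ.le hN hρ0 h1 h2).trans ?_
    have b1 : (t - s) * √ρ / s ≤ (t - s) * (2 * δ) := by
      rw [mul_div_assoc]
      have : 0 ≤ t - s := by linarith
      gcongr
      rw [div_le_iff₀ hs0]
      exact hTr.trans (by gcongr)
    have b2 : 2 * δ * √(t - s) ≤ δ ^ 2 * (t - s) + 1 := by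
      have := Real.sq_sqrt (sub_nonneg.2 h2)
      nlinarith [sq_nonneg (δ * √(t - s) - 1)]
    have := mul_le_mul_of_nonneg_left b1 (by positivity : 0 ≤ 2 * (1 + 2 * δ₀) * δ)
    have := mul_le_mul_of_nonneg_left b2 (by positivity : 0 ≤ 2 * (1 + 2 * δ₀))
    linarith
  have early : ∀ s t, 0 ≤ s → s ≤ t → t ≤ tEnd δ ρ → |psi δ₀ δ s ρ - psi δ₀ δ t ρ| ≤
      18 * (1 + 2 * δ₀) * δ ^ 2 * (t - s) := by
    intro s t h0 h1 h2
    rw [psi_of_le hρ0 h2, psi_of_le hρ0 (h1.trans h2)]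
    have hN := kMax_le_mul_sqrt (ρ := ρ) hδ.le hδ1
    have c1 := fsum_le hδ₀ hδ.le (t := tEnd δ ρ) hρ0 hN
    have c2 := fsum_nonneg (δ := δ) hδ₀ (kMax δ ρ) (t := tEnd δ ρ) hρ0
    generalize fsum δ₀ δ (kMax δ ρ) (tEnd δ ρ) ρ = P at *
    have hA : 0 ≤ δ * √ρ := by positivity
    have c3 : |P - δ * √ρ| ≤ 9 * (1 + 2 * δ₀) * δ * √ρ := by
      rw [abs_le]
      constructor <;> nlinarith
    have c4 : |(P - δ * √ρ) / tEnd δ ρ| ≤ 18 * (1 + 2 * δ₀) * δ ^ 2 := by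
      rw [abs_div, abs_of_pos hT, div_le_iff₀ hT]
      refine c3.trans ?_
      have := mul_le_mul_of_nonneg_left hTr (by positivity : 0 ≤ 9 * (1 + 2 * δ₀) * δ)
      linarith
    generalize (P - δ * √ρ) / tEnd δ ρ = σ at *
    have : δ * √ρ + s * σ - (δ * √ρ + t * σ) = σ * (s - t) := by ring
    rw [this, abs_mul, abs_of_nonpos (by linarith : s - t ≤ 0), neg_sub]
    have : 0 ≤ t - s := by linarith
    gcongr
  have hp : 0 ≤ (1 + 2 * δ₀) * δ ^ 2 := by positivity
  rcases le_total (tEnd δ ρ) s with h | h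
  · refine (late s t h hst).trans ?_
    have := mul_nonneg hp (sub_nonneg.2 hst)
    linarith
  rcases le_total t (tEnd δ ρ) with h' | h'
  · refine (early s t hs hst h').trans ?_
    have := mul_nonneg hp (sub_nonneg.2 hst)
    linarith
  have e1 := early s _ hs h le_rfl
  have e2 := late _ t le_rfl h'
  refine (abs_sub_le _ (psi δ₀ δ (tEnd δ ρ) ρ) _).trans ?_
  have := mul_nonneg hp (sub_nonneg.2 h)
  have := mul_nonneg hp (sub_nonneg.2 h')
  linarith

theorem abs_psi_sub_le_of_ge {ρ' t : ℝ} (hδ₀ : 0 ≤ δ₀) (hδ : 0 < δ) (hδ1 : δ ≤ 1)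
    (hρ : 4 ≤ δ ^ 3 * ρ) (h : ρ ≤ ρ') (h4 : ρ' ≤ 4 * ρ) (ht : tEnd δ ρ ≤ t) (ht' : tEnd δ ρ' ≤ t) :
    |psi δ₀ δ t ρ - psi δ₀ δ t ρ'| ≤
      12 * (1 + 2 * δ₀) * δ * ((ρ' - ρ) / √ρ' + √(t * (ρ' - ρ) / ρ')) := by
  have hρ0 := pos_of_four_le hδ hρ
  have hρ' : 4 ≤ δ ^ 3 * ρ' := hρ.trans (by gcongr)
  rw [psi_of_ge ht, psi_of_ge ht', ← fsum_eq_of_le hρ0 (kMax_mono hδ.le h) ht]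
  exact abs_fsum_sub_le hδ₀ hδ.le (one_le_kMax hδ hρ') hρ0 h h4 (kMax_le_mul_sqrt hδ.le hδ1) ht'

theorem sqrt_sub_sqrt_le {ρ' : ℝ} (hρ : 0 < ρ) (h : ρ ≤ ρ') : √ρ' - √ρ ≤ (ρ' - ρ) / √ρ' := by
  have h1 := Real.sqrt_pos.2 (hρ.trans_le h)
  have h2 := Real.mul_self_sqrt hρ.le
  have h3 := Real.mul_self_sqrt (hρ.trans_le h).le
  have h4 := Real.sqrt_le_sqrt h
  have h5 := Real.sqrt_nonneg ρ
  rw [le_div_iff₀ h1]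
  nlinarith

/-- The horizon τ is left free: 2ρ' serves for all times, and a multiple of √ρ' for early times,
where the bound becomes a constant. -/
theorem abs_psi_sub_le {ρ' t τ : ℝ} (hδ₀ : 0 ≤ δ₀) (hδ : 0 < δ) (hδ1 : δ ≤ 1)
    (hρ : 4 ≤ δ ^ 3 * ρ) (h : ρ ≤ ρ') (h4 : ρ' ≤ 4 * ρ) (ht : 0 ≤ t) (htτ : t ≤ τ)
    (hτ : tEnd δ ρ ≤ τ) (hτ' : tEnd δ ρ' ≤ τ) :
    |psi δ₀ δ t ρ - psi δ₀ δ t ρ'| ≤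
      60 * (1 + 2 * δ₀) * √δ * ((ρ' - ρ) / √ρ' + √(τ * (ρ' - ρ) / ρ'))
        + 200 * (1 + 2 * δ₀) / δ := by
  have hρ0 := pos_of_four_le hδ hρ
  have hρ' : 4 ≤ δ ^ 3 * ρ' := hρ.trans (by gcongr)
  have hρ0' := hρ0.trans_le h
  have hζ : 0 ≤ ρ' - ρ := by linarith
  have hr := Real.sqrt_pos.2 hρ0'
  have hT := tEnd_pos (δ := δ) hρ0
  have hT' := tEnd_pos (δ := δ) hρ0'
  have hsδ := Real.sqrt_pos.2 hδ
  have hsδ1 : √δ ≤ 1 := Real.sqrt_le_one.2 hδ1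
  have hss := Real.mul_self_sqrt hδ.le
  have hδs : δ ≤ √δ := by nlinarith
  have hτ0 : 0 ≤ τ := ht.trans htτ
  have hx : 0 ≤ (ρ' - ρ) / √ρ' := by positivity
  have hy : 0 ≤ √(τ * (ρ' - ρ) / ρ') := by positivity
  -- The two last critical times differ by at most (ρ'-ρ)/(√ρ' δ^{3/2}) + 4δ^{-3}; the factor δ²
  -- from the time variation leaves √δ and 1/δ.
  have hTT : 48 * δ ^ 2 * |tEnd δ ρ - tEnd δ ρ'| ≤ 48 * √δ * ((ρ' - ρ) / √ρ') + 192 / δ := by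
    obtain ⟨a1, -, -⟩ := abs_tEnd_sub_le hδ hρ
    obtain ⟨a2, -, -⟩ := abs_tEnd_sub_le hδ hρ'
    have a3 := sqrt_sub_sqrt_le hρ0 h
    have a4 : |√ρ / (δ * √δ) - √ρ' / (δ * √δ)| ≤ (ρ' - ρ) / √ρ' / (δ * √δ) := by
      rw [abs_sub_comm, ← sub_div, abs_of_nonneg]
      · gcongr
      · have := Real.sqrt_le_sqrt h
        have : 0 ≤ √ρ' - √ρ := by linarith
        positivity
    have a5 : |tEnd δ ρ - tEnd δ ρ'| ≤ (ρ' - ρ) / √ρ' / (δ * √δ) + 4 / (δ * √δ) ^ 2 := by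
      have e : (4 : ℝ) / (δ * √δ) ^ 2 = 2 / (δ * √δ) ^ 2 + 2 / (δ * √δ) ^ 2 := by ring
      rw [e]
      rw [abs_le] at *
      constructor <;> linarith
    have a6 := mul_le_mul_of_nonneg_left a5 (by positivity : 0 ≤ 48 * δ ^ 2)
    refine a6.trans (le_of_eq ?_)
    generalize (ρ' - ρ) / √ρ' = x
    rw [mul_pow, Real.sq_sqrt hδ.le]
    have : x / (δ * √δ) = x * √δ / δ ^ 2 := by
      rw [div_eq_div_iff (by positivity) (by positivity)]
      linear_combination (-x * δ) * hss
    rw [this]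
    field_simp
    ring
  set B := 60 * (1 + 2 * δ₀) * √δ * ((ρ' - ρ) / √ρ' + √(τ * (ρ' - ρ) / ρ'))
        + 200 * (1 + 2 * δ₀) / δ with hB
  have hδinv : 1 ≤ 1 / δ := by rw [le_div_iff₀ hδ]; linarith
  have key : ∀ s, 0 ≤ s → s ≤ τ → tEnd δ ρ ≤ s ∨ tEnd δ ρ' ≤ s →
      |psi δ₀ δ s ρ - psi δ₀ δ s ρ'| ≤ B := by
    intro s hs0 hsτ hs
    -- Waiting until both last critical times have passed takes at most their distance, since s is
    -- already beyond one of them.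
    set M := max s (max (tEnd δ ρ) (tEnd δ ρ')) with hM
    have hsM : s ≤ M := le_max_left _ _
    have m1 : tEnd δ ρ ≤ M := (le_max_left _ _).trans (le_max_right _ _)
    have m2 : tEnd δ ρ' ≤ M := (le_max_right _ _).trans (le_max_right _ _)
    have hMτ : M ≤ τ := max_le hsτ (max_le hτ hτ')
    have hMs : M - s ≤ |tEnd δ ρ - tEnd δ ρ'| := by
      have q1 := le_abs_self (tEnd δ ρ - tEnd δ ρ')
      have q2 := neg_abs_le (tEnd δ ρ - tEnd δ ρ')
      have : M ≤ s + |tEnd δ ρ - tEnd δ ρ'| := by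
        refine max_le (by linarith [abs_nonneg (tEnd δ ρ - tEnd δ ρ')]) (max_le ?_ ?_) <;>
        rcases hs with hs | hs <;> linarith
      linarith
    have b1 := abs_psi_time_sub_le hδ₀ hδ hδ1 hρ hs0 hsM
    have b2 := abs_psi_time_sub_le hδ₀ hδ hδ1 hρ' hs0 hsM
    have b3 := abs_psi_sub_le_of_ge hδ₀ hδ hδ1 hρ h h4 m1 m2
    have b4 : 12 * (1 + 2 * δ₀) * δ * ((ρ' - ρ) / √ρ' + √(M * (ρ' - ρ) / ρ')) ≤
        12 * (1 + 2 * δ₀) * √δ * ((ρ' - ρ) / √ρ' + √(τ * (ρ' - ρ) / ρ')) := by gcongr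
    have b5 := mul_le_mul_of_nonneg_left (hMs.trans' le_rfl)
      (by positivity : 0 ≤ (1 + 2 * δ₀) * δ ^ 2)
    have b6 := mul_le_mul_of_nonneg_left hTT (by positivity : 0 ≤ 1 + 2 * δ₀)
    have b7 : |psi δ₀ δ s ρ - psi δ₀ δ s ρ'| ≤ |psi δ₀ δ s ρ - psi δ₀ δ M ρ| +
        |psi δ₀ δ M ρ - psi δ₀ δ M ρ'| + |psi δ₀ δ s ρ' - psi δ₀ δ M ρ'| := by
      rw [abs_sub_comm (psi δ₀ δ s ρ') (psi δ₀ δ M ρ')]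
      exact (abs_sub_le _ (psi δ₀ δ M ρ') _).trans (by gcongr; exact abs_sub_le _ _ _)
    have b8 := mul_le_mul_of_nonneg_left hδinv (by positivity : 0 ≤ 4 * (1 + 2 * δ₀))
    have b9 : 0 ≤ (1 + 2 * δ₀) * √δ * √(τ * (ρ' - ρ) / ρ') := by positivity
    have c1 : (1 + 2 * δ₀) * (192 / δ) = 192 * (1 + 2 * δ₀) / δ := by ring
    have c2 : 4 * (1 + 2 * δ₀) * (1 / δ) = 4 * (1 + 2 * δ₀) / δ := by ring
    have c3 : 200 * (1 + 2 * δ₀) / δ = 192 * (1 + 2 * δ₀) / δ + 4 * (1 + 2 * δ₀) / δ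
      + 4 * (1 + 2 * δ₀) * (1 / δ) := by ring
    rw [hB, c3]
    nlinarith
  by_cases hc : tEnd δ ρ ≤ t ∨ tEnd δ ρ' ≤ t
  · exact key t ht htτ hc
  push Not at hc
  obtain ⟨hc1, hc2⟩ := hc
  -- On [0, m] both functions are affine in time, so their difference at t is a convex combination
  -- of its values at 0 and m.
  set m := min (tEnd δ ρ) (tEnd δ ρ') with hm
  have hm0 : 0 < m := lt_min hT hT'
  have htm : t < m := lt_min hc1 hc2
  have d1 := key m hm0.le ((min_le_left _ _).trans hτ) (by
    rcases min_choice (tEnd δ ρ) (tEnd δ ρ') with h | h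
    · left; rw [hm, h]
    · right; rw [hm, h])
  have d0 : |δ * √ρ - δ * √ρ'| ≤ B := by
    have a3 := sqrt_sub_sqrt_le hρ0 h
    have a4 := Real.sqrt_le_sqrt h
    rw [abs_sub_comm, ← mul_sub, abs_of_nonneg (mul_nonneg hδ.le (by linarith))]
    calc δ * (√ρ' - √ρ) ≤ √δ * ((ρ' - ρ) / √ρ') := by gcongr
      _ ≤ 60 * (1 + 2 * δ₀) * √δ * ((ρ' - ρ) / √ρ') := by
        have : 0 ≤ √δ * ((ρ' - ρ) / √ρ') := by positivity
        nlinarith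
      _ ≤ B := by
        rw [hB]
        have : 0 ≤ 60 * (1 + 2 * δ₀) * √δ * √(τ * (ρ' - ρ) / ρ') := by positivity
        have : 0 ≤ 200 * (1 + 2 * δ₀) / δ := by positivity
        linarith
  rw [psi_of_le hρ0 (min_le_left _ _), psi_of_le hρ0' (min_le_right _ _)] at d1
  rw [psi_of_le hρ0 hc1.le, psi_of_le hρ0' hc2.le]
  generalize (fsum δ₀ δ (kMax δ ρ) (tEnd δ ρ) ρ - δ * √ρ) / tEnd δ ρ = σ at *
  generalize (fsum δ₀ δ (kMax δ ρ') (tEnd δ ρ') ρ' - δ * √ρ') / tEnd δ ρ' = σ' at *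
  have e : δ * √ρ + t * σ - (δ * √ρ' + t * σ') = (1 - t / m) * (δ * √ρ - δ * √ρ') +
      t / m * (δ * √ρ + m * σ - (δ * √ρ' + m * σ')) := by
    field_simp
    ring
  have s0 : 0 ≤ t / m := by positivity
  have s1 : t / m ≤ 1 := (div_le_one hm0).2 htm.le
  rw [e]
  refine (abs_add_le _ _).trans ?_
  rw [abs_mul, abs_mul, abs_of_nonneg s0, abs_of_nonneg (by linarith : 0 ≤ 1 - t / m)]
  have := mul_le_mul_of_nonneg_left d1 s0
  have := mul_le_mul_of_nonneg_left d0 (by linarith : 0 ≤ 1 - t / m)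
  linarith

end


/-! ### Logarithms of the weights -/

theorem wNR_eq {δ₀ δ t η : ℝ} (h : ¬|η| ≤ δ ^ (-10 : ℤ)) (hη : 0 < |η|) :
    wNR δ₀ δ t η = Real.exp (-psi δ₀ δ t |η|) := by
  unfold wNR
  rw [if_neg h]
  split_ifs with h1
  · rw [wNRFrom_eq hη _ _ h1, psi_of_ge h1]
  · rw [wEarly_eq hη, psi, if_neg (show ¬tEnd δ |η| ≤ t from h1)]

/-- `-log (w_R / w_NR)` for `ρ > δ^{-10}`. -/
noncomputable def resSum (δ t ρ : ℝ) : ℝ :=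
  if tEnd δ ρ ≤ t then ∑ i ∈ Finset.range (kMax δ ρ), res δ ((i + 1 : ℕ) : ℝ) t ρ else 0

theorem wR_eq {δ₀ δ t η : ℝ} (h : ¬|η| ≤ δ ^ (-10 : ℤ)) (hη : 0 < |η|) :
    wR δ₀ δ t η = Real.exp (-(psi δ₀ δ t |η| + resSum δ t |η|)) := by
  unfold wR resSum
  rw [if_neg h, neg_add, Real.exp_add]
  by_cases h1 : tCrit (kMax δ |η|) |η| ≤ t
  · have h2 : tEnd δ |η| ≤ t := h1
    rw [if_pos h1, if_pos h2, wRFrom_eq hη _ _ h1, wNRFrom_eq hη _ _ h1, psi_of_ge h2]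
  · have h2 : ¬tEnd δ |η| ≤ t := h1
    rw [if_neg h1, if_neg h2, wEarly_eq hη, psi, if_neg h2]
    simp

/-- `-log w_k(t, ρ)` for `ρ > δ^{-10}`. -/
noncomputable def psiK (δ₀ δ : ℝ) (k : ℤ) (t ρ : ℝ) : ℝ :=
  psi δ₀ δ t ρ + if 1 ≤ k ∧ (k : ℝ) ≤ √(δ ^ 3 * ρ) then res δ k t ρ else 0

/-- `-log w_k(t, ρ)`. -/
noncomputable def bigPsi (δ₀ δ : ℝ) (k : ℤ) (t ρ : ℝ) : ℝ :=
  if |ρ| ≤ δ ^ (-10 : ℤ) then 0 else if 0 < ρ then psiK δ₀ δ k t ρ else psiK δ₀ δ (-k) t (-ρ)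

/-- The membership condition on t disappears because the resonant correction vanishes off its
interval; only the cutoff in k remains. -/
theorem wKPos_eq {δ₀ δ t ρ : ℝ} {k : ℤ} (h : ¬|ρ| ≤ δ ^ (-10 : ℤ)) (hρ : 0 < ρ) :
    wKPos δ₀ δ k t ρ = Real.exp (-psiK δ₀ δ k t ρ) := by
  have habs := abs_of_pos hρ
  unfold wKPos psiK
  by_cases hk : 1 ≤ k ∧ (k : ℝ) ≤ √(δ ^ 3 * ρ)
  · obtain ⟨m, rfl⟩ : ∃ m : ℕ, k = (m + 1 : ℕ) :=
      ⟨(k - 1).toNat, by have := hk.1; omega⟩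
    have hkM : m + 1 ≤ kMax δ ρ := Nat.le_floor (by exact_mod_cast hk.2)
    rw [if_pos hk, Int.cast_natCast, neg_add, Real.exp_add]
    split_ifs with hc
    · obtain ⟨-, -, h1, h2⟩ := hc
      simp only [Int.toNat_natCast, add_tsub_cancel_right] at h1 h2
      have h3 : tCrit (kMax δ ρ) ρ ≤ t := (tCrit_antitone hρ hkM).trans h1
      unfold wR
      rw [if_neg h, habs, if_pos h3, wRFrom_eq_of_mem hρ h3 hkM h1 h2, wNRFrom_eq hρ _ _ h3,
        psi_of_ge (show tEnd δ ρ ≤ t from h3)]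
    · have h1 : ¬ t ∈ resInterval ((m + 1 : ℕ) : ℤ).toNat ρ := fun h => hc ⟨hk.1, hk.2, h⟩
      simp only [resInterval, Int.toNat_natCast, add_tsub_cancel_right, Set.mem_Icc,
        not_and_or, not_le] at h1
      rw [wNR_eq h (by rwa [habs]), habs,
        res_succ_eq_zero hρ (h1.imp le_of_lt le_of_lt)]
      simp
  · rw [if_neg hk, if_neg (fun h => hk ⟨h.1, h.2.1⟩), wNR_eq h (by rwa [habs]), habs, add_zero]

theorem wK_eq {δ₀ δ t ρ : ℝ} {k : ℤ} (hδ : 0 < δ) :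
    wK δ₀ δ k t ρ = Real.exp (-bigPsi δ₀ δ k t ρ) := by
  unfold wK bigPsi
  split_ifs with h h1
  · simp
  · exact wKPos_eq h h1
  · have h2 : 0 < |ρ| := lt_trans (by positivity : 0 < δ ^ (-10 : ℤ)) (not_le.1 h)
    have h3 : 0 < -ρ := by
      rw [abs_of_nonpos (not_lt.1 h1)] at h2
      exact h2
    exact wKPos_eq (by rwa [abs_neg]) h3

theorem bigPsi_neg {δ₀ δ t ρ : ℝ} {k : ℤ} (hδ : 0 < δ) :
    bigPsi δ₀ δ k t (-ρ) = bigPsi δ₀ δ (-k) t ρ := by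
  unfold bigPsi
  rw [abs_neg]
  by_cases h : |ρ| ≤ δ ^ (-10 : ℤ)
  · rw [if_pos h, if_pos h]
  rw [if_neg h, if_neg h]
  have h2 : 0 < |ρ| := lt_trans (by positivity : 0 < δ ^ (-10 : ℤ)) (not_le.1 h)
  rcases lt_or_gt_of_ne (abs_pos.1 h2) with h | h
  · rw [if_pos (by linarith), if_neg (by linarith), neg_neg]
  · rw [if_neg (by linarith), if_pos h, neg_neg]

theorem bigPsi_of_lt {δ₀ δ t ρ : ℝ} {k : ℤ} (hδ : 0 < δ) (h : δ ^ (-10 : ℤ) < ρ) :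
    bigPsi δ₀ δ k t ρ = psiK δ₀ δ k t ρ := by
  have h0 : 0 < ρ := lt_trans (by positivity : 0 < δ ^ (-10 : ℤ)) h
  unfold bigPsi
  rw [abs_of_pos h0, if_neg (not_le.2 h), if_pos h0]

/-! ### Bounds for the resonant factor -/

theorem ell_le_mul (δ : ℝ) {x : ℝ} (hx : 0 ≤ x) : ell δ x ≤ δ ^ 2 * x := by
  have := one_le_ell_arg δ hx
  have := Real.log_le_sub_one_of_pos (x := 1 + δ ^ 2 * x) (by linarith)
  unfold ell
  linarith

theorem abs_res_sub_le {δ k t ρ ρ' : ℝ} (hδ : 0 ≤ δ) (hk : 1 ≤ k) (hρ : 0 < ρ) (hρ' : 0 < ρ') :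
    |res δ k t ρ - res δ k t ρ'| ≤ 4 * δ * √|ρ - ρ'| := by
  have hk0 : 0 < k := by linarith
  have a1 : |ρ / (8 * k ^ 2) - ρ' / (8 * k ^ 2)| ≤ |ρ - ρ'| := by
    rw [← sub_div, abs_div, abs_of_pos (by positivity : 0 < 8 * k ^ 2)]
    exact div_le_self (abs_nonneg _) (by nlinarith)
  have a2 : |t - ρ / k - (t - ρ' / k)| ≤ |ρ - ρ'| := by
    have : t - ρ / k - (t - ρ' / k) = -((ρ - ρ') / k) := by ring
    rw [this, abs_neg, abs_div, abs_of_pos hk0]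
    exact div_le_self (abs_nonneg _) hk
  have a3 : |min |t - ρ / k| (ρ / (8 * k ^ 2)) - min |t - ρ' / k| (ρ' / (8 * k ^ 2))| ≤ |ρ - ρ'| :=
    (abs_min_sub_min_le_max _ _ _ _).trans
      (max_le ((abs_abs_sub_abs_le_abs_sub _ _).trans a2) a1)
  have b1 := (abs_ell_sub_le δ (x := ρ / (8 * k ^ 2)) (y := ρ' / (8 * k ^ 2)) (by positivity)
    (by positivity)).trans (ell_mono δ (abs_nonneg _) a1)
  have b2 := (abs_ell_sub_le δ (x := min |t - ρ / k| (ρ / (8 * k ^ 2)))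
    (y := min |t - ρ' / k| (ρ' / (8 * k ^ 2))) (by positivity) (by positivity)).trans
    (ell_mono δ (abs_nonneg _) a3)
  have b3 := ell_le_sqrt hδ (abs_nonneg (ρ - ρ'))
  unfold res
  rw [abs_le] at *
  constructor <;> linarith

/-- A nonzero correction forces ρ/k ≤ 2t, hence ρ/k² ≤ 4t²/ρ ≤ 4K, and the logarithm is at most δ²
times its argument. -/
theorem res_le_of_le {δ k t ρ K : ℝ} (hk : 1 ≤ k) (hρ : 0 < ρ) (ht : 0 ≤ t) (hK : t ^ 2 ≤ K * ρ) :
    res δ k t ρ ≤ δ ^ 2 * K := by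
  have hk0 : 0 < k := by linarith
  have hK0 : 0 ≤ K := nonneg_of_mul_nonneg_left ((sq_nonneg t).trans hK) hρ
  rcases le_or_gt (ρ / (8 * k ^ 2)) |t - ρ / k| with h | h
  · rw [res_eq_zero h]
    positivity
  refine (res_le hρ _ _).trans ((ell_le_mul δ (by positivity)).trans ?_)
  gcongr
  have h1 : ρ / (8 * k ^ 2) ≤ ρ / k / 8 := by
    rw [div_div, div_le_div_iff₀ (by positivity) (by positivity)]
    nlinarith [mul_pos hρ hk0]
  have h2 := neg_abs_le (t - ρ / k)
  have h3 : ρ / k ≤ 2 * t := by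
    have : 0 ≤ ρ / k := by positivity
    linarith
  have h4 : (ρ / k) ^ 2 ≤ (2 * t) ^ 2 := by gcongr
  rw [div_pow, div_le_iff₀ (by positivity)] at h4
  rw [div_le_iff₀ (by positivity)]
  have : ρ * ρ ≤ K * (8 * k ^ 2) * ρ := by
    have := mul_le_mul_of_nonneg_right hK (sq_nonneg k)
    nlinarith [mul_nonneg (mul_nonneg hK0 (sq_nonneg k)) hρ.le]
  exact le_of_mul_le_mul_right this hρ

/-! ### Frequency variation of -log w_k at positive frequencies. -/

section
variable {δ₀ δ ρ ρ' t : ℝ} {k : ℤ}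

theorem psiK_nonneg (hδ₀ : 0 ≤ δ₀) (hδ : 0 ≤ δ) (hρ : 0 < ρ) (ht : 0 ≤ t) :
    0 ≤ psiK δ₀ δ k t ρ := by
  have := psi_nonneg hδ₀ hδ hρ ht
  have := res_nonneg (δ := δ) hρ k t
  unfold psiK
  split_ifs <;> linarith

theorem psiK_le (hδ₀ : 0 ≤ δ₀) (hδ : 0 < δ) (hδ1 : δ ≤ 1) (hρ : 0 < ρ) (ht : 0 ≤ t) :
    psiK δ₀ δ k t ρ ≤ 10 * (1 + 2 * δ₀) * δ * √ρ := by
  have h1 := psi_le hδ₀ hδ hδ1 hρ ht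
  have h2 : 0 ≤ δ * √ρ := by positivity
  have h3 : (if 1 ≤ k ∧ (k : ℝ) ≤ √(δ ^ 3 * ρ) then res δ k t ρ else 0) ≤ 2 * δ * √ρ := by
    split_ifs with h
    · have hk : (1 : ℝ) ≤ k := by exact_mod_cast h.1
      refine (res_le hρ _ _).trans ((ell_le_sqrt hδ.le (by positivity)).trans ?_)
      gcongr
      exact div_le_self hρ.le (by nlinarith)
    · linarith
  unfold psiK
  nlinarith

theorem abs_resIte_sub_le (hδ : 0 < δ) (hρ : 0 < ρ) (h : ρ ≤ ρ') :
    |(if 1 ≤ k ∧ (k : ℝ) ≤ √(δ ^ 3 * ρ) then res δ k t ρ else 0) -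
      (if 1 ≤ k ∧ (k : ℝ) ≤ √(δ ^ 3 * ρ') then res δ k t ρ' else 0)| ≤
      4 * δ * √(ρ' - ρ) + 1 / δ := by
  have hρ' := hρ.trans_le h
  have hb : |ρ - ρ'| = ρ' - ρ := by rw [abs_sub_comm, abs_of_nonneg (by linarith)]
  have hδ0 : 0 ≤ 1 / δ := by positivity
  have h0 : 0 ≤ 4 * δ * √(ρ' - ρ) + 1 / δ := by positivity
  by_cases hk1 : 1 ≤ k
  swap
  · simpa [hk1] using h0
  have hk : (1 : ℝ) ≤ k := by exact_mod_cast hk1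
  have hd := abs_res_sub_le (t := t) hδ.le hk hρ hρ'
  rw [hb] at hd
  simp only [hk1, true_and]
  have hs : √(δ ^ 3 * ρ) ≤ √(δ ^ 3 * ρ') := Real.sqrt_le_sqrt (by gcongr)
  split_ifs with h1 h2 h2
  · linarith
  · linarith
  · push Not at h1
    -- When only ρ' passes the cutoff, ρ < k²/δ³, so the correction at ρ is bounded; the one at ρ'
    -- is reached by the Lipschitz-type bound.
    have h3 : res δ k t ρ ≤ 1 / δ := by
      refine (res_le hρ _ _).trans ((ell_le_mul δ (by positivity)).trans ?_)
      rw [Real.sqrt_lt (by positivity) (by linarith)] at h1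
      rw [mul_div_assoc', div_le_div_iff₀ (by positivity) hδ]
      nlinarith
    have h4 := res_nonneg (δ := δ) hρ k t
    rw [abs_le] at *
    constructor <;> linarith
  · simpa using h0

theorem div_sqrt_le_sqrt (hρ : 0 < ρ) (h : ρ ≤ ρ') : (ρ' - ρ) / √ρ' ≤ √(ρ' - ρ) := by
  have hρ' := hρ.trans_le h
  rw [div_le_iff₀ (Real.sqrt_pos.2 hρ')]
  have h1 : √(ρ' - ρ) ≤ √ρ' := Real.sqrt_le_sqrt (by linarith)
  calc ρ' - ρ = √(ρ' - ρ) * √(ρ' - ρ) := (Real.mul_self_sqrt (by linarith)).symm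
    _ ≤ _ := by gcongr

theorem sqrt_mul_div_le (hρ : 0 < ρ) (h : ρ ≤ ρ') (ht2 : t ≤ 2 * ρ') :
    √(t * (ρ' - ρ) / ρ') ≤ 2 * √(ρ' - ρ) := by
  have hρ' := hρ.trans_le h
  have hζ : 0 ≤ ρ' - ρ := by linarith
  calc √(t * (ρ' - ρ) / ρ') ≤ √(2 ^ 2 * (ρ' - ρ)) := by
        apply Real.sqrt_le_sqrt
        rw [div_le_iff₀ hρ']
        nlinarith [mul_nonneg hζ hρ'.le, mul_le_mul_of_nonneg_right ht2 hζ]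
    _ = _ := by rw [Real.sqrt_mul (by norm_num), Real.sqrt_sq (by norm_num)]

theorem tEnd_le_two_mul (hρ : 0 < ρ) : tEnd δ ρ ≤ 2 * ρ := by
  have : tEnd δ ρ ≤ tCrit 0 ρ := tCrit_antitone hρ (Nat.zero_le _)
  simpa [tCrit] using this

theorem abs_psiK_sub_le (hδ₀ : 0 ≤ δ₀) (hδ : 0 < δ) (hδ1 : δ ≤ 1) (hρ : 4 ≤ δ ^ 3 * ρ)
    (h : ρ ≤ ρ') (h4 : ρ' ≤ 4 * ρ) (ht : 0 ≤ t) :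
    |psiK δ₀ δ k t ρ - psiK δ₀ δ k t ρ'| ≤
      200 * (1 + 2 * δ₀) * √δ * √(ρ' - ρ) + 201 * (1 + 2 * δ₀) / δ := by
  have hρ0 := pos_of_four_le hδ hρ
  have hρ0' := hρ0.trans_le h
  have h1 := abs_resIte_sub_le (k := k) (t := t) hδ hρ0 h
  have h2 : |psi δ₀ δ t ρ - psi δ₀ δ t ρ'| ≤
      180 * (1 + 2 * δ₀) * √δ * √(ρ' - ρ) + 200 * (1 + 2 * δ₀) / δ := by
    rcases le_or_gt t (2 * ρ') with h' | h'
    · refine (abs_psi_sub_le hδ₀ hδ hδ1 hρ h h4 ht h'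
        ((tEnd_le_two_mul hρ0).trans (by linarith)) (tEnd_le_two_mul hρ0')).trans ?_
      have a1 := div_sqrt_le_sqrt hρ0 h
      have a2 := sqrt_mul_div_le hρ0 h le_rfl
      have := mul_le_mul_of_nonneg_left (add_le_add a1 a2)
        (by positivity : 0 ≤ 60 * (1 + 2 * δ₀) * √δ)
      linarith
    · rw [psi_eq_zero hρ0 (by linarith), psi_eq_zero hρ0' h'.le, sub_zero, abs_zero]
      positivity
  have hsδ : δ ≤ √δ := by
    have := Real.mul_self_sqrt hδ.le
    nlinarith [Real.sqrt_le_one.2 hδ1, Real.sqrt_nonneg δ]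
  have h3 : δ * √(ρ' - ρ) ≤ √δ * √(ρ' - ρ) := by gcongr
  have h4 : 0 ≤ √δ * √(ρ' - ρ) := by positivity
  have h5 : 1 / δ ≤ (1 + 2 * δ₀) / δ := by gcongr; linarith
  have h6 : 201 * (1 + 2 * δ₀) / δ = 200 * (1 + 2 * δ₀) / δ + (1 + 2 * δ₀) / δ := by ring
  have h7 : 4 * (δ * √(ρ' - ρ)) ≤ 20 * (1 + 2 * δ₀) * (√δ * √(ρ' - ρ)) := by nlinarith
  unfold psiK
  rw [abs_le] at *
  constructor <;> linarith

/-- For times and shifts at most K√ρ', the horizon τ = K√ρ' bounds both variation terms by K, and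
the resonant corrections are individually bounded. -/
theorem abs_psiK_sub_le_of_le {K : ℝ} (hδ₀ : 0 ≤ δ₀) (hδ : 0 < δ) (hδ1 : δ ≤ 1)
    (hρ : 4 ≤ δ ^ 3 * ρ) (h : ρ ≤ ρ') (h4 : ρ' ≤ 4 * ρ) (ht : 0 ≤ t) (hK : 2 / (δ * √δ) ≤ K)
    (htK : t ≤ K * √ρ') (hζK : ρ' - ρ ≤ K * √ρ') :
    |psiK δ₀ δ k t ρ - psiK δ₀ δ k t ρ'| ≤
      120 * (1 + 2 * δ₀) * √δ * K + 200 * (1 + 2 * δ₀) / δ + 4 * δ ^ 2 * K ^ 2 := by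
  have hρ0 := pos_of_four_le hδ hρ
  have hρ0' := hρ0.trans_le h
  have hρ' : 4 ≤ δ ^ 3 * ρ' := hρ.trans (by gcongr)
  have hζ : 0 ≤ ρ' - ρ := by linarith
  have hr' := Real.sqrt_pos.2 hρ0'
  have hsq := Real.mul_self_sqrt hρ0'.le
  have hK0 : 0 ≤ K := le_trans (by positivity) hK
  have T1 : tEnd δ ρ ≤ K * √ρ' := by
    refine (abs_tEnd_sub_le hδ hρ).2.2.trans ?_
    rw [mul_div_right_comm]
    gcongr
  have T2 : tEnd δ ρ' ≤ K * √ρ' := by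
    refine (abs_tEnd_sub_le hδ hρ').2.2.trans ?_
    rw [mul_div_right_comm]
    gcongr
  have h1 := abs_psi_sub_le hδ₀ hδ hδ1 hρ h h4 ht htK T1 T2
  have a1 : (ρ' - ρ) / √ρ' ≤ K := (div_le_iff₀ hr').2 hζK
  have a2 : √(K * √ρ' * (ρ' - ρ) / ρ') ≤ K := by
    rw [Real.sqrt_le_left hK0, div_le_iff₀ hρ0']
    calc K * √ρ' * (ρ' - ρ) ≤ K * √ρ' * (K * √ρ') := by gcongr
      _ = K ^ 2 * ρ' := by linear_combination K ^ 2 * hsq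
  have a3 := mul_le_mul_of_nonneg_left (add_le_add a1 a2)
    (by positivity : 0 ≤ 60 * (1 + 2 * δ₀) * √δ)
  have t2 : t ^ 2 ≤ K ^ 2 * ρ' := by
    calc t ^ 2 ≤ (K * √ρ') ^ 2 := by gcongr
      _ = K ^ 2 * ρ' := by linear_combination K ^ 2 * hsq
  have t3 : t ^ 2 ≤ 4 * K ^ 2 * ρ := by nlinarith [sq_nonneg K]
  have r1 : 0 ≤ (if 1 ≤ k ∧ (k : ℝ) ≤ √(δ ^ 3 * ρ) then res δ k t ρ else 0) ∧
      (if 1 ≤ k ∧ (k : ℝ) ≤ √(δ ^ 3 * ρ) then res δ k t ρ else 0) ≤ 4 * δ ^ 2 * K ^ 2 := by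
    split_ifs with hk
    · have := res_le_of_le (δ := δ) (by exact_mod_cast hk.1 : (1 : ℝ) ≤ k) hρ0 ht t3
      exact ⟨res_nonneg hρ0 _ _, by linarith⟩
    · exact ⟨le_rfl, by positivity⟩
  have r2 : 0 ≤ (if 1 ≤ k ∧ (k : ℝ) ≤ √(δ ^ 3 * ρ') then res δ k t ρ' else 0) ∧
      (if 1 ≤ k ∧ (k : ℝ) ≤ √(δ ^ 3 * ρ') then res δ k t ρ' else 0) ≤ 4 * δ ^ 2 * K ^ 2 := by
    have hKK : 0 ≤ δ ^ 2 * K ^ 2 := by positivity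
    split_ifs with hk
    · have := res_le_of_le (δ := δ) (by exact_mod_cast hk.1 : (1 : ℝ) ≤ k) hρ0' ht t2
      exact ⟨res_nonneg hρ0' _ _, by linarith⟩
    · exact ⟨le_rfl, by positivity⟩
  obtain ⟨r1, r1'⟩ := r1
  obtain ⟨r2, r2'⟩ := r2
  unfold psiK
  rw [abs_le] at *
  constructor <;> linarith

/-- No additive constant appears: past both last critical times neither the affine regime nor the
cutoff in k intervenes. This is essential for a relative error that is small with δ. -/
theorem abs_psiK_sub_le_of_ge (hδ₀ : 0 ≤ δ₀) (hδ : 0 < δ) (hδ1 : δ ≤ 1)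
    (hρ : 4 ≤ δ ^ 3 * ρ) (h : ρ ≤ ρ') (h4 : ρ' ≤ 4 * ρ) (htρ : 4 * √ρ' / (δ * √δ) ≤ t) :
    |psiK δ₀ δ k t ρ - psiK δ₀ δ k t ρ'| ≤ 40 * (1 + 2 * δ₀) * δ * √(ρ' - ρ) := by
  have hρ0 := pos_of_four_le hδ hρ
  have hρ0' := hρ0.trans_le h
  have hρ' : 4 ≤ δ ^ 3 * ρ' := hρ.trans (by gcongr)
  have hζ : 0 ≤ ρ' - ρ := by linarith
  have hr' := Real.sqrt_pos.2 hρ0'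
  have hsδ := Real.sqrt_pos.2 hδ
  have htρ2 : 2 * √ρ' / (δ * √δ) ≤ t / 2 := by
    have : 4 * √ρ' / (δ * √δ) = 2 * (2 * √ρ' / (δ * √δ)) := by ring
    linarith
  have ht0 : 0 ≤ t := le_trans (by positivity) htρ
  have hsρ : √ρ ≤ √ρ' := Real.sqrt_le_sqrt h
  have T1 : tEnd δ ρ ≤ t := by
    refine (abs_tEnd_sub_le hδ hρ).2.2.trans (le_trans ?_ (htρ2.trans (by linarith)))
    gcongr
  have T2 : tEnd δ ρ' ≤ t :=
    (abs_tEnd_sub_le hδ hρ').2.2.trans (htρ2.trans (by linarith))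
  have h2 : |psi δ₀ δ t ρ - psi δ₀ δ t ρ'| ≤ 36 * (1 + 2 * δ₀) * δ * √(ρ' - ρ) := by
    rcases le_or_gt t (2 * ρ') with h' | h'
    · refine (abs_psi_sub_le_of_ge hδ₀ hδ hδ1 hρ h h4 T1 T2).trans ?_
      have a1 := div_sqrt_le_sqrt hρ0 h
      have a2 := sqrt_mul_div_le hρ0 h h'
      have := mul_le_mul_of_nonneg_left (add_le_add a1 a2)
        (by positivity : 0 ≤ 12 * (1 + 2 * δ₀) * δ)
      linarith
    · rw [psi_eq_zero hρ0 (by linarith), psi_eq_zero hρ0' h'.le, sub_zero, abs_zero]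
      positivity
  have hb : |ρ - ρ'| = ρ' - ρ := by rw [abs_sub_comm, abs_of_nonneg (by linarith)]
  have h3 : |(if 1 ≤ k ∧ (k : ℝ) ≤ √(δ ^ 3 * ρ) then res δ k t ρ else 0) -
      (if 1 ≤ k ∧ (k : ℝ) ≤ √(δ ^ 3 * ρ') then res δ k t ρ' else 0)| ≤ 4 * δ * √(ρ' - ρ) := by
    have h0 : 0 ≤ 4 * δ * √(ρ' - ρ) := by positivity
    by_cases hk1 : 1 ≤ k
    swap
    · simpa [hk1] using h0
    have hk : (1 : ℝ) ≤ k := by exact_mod_cast hk1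
    have hk0 : (0 : ℝ) < k := by linarith
    have hd := abs_res_sub_le (t := t) hδ.le hk hρ0 hρ0'
    rw [hb] at hd
    simp only [hk1, true_and]
    have hs : √(δ ^ 3 * ρ) ≤ √(δ ^ 3 * ρ') := Real.sqrt_le_sqrt (by gcongr)
    split_ifs with g1 g2 g2
    · exact hd
    · linarith
    · push Not at g1
      rw [res_eq_zero]
      · simpa using h0
      rw [sqrt_cube_mul hδ.le] at g1
      have hρρ : √ρ' ≤ 2 * √ρ := by
        calc √ρ' ≤ √(2 ^ 2 * ρ) := Real.sqrt_le_sqrt (by linarith)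
          _ = 2 * √ρ := by rw [Real.sqrt_mul (by norm_num), Real.sqrt_sq (by norm_num)]
      -- A k between the two cutoffs is resonant at time at most t/2, so t is outside its window and
      -- the correction is zero.
      have h5 : ρ' / k ≤ 2 * √ρ' / (δ * √δ) := by
        rw [div_le_div_iff₀ hk0 (by positivity)]
        have h6 : √ρ' * (δ * √δ) ≤ 2 * k := by
          have := mul_le_mul_of_nonneg_left hρρ (by positivity : 0 ≤ δ * √δ)
          linarith
        have := mul_le_mul_of_nonneg_left h6 hr'.le
        rw [← mul_assoc, Real.mul_self_sqrt hρ0'.le] at this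
        linarith
      have h7 : ρ' / (8 * k ^ 2) ≤ ρ' / k := by
        rw [div_le_div_iff₀ (by positivity) hk0]
        nlinarith [mul_pos hρ0' hk0]
      exact le_trans (by linarith) (le_abs_self _)
    · simpa using h0
  have h8 : 0 ≤ δ * √(ρ' - ρ) := by positivity
  have h9 : 4 * (δ * √(ρ' - ρ)) ≤ 4 * (1 + 2 * δ₀) * (δ * √(ρ' - ρ)) := by nlinarith
  unfold psiK
  rw [abs_le] at *
  constructor <;> linarith

end


/-! ### Frequency variation of -log w_k for both signs, and measurability. -/

section
variable {δ₀ δ : ℝ}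

theorem four_le_of_lt {ρ : ℝ} (hδ : 0 < δ) (hδ2 : δ ≤ 1 / 2) (h : δ ^ (-10 : ℤ) < ρ) :
    4 ≤ δ ^ 3 * ρ := by
  have e : δ ^ (-10 : ℤ) = 1 / δ ^ 10 := by
    rw [zpow_neg, one_div]
    norm_cast
  rw [e, div_lt_iff₀ (by positivity)] at h
  have h7 : δ ^ 7 ≤ (1 / 2) ^ 7 := by gcongr
  have h8 : 0 < δ ^ 7 := by positivity
  have : 4 * δ ^ 7 ≤ δ ^ 3 * ρ * δ ^ 7 := by nlinarith
  exact le_of_mul_le_mul_right this h8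

theorem bigPsi_nonneg (hδ₀ : 0 ≤ δ₀) (hδ : 0 < δ) {k : ℤ} {t : ℝ} (ht : 0 ≤ t) (ρ : ℝ) :
    0 ≤ bigPsi δ₀ δ k t ρ := by
  unfold bigPsi
  split_ifs with h h1
  · exact le_rfl
  · exact psiK_nonneg hδ₀ hδ.le h1 ht
  · rcases lt_or_eq_of_le (not_lt.1 h1) with h2 | h2
    · exact psiK_nonneg hδ₀ hδ.le (by linarith) ht
    · exact absurd (by rw [h2, abs_zero]; positivity) h

theorem bigPsi_le (hδ₀ : 0 ≤ δ₀) (hδ : 0 < δ) (hδ1 : δ ≤ 1) {k : ℤ} {t : ℝ} (ht : 0 ≤ t) (ρ : ℝ) :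
    bigPsi δ₀ δ k t ρ ≤ 10 * (1 + 2 * δ₀) * δ * √|ρ| := by
  unfold bigPsi
  split_ifs with h h1
  · positivity
  · rw [abs_of_pos h1]
    exact psiK_le hδ₀ hδ hδ1 h1 ht
  · rcases lt_or_eq_of_le (not_lt.1 h1) with h2 | h2
    · rw [abs_of_neg h2]
      exact psiK_le hδ₀ hδ hδ1 (by linarith) ht
    · exact absurd (by rw [h2, abs_zero]; positivity) h

theorem sqrt_add_le (x y : ℝ) (hx : 0 ≤ x) (hy : 0 ≤ y) : √(x + y) ≤ √x + √y := by
  rw [Real.sqrt_le_left (by positivity)]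
  have := Real.sq_sqrt hx
  have := Real.sq_sqrt hy
  nlinarith [mul_nonneg (Real.sqrt_nonneg x) (Real.sqrt_nonneg y)]

/-- Comparable large frequencies of one sign use the variation bound. In all other cases √ρ' is
controlled by √(ρ'-ρ) plus a constant, and the size bound O(δ√ρ') is enough. -/
theorem exists_abs_bigPsi_sub_le (hδ₀ : 0 ≤ δ₀) (hδ : 0 < δ) (hδ2 : δ ≤ 1 / 2) :
    ∃ M : ℝ, 0 ≤ M ∧ ∀ (k : ℤ) (t ρ ρ' : ℝ), 0 ≤ t →
      |bigPsi δ₀ δ k t ρ - bigPsi δ₀ δ k t ρ'| ≤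
        M + 200 * (1 + 2 * δ₀) * √δ * √|ρ - ρ'| := by
  have hD : 0 < δ ^ (-10 : ℤ) := by positivity
  have hδ1 : δ ≤ 1 := by linarith
  have hsδ : δ ≤ √δ := by
    have := Real.mul_self_sqrt hδ.le
    nlinarith [Real.sqrt_le_one.2 hδ1, Real.sqrt_nonneg δ]
  set M := 201 * (1 + 2 * δ₀) / δ + 10 * (1 + 2 * δ₀) * √(δ ^ (-10 : ℤ)) with hM
  have hM0 : 0 ≤ M := by positivity
  refine ⟨M, hM0, ?_⟩
  intro k t ρ ρ' ht
  wlog hle : |ρ| ≤ |ρ'| generalizing ρ ρ'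
  · rw [abs_sub_comm, abs_sub_comm ρ ρ']
    exact this ρ' ρ (by linarith)
  wlog hpos : 0 ≤ ρ' generalizing k ρ ρ'
  · have h1 := this (-k) (-ρ) (-ρ') (by rwa [abs_neg, abs_neg]) (by linarith)
    rw [bigPsi_neg hδ, bigPsi_neg hδ, neg_neg] at h1
    have e : |-ρ - -ρ'| = |ρ - ρ'| := by rw [← abs_neg]; ring_nf
    rwa [e] at h1
  rw [abs_of_nonneg hpos] at hle
  have hρρ' : ρ ≤ ρ' := (le_abs_self ρ).trans hle
  have hb : |ρ - ρ'| = ρ' - ρ := by rw [abs_sub_comm, abs_of_nonneg (by linarith)]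
  rw [hb]
  have hz : 0 ≤ 200 * (1 + 2 * δ₀) * √δ * √(ρ' - ρ) := by positivity
  rcases le_or_gt ρ' (δ ^ (-10 : ℤ)) with h1 | h1
  · unfold bigPsi
    rw [if_pos (hle.trans h1), if_pos (by rwa [abs_of_nonneg hpos]), sub_zero, abs_zero]
    positivity
  by_cases h2 : δ ^ (-10 : ℤ) < ρ ∧ ρ' ≤ 4 * ρ
  · rw [bigPsi_of_lt hδ h1, bigPsi_of_lt hδ h2.1]
    refine (abs_psiK_sub_le hδ₀ hδ hδ1 (four_le_of_lt hδ hδ2 h2.1) hρρ' h2.2 ht).trans ?_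
    rw [hM]
    have : 0 ≤ 10 * (1 + 2 * δ₀) * √(δ ^ (-10 : ℤ)) := by positivity
    linarith
  have h3 : √ρ' ≤ 2 * √(ρ' - ρ) + √(δ ^ (-10 : ℤ)) := by
    rcases le_or_gt ρ (δ ^ (-10 : ℤ)) with h | h
    · calc √ρ' ≤ √((ρ' - ρ) + δ ^ (-10 : ℤ)) := Real.sqrt_le_sqrt (by linarith)
        _ ≤ √(ρ' - ρ) + √(δ ^ (-10 : ℤ)) := sqrt_add_le _ _ (by linarith) hD.le
        _ ≤ _ := by linarith [Real.sqrt_nonneg (ρ' - ρ)]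
    · have h4 : 4 * ρ < ρ' := by
        by_contra hc
        exact h2 ⟨h, not_lt.1 hc⟩
      have : √ρ' ≤ 2 * √(ρ' - ρ) := by
        calc √ρ' ≤ √(2 ^ 2 * (ρ' - ρ)) := Real.sqrt_le_sqrt (by linarith)
          _ = _ := by rw [Real.sqrt_mul (by norm_num), Real.sqrt_sq (by norm_num)]
      linarith [Real.sqrt_nonneg (δ ^ (-10 : ℤ))]
  have b1 := bigPsi_nonneg hδ₀ hδ (k := k) ht ρ
  have b2 := bigPsi_nonneg hδ₀ hδ (k := k) ht ρ'
  have b3 := bigPsi_le hδ₀ hδ hδ1 (k := k) ht ρ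
  have b4 := bigPsi_le hδ₀ hδ hδ1 (k := k) ht ρ'
  rw [abs_of_nonneg hpos] at b4
  have hs : √|ρ| ≤ √ρ' := Real.sqrt_le_sqrt hle
  have b5 : 10 * (1 + 2 * δ₀) * δ * √|ρ| ≤ 10 * (1 + 2 * δ₀) * δ * √ρ' := by gcongr
  have b6 : 10 * (1 + 2 * δ₀) * δ * √ρ' ≤ M + 200 * (1 + 2 * δ₀) * √δ * √(ρ' - ρ) := by
    calc 10 * (1 + 2 * δ₀) * δ * √ρ'
        ≤ 10 * (1 + 2 * δ₀) * δ * (2 * √(ρ' - ρ) + √(δ ^ (-10 : ℤ))) := by gcongr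
      _ = 20 * (1 + 2 * δ₀) * δ * √(ρ' - ρ) + 10 * (1 + 2 * δ₀) * δ * √(δ ^ (-10 : ℤ)) := by ring
      _ ≤ 200 * (1 + 2 * δ₀) * √δ * √(ρ' - ρ) + 10 * (1 + 2 * δ₀) * 1 * √(δ ^ (-10 : ℤ)) := by
        gcongr
        norm_num
      _ ≤ _ := by
        rw [hM]
        have : 0 ≤ 201 * (1 + 2 * δ₀) / δ := by positivity
        linarith
  rw [abs_le]
  constructor <;> linarith

/-- A symmetric estimate for `bigPsi` near `ξ` follows from the case `ξ > 0`, `ρ ≤ ρ'`. -/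
theorem bigPsi_local_of_psiK (hδ : 0 < δ) (hδ2 : δ ≤ 1 / 2) {t B ξ : ℝ} {F : ℝ → ℝ}
    (hξ : 2 * δ ^ (-10 : ℤ) ≤ |ξ|)
    (H : ∀ (k : ℤ) (ρ ρ' : ℝ), 4 ≤ δ ^ 3 * ρ → ρ ≤ ρ' → ρ' ≤ 4 * ρ → |ξ| ≤ 2 ^ 2 * ρ' →
      ρ' ≤ 2 ^ 2 * |ξ| → ρ' - ρ ≤ B →
      |psiK δ₀ δ k t ρ - psiK δ₀ δ k t ρ'| ≤ F (ρ' - ρ))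
    {k : ℤ} {ρ ρ' : ℝ} (hρ : |ρ - ξ| ≤ |ξ| / 3) (hρ' : |ρ' - ξ| ≤ |ξ| / 3) (hB : |ρ - ρ'| ≤ B) :
    |bigPsi δ₀ δ k t ρ - bigPsi δ₀ δ k t ρ'| ≤ F |ρ - ρ'| := by
  have hD : 0 < δ ^ (-10 : ℤ) := by positivity
  wlog hpos : 0 ≤ ξ generalizing k ξ ρ ρ'
  · have e : ∀ x y : ℝ, |-x - -y| = |x - y| := fun x y => by rw [← abs_neg]; ring_nf
    have h1 := this (ξ := -ξ) (k := -k) (ρ := -ρ) (ρ' := -ρ') (by rwa [abs_neg])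
      (by rwa [abs_neg]) (by rwa [e, abs_neg]) (by rwa [e, abs_neg]) (by rwa [e]) (by linarith)
    rw [bigPsi_neg hδ, bigPsi_neg hδ, neg_neg] at h1
    rwa [e] at h1
  wlog hle : ρ ≤ ρ' generalizing ρ ρ'
  · rw [abs_sub_comm, abs_sub_comm ρ ρ']
    exact this hρ' hρ (by rwa [abs_sub_comm]) (by linarith)
  rw [abs_of_nonneg hpos] at *
  have hb : |ρ - ρ'| = ρ' - ρ := by rw [abs_sub_comm, abs_of_nonneg (by linarith)]
  rw [hb] at hB ⊢
  rw [abs_le] at hρ hρ'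
  have h1 : δ ^ (-10 : ℤ) < ρ := by linarith
  rw [bigPsi_of_lt hδ h1, bigPsi_of_lt hδ (h1.trans_le hle)]
  exact H k ρ ρ' (four_le_of_lt hδ hδ2 h1) hle (by linarith) (by linarith) (by linarith) hB

theorem sqrt_le_two_mul {x y : ℝ} (h : x ≤ 2 ^ 2 * y) : √x ≤ 2 * √y :=
  (Real.sqrt_le_sqrt h).trans
    (by rw [Real.sqrt_mul (by norm_num), Real.sqrt_sq (by norm_num)])

theorem exists_abs_bigPsi_sub_le_of_le (hδ₀ : 0 ≤ δ₀) (hδ : 0 < δ) (hδ2 : δ ≤ 1 / 2) (K : ℝ) :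
    ∃ M : ℝ, 0 ≤ M ∧ ∀ (k : ℤ) (t ξ ρ ρ' : ℝ), 0 ≤ t → 2 * δ ^ (-10 : ℤ) ≤ |ξ| →
      t ≤ K * √|ξ| → |ρ - ξ| ≤ |ξ| / 3 → |ρ' - ξ| ≤ |ξ| / 3 → |ρ - ρ'| ≤ K * √|ξ| →
      |bigPsi δ₀ δ k t ρ - bigPsi δ₀ δ k t ρ'| ≤ M := by
  -- The factor 2 comes from √|ξ| ≤ 2√ρ'; the other entry puts both last critical times below K'√ρ'.
  set K' := max (2 * K) (2 / (δ * √δ)) with hK'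
  have h1 : 2 * K ≤ K' := le_max_left _ _
  have h2 : 2 / (δ * √δ) ≤ K' := le_max_right _ _
  have h3 : 0 ≤ K' := le_trans (by positivity) h2
  refine ⟨120 * (1 + 2 * δ₀) * √δ * K' + 200 * (1 + 2 * δ₀) / δ + 4 * δ ^ 2 * K' ^ 2,
    by positivity, ?_⟩
  intro k t ξ ρ ρ' ht hξ htK hρ hρ' hB
  refine bigPsi_local_of_psiK (F := fun _ => _) hδ hδ2 hξ ?_ hρ hρ' hB
  intro k ρ ρ' g1 g2 g3 g4 g5 g6
  have hK0 : K * √|ξ| ≤ K' * √ρ' := by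
    have := sqrt_le_two_mul g4
    rcases le_or_gt 0 K with hK | hK
    · calc K * √|ξ| ≤ K * (2 * √ρ') := by gcongr
        _ = 2 * K * √ρ' := by ring
        _ ≤ _ := by gcongr
    · have : K * √|ξ| ≤ 0 := mul_nonpos_of_nonpos_of_nonneg hK.le (Real.sqrt_nonneg _)
      exact this.trans (by positivity)
  exact abs_psiK_sub_le_of_le hδ₀ hδ (by linarith) g1 g2 g3 ht h2 (htK.trans hK0) (g6.trans hK0)

theorem abs_bigPsi_sub_le_of_ge (hδ₀ : 0 ≤ δ₀) (hδ : 0 < δ) (hδ2 : δ ≤ 1 / 2) {k : ℤ}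
    {t ξ ρ ρ' : ℝ} (hξ : 2 * δ ^ (-10 : ℤ) ≤ |ξ|) (htξ : 8 * √|ξ| / (δ * √δ) ≤ t)
    (hρ : |ρ - ξ| ≤ |ξ| / 3) (hρ' : |ρ' - ξ| ≤ |ξ| / 3) :
    |bigPsi δ₀ δ k t ρ - bigPsi δ₀ δ k t ρ'| ≤ 40 * (1 + 2 * δ₀) * δ * √|ρ - ρ'| := by
  refine bigPsi_local_of_psiK (F := fun x => 40 * (1 + 2 * δ₀) * δ * √x) hδ hδ2 hξ ?_ hρ hρ' le_rfl
  intro k ρ ρ' g1 g2 g3 g4 g5 g6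
  refine abs_psiK_sub_le_of_ge hδ₀ hδ (by linarith) g1 g2 g3 (le_trans ?_ htξ)
  have := sqrt_le_two_mul g5
  gcongr ?_ / _
  linarith

/-! ### Measurability -/

theorem measurable_ell : Measurable (ell δ) := by
  unfold ell
  fun_prop

theorem measurable_tCrit (n : ℕ) : Measurable (tCrit n) := by
  unfold tCrit
  split_ifs <;> fun_prop

theorem measurable_fpart (n : ℕ) {τ : ℝ → ℝ} (hτ : Measurable τ) :
    Measurable fun ρ => fpart δ₀ δ n (τ ρ) ρ := by
  have := measurable_ell (δ := δ)
  unfold fpart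
  fun_prop

theorem measurable_fsum (n : ℕ) {τ : ℝ → ℝ} (hτ : Measurable τ) :
    Measurable fun ρ => fsum δ₀ δ n (τ ρ) ρ := by
  unfold fsum
  exact Finset.measurable_fun_sum _ fun i _ => measurable_fpart i hτ

theorem measurable_res (k t : ℝ) : Measurable fun ρ => res δ k t ρ := by
  have := measurable_ell (δ := δ)
  unfold res
  fun_prop

theorem measurable_kMax : Measurable (kMax δ) := by
  unfold kMax
  exact Nat.measurable_floor.comp (f := fun η => √(δ ^ 3 * η)) (by fun_prop)

/-- The number of intervals depends measurably on ρ and takes countably many values, so each value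
may be treated separately. -/
theorem measurable_comp_kMax {g : ℕ → ℝ → ℝ} (hg : ∀ n, Measurable (g n)) :
    Measurable fun ρ => g (kMax δ ρ) ρ :=
  (measurable_from_prod_countable_right (f := fun p : ℕ × ℝ => g p.1 p.2) hg).comp
    (measurable_kMax.prodMk measurable_id)

theorem measurable_tEnd : Measurable (tEnd δ) :=
  measurable_comp_kMax measurable_tCrit

theorem measurable_psi (t : ℝ) : Measurable fun ρ => psi δ₀ δ t ρ := by
  have h1 : Measurable fun ρ => fsum δ₀ δ (kMax δ ρ) t ρ :=
    measurable_comp_kMax (g := fun n ρ => fsum δ₀ δ n t ρ)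
      fun n => measurable_fsum n measurable_const
  have h2 : Measurable fun ρ => fsum δ₀ δ (kMax δ ρ) (tEnd δ ρ) ρ :=
    measurable_comp_kMax (g := fun n ρ => fsum δ₀ δ n (tEnd δ ρ) ρ)
      fun n => measurable_fsum n measurable_tEnd
  have h3 := measurable_tEnd (δ := δ)
  unfold psi
  exact Measurable.ite (measurableSet_le h3 measurable_const) h1 (by fun_prop)

theorem measurable_resSum (t : ℝ) : Measurable fun ρ => resSum δ t ρ := by
  unfold resSum
  refine Measurable.ite (measurableSet_le measurable_tEnd measurable_const) ?_ measurable_const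
  exact measurable_comp_kMax
    (g := fun n ρ => ∑ i ∈ Finset.range n, res δ ((i + 1 : ℕ) : ℝ) t ρ)
    fun n => Finset.measurable_fun_sum _ fun i _ => measurable_res _ _

theorem measurable_psiK (k : ℤ) (t : ℝ) : Measurable fun ρ => psiK δ₀ δ k t ρ := by
  unfold psiK
  refine (measurable_psi t).add (Measurable.ite ?_ (measurable_res _ _) measurable_const)
  exact (MeasurableSet.const _).inter 
    (measurableSet_le (g := fun ρ => √(δ ^ 3 * ρ)) measurable_const (by fun_prop))

theorem measurable_bigPsi (k : ℤ) (t : ℝ) : Measurable fun ρ => bigPsi δ₀ δ k t ρ := by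
  unfold bigPsi
  refine Measurable.ite (measurableSet_le measurable_id.abs measurable_const) measurable_const
    (Measurable.ite (measurableSet_lt measurable_const measurable_id) (measurable_psiK k t) ?_)
  exact (measurable_psiK (-k) t).comp measurable_neg

theorem measurable_wK (hδ : 0 < δ) (k : ℤ) (t : ℝ) : Measurable (wK δ₀ δ k t) := by
  have : wK δ₀ δ k t = fun ρ => Real.exp (-bigPsi δ₀ δ k t ρ) := funext fun ρ => wK_eq hδ
  rw [this]
  exact Real.measurable_exp.comp (measurable_bigPsi k t).neg

theorem wR_eq_ite (hδ : 0 < δ) (t : ℝ) : wR δ₀ δ t = fun ρ => if |ρ| ≤ δ ^ (-10 : ℤ) then 1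
    else Real.exp (-(psi δ₀ δ t |ρ| + resSum δ t |ρ|)) := by
  funext ρ
  split_ifs with h
  · exact if_pos h
  · exact wR_eq h (lt_trans (by positivity : 0 < δ ^ (-10 : ℤ)) (not_le.1 h))

theorem measurable_wR (hδ : 0 < δ) (t : ℝ) : Measurable (wR δ₀ δ t) := by
  rw [wR_eq_ite hδ]
  refine Measurable.ite (measurableSet_le measurable_id.abs measurable_const) measurable_const ?_
  have h1 := (measurable_psi (δ₀ := δ₀) (δ := δ) t).comp (measurable_id.abs (α := ℝ))
  have h2 := (measurable_resSum (δ := δ) t).comp (measurable_id.abs (α := ℝ))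
  exact Real.measurable_exp.comp (h1.add h2).neg

theorem wR_pos (hδ : 0 < δ) (t ρ : ℝ) : 0 < wR δ₀ δ t ρ := by
  rw [wR_eq_ite hδ]
  dsimp only
  split_ifs <;> positivity

theorem wR_le_one (hδ₀ : 0 ≤ δ₀) (hδ : 0 < δ) {t : ℝ} (ht : 0 ≤ t) (ρ : ℝ) :
    wR δ₀ δ t ρ ≤ 1 := by
  rw [wR_eq_ite hδ]
  dsimp only
  split_ifs with h
  · exact le_rfl
  have h0 : 0 < |ρ| := lt_trans (by positivity : 0 < δ ^ (-10 : ℤ)) (not_le.1 h)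
  rw [Real.exp_le_one_iff, neg_nonpos]
  have h2 : 0 ≤ resSum δ t |ρ| := by
    unfold resSum
    split_ifs
    · exact Finset.sum_nonneg fun i _ => res_nonneg h0 _ _
    · exact le_rfl
  exact add_nonneg (psi_nonneg hδ₀ hδ.le h0 ht) h2

theorem wK_pos (hδ : 0 < δ) (k : ℤ) (t ρ : ℝ) : 0 < wK δ₀ δ k t ρ := by
  rw [wK_eq hδ]
  positivity

theorem wK_le_one (hδ₀ : 0 ≤ δ₀) (hδ : 0 < δ) (k : ℤ) {t : ℝ} (ht : 0 ≤ t) (ρ : ℝ) :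
    wK δ₀ δ k t ρ ≤ 1 := by
  rw [wK_eq hδ, Real.exp_le_one_iff, neg_nonpos]
  exact bigPsi_nonneg hδ₀ hδ ht ρ

end

open MeasureTheory

/-! ### Averages against the mollifier -/

/-- The average `d₀⁻¹ ∫ W(ξ - L x) φ(x) dx`. -/
noncomputable def avg (φ W : ℝ → ℝ) (ξ L : ℝ) : ℝ :=
  1 / (∫ x : ℝ, φ x) * ∫ x : ℝ, W (ξ - L * x) * φ x

section
variable {φ W : ℝ → ℝ}

theorem IsMollifier.eq_zero (hφ : IsMollifier φ) {x : ℝ} (hx : 8 / 5 < |x|) : φ x = 0 := by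
  by_contra h
  have h1 := hφ.support (subset_tsupport φ h)
  have := abs_le.2 h1
  linarith

theorem IsMollifier.hasCompactSupport (hφ : IsMollifier φ) : HasCompactSupport φ :=
  IsCompact.of_isClosed_subset isCompact_Icc (isClosed_tsupport φ) hφ.support

theorem IsMollifier.nonneg (hφ : IsMollifier φ) (x : ℝ) : 0 ≤ φ x := (hφ.mem_Icc x).1

theorem IsMollifier.integrable (hφ : IsMollifier φ) : Integrable φ :=
  hφ.smooth.continuous.integrable_of_hasCompactSupport hφ.hasCompactSupport

theorem IsMollifier.integral_pos (hφ : IsMollifier φ) : 0 < ∫ x, φ x := by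
  have h0 : φ 0 ≠ 0 := by
    rw [hφ.eq_one 0 (by constructor <;> norm_num)]
    exact one_ne_zero
  exact hφ.smooth.continuous.integral_pos_of_hasCompactSupport_nonneg_nonzero
    hφ.hasCompactSupport hφ.nonneg h0

theorem IsMollifier.exists_lipschitz (hφ : IsMollifier φ) :
    ∃ G : ℝ, 0 ≤ G ∧ ∀ x y, |φ x - φ y| ≤ G * |x - y| := by
  obtain ⟨C, hC⟩ := hφ.smooth.lipschitzWith_of_hasCompactSupport hφ.hasCompactSupport (by simp)
  refine ⟨C, C.2, fun x y => ?_⟩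
  have := hC.dist_le_mul x y
  rwa [Real.dist_eq, Real.dist_eq] at this

theorem integrable_mul_mollifier (hφ : IsMollifier φ) (hW : Measurable W) (h0 : ∀ x, 0 < W x)
    (h1 : ∀ x, W x ≤ 1) (ξ L : ℝ) : Integrable fun x => W (ξ - L * x) * φ x := by
  refine hφ.integrable.mono' ?_ (Filter.Eventually.of_forall fun x => ?_)
  · have := hφ.smooth.continuous.measurable
    exact Measurable.aestronglyMeasurable (by fun_prop)
  · rw [Real.norm_eq_abs, abs_of_nonneg (mul_nonneg (h0 _).le (hφ.nonneg x))]
    exact mul_le_of_le_one_left (hφ.nonneg x) (h1 _)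

/-- In the rescaled variable both windows share the same measure φ(x)dx, so averages at different
centres and lengths compare pointwise in x. -/
theorem avg_le_mul_avg {V : ℝ → ℝ} (hφ : IsMollifier φ) (hW : Measurable W) (hW0 : ∀ x, 0 < W x)
    (hW1 : ∀ x, W x ≤ 1) (hV : Measurable V) (hV0 : ∀ x, 0 < V x) (hV1 : ∀ x, V x ≤ 1)
    {ξ η L L' c : ℝ} (h : ∀ x, |x| ≤ 8 / 5 → W (ξ - L * x) ≤ c * V (η - L' * x)) :
    avg φ W ξ L ≤ c * avg φ V η L' := by
  have hd := hφ.integral_pos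
  unfold avg
  rw [mul_left_comm]
  gcongr
  rw [← integral_const_mul]
  refine integral_mono (integrable_mul_mollifier hφ hW hW0 hW1 ξ L)
    ((integrable_mul_mollifier hφ hV hV0 hV1 η L').const_mul c) fun x => ?_
  dsimp only
  rcases le_or_gt |x| (8 / 5) with hx | hx
  · rw [← mul_assoc]
    exact mul_le_mul_of_nonneg_right (h x hx) (hφ.nonneg x)
  · rw [hφ.eq_zero hx]
    simp

theorem avg_const (hφ : IsMollifier φ) (c ξ L : ℝ) : avg φ (fun _ => c) ξ L = c := by
  have hd := hφ.integral_pos.ne'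
  unfold avg
  rw [integral_const_mul]
  field_simp

theorem avg_le_one (hφ : IsMollifier φ) (hW : Measurable W) (hW0 : ∀ x, 0 < W x)
    (hW1 : ∀ x, W x ≤ 1) (ξ L : ℝ) : avg φ W ξ L ≤ 1 := by
  have := avg_le_mul_avg (V := fun _ => 1) (c := 1) (L := L) (L' := L) (ξ := ξ) (η := ξ) hφ hW hW0
    hW1 measurable_const (by simp) (by simp) (by simpa using fun x _ => hW1 _)
  rwa [avg_const hφ, one_mul] at this

theorem avg_pos (hφ : IsMollifier φ) (hW : Measurable W) (hW0 : ∀ x, 0 < W x)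
    (hW1 : ∀ x, W x ≤ 1) (ξ L : ℝ) : 0 < avg φ W ξ L := by
  have hd := hφ.integral_pos
  refine mul_pos (by positivity) ?_
  rw [integral_pos_iff_support_of_nonneg (fun x => mul_nonneg (hW0 _).le (hφ.nonneg x))
    (integrable_mul_mollifier hφ hW hW0 hW1 ξ L)]
  rw [integral_pos_iff_support_of_nonneg hφ.nonneg hφ.integrable] at hd
  refine hd.trans_le (measure_mono fun x hx => ?_)
  exact mul_ne_zero (hW0 _).ne' hx

theorem le_avg (hφ : IsMollifier φ) (hW : Measurable W) (hW0 : ∀ x, 0 < W x)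
    (hW1 : ∀ x, W x ≤ 1) {ξ L c : ℝ} (hc : 0 < c) (hc1 : c ≤ 1)
    (h : ∀ x, |x| ≤ 8 / 5 → c ≤ W (ξ - L * x)) : c ≤ avg φ W ξ L := by
  have := avg_le_mul_avg (W := fun _ => c) (c := 1) (L := L) (L' := L) (ξ := ξ) (η := ξ) hφ
    measurable_const (fun _ => hc) (fun _ => hc1) hW hW0 hW1
    (fun x hx => by rw [one_mul]; exact h x hx)
  rwa [avg_const hφ, one_mul] at this

/-- The mollifier rescaled to length `L` and centred at `ξ`. -/
noncomputable def kern (φ : ℝ → ℝ) (ξ L ρ : ℝ) : ℝ :=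
  φ ((ξ - ρ) / L) * (1 / ((∫ x : ℝ, φ x) * L))

theorem integral_mul_kern {ξ L : ℝ} (hL : 0 < L) (W : ℝ → ℝ) :
    ∫ ρ, W ρ * kern φ ξ L ρ = avg φ W ξ L := by
  rw [← integral_sub_left_eq_self (fun ρ => W ρ * kern φ ξ L ρ) volume ξ]
  have h := Measure.integral_comp_mul_left (fun y => W (ξ - y) * kern φ ξ L (ξ - y)) L
  rw [abs_of_pos (inv_pos.2 hL), smul_eq_mul] at h
  have h2 : ∫ x, W (ξ - x) * kern φ ξ L (ξ - x) =
      L * ∫ x, W (ξ - L * x) * kern φ ξ L (ξ - L * x) := by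
    rw [h, mul_inv_cancel_left₀ hL.ne']
  rw [h2]
  unfold avg
  rw [← integral_const_mul, ← integral_const_mul]
  congr 1
  funext x
  unfold kern
  rw [sub_sub_cancel, mul_div_cancel_left₀ _ hL.ne']
  field_simp

theorem mollify_eq {w : ℝ → ℝ → ℝ} {δ' t ξ : ℝ} (hL : 0 < avgLength δ' t ξ) :
    mollify φ δ' w t ξ = avg φ (w t) ξ (avgLength δ' t ξ) := by
  rw [← integral_mul_kern hL]
  unfold mollify kern
  simp only [mul_assoc]

theorem integrable_mul_kern (hφ : IsMollifier φ) (hW : Measurable W) (h0 : ∀ x, 0 < W x)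
    (h1 : ∀ x, W x ≤ 1) {ξ L : ℝ} (hL : 0 < L) : Integrable fun ρ => W ρ * kern φ ξ L ρ := by
  have hd := hφ.integral_pos
  have hk : Integrable (kern φ ξ L) := by
    unfold kern
    have := (hφ.integrable.comp_div hL.ne').comp_sub_left ξ
    exact this.mul_const _
  have hk0 : ∀ ρ, 0 ≤ kern φ ξ L ρ := fun ρ => mul_nonneg (hφ.nonneg _) (by positivity)
  refine hk.mono' (hW.aestronglyMeasurable.mul hk.aestronglyMeasurable)
    (Filter.Eventually.of_forall fun x => ?_)
  rw [Real.norm_eq_abs, abs_of_nonneg (mul_nonneg (h0 _).le (hk0 x))]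
  exact mul_le_of_le_one_left (hk0 x) (h1 _)

/-- The argument of φ moves by O(|ξ-η|/L) and the normalisation by O(|ξ-η|/L²), since the length
changes no more than the centre. -/
theorem abs_kern_sub_le (hφ : IsMollifier φ) {G : ℝ} (hG : ∀ x y, |φ x - φ y| ≤ G * |x - y|)
    {ξ η L L' ρ : ℝ} (hL : 0 < L) (hζ : |ξ - η| ≤ L / 2) (hLL : |L - L'| ≤ |ξ - η|)
    (hρ : |ρ - ξ| ≤ 4 * L) :
    |kern φ ξ L ρ - kern φ η L' ρ| ≤ (11 * G + 2) / (∫ x, φ x) * (|ξ - η| / L ^ 2) := by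
  have hd := hφ.integral_pos
  have hG0 : 0 ≤ G := by
    have := (abs_nonneg _).trans (hG 1 0)
    simpa using this
  set ζ := |ξ - η| with hζdef
  have hζ0 : 0 ≤ ζ := abs_nonneg _
  have hL' : L / 2 ≤ L' := by
    have := abs_le.1 hLL
    linarith
  have hL'0 : 0 < L' := by linarith
  have b1 : |1 / L - 1 / L'| ≤ 2 * (ζ / L ^ 2) := by
    have e : 1 / L - 1 / L' = -(L - L') / (L * L') := by field_simp; ring
    rw [e, abs_div, abs_neg, abs_of_pos (by positivity : 0 < L * L'), mul_div_assoc',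
      div_le_div_iff₀ (by positivity) (by positivity)]
    have : L ^ 2 ≤ 2 * (L * L') := by nlinarith
    calc |L - L'| * L ^ 2 ≤ ζ * (2 * (L * L')) := by gcongr
      _ = _ := by ring
  have b2 : |(ξ - ρ) / L - (η - ρ) / L'| ≤ 11 * (ζ / L) := by
    have e : (ξ - ρ) / L - (η - ρ) / L' = (ξ - η) / L + (η - ρ) * (1 / L - 1 / L') := by
      field_simp
      ring
    have h5 : |η - ρ| ≤ 4 * L + L / 2 := by
      have : η - ρ = -(ξ - η) + -(ρ - ξ) := by ring
      rw [this]
      refine (abs_add_le _ _).trans ?_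
      rw [abs_neg, abs_neg]
      linarith
    rw [e]
    refine (abs_add_le _ _).trans ?_
    rw [abs_div, abs_of_pos hL, abs_mul]
    have h6 : |η - ρ| * |1 / L - 1 / L'| ≤ (4 * L + L / 2) * (2 * (ζ / L ^ 2)) := by gcongr
    have h7 : (4 * L + L / 2) * (2 * (ζ / L ^ 2)) = 9 * (ζ / L) := by field_simp; ring
    have h8 : 0 ≤ ζ / L := by positivity
    rw [← hζdef]
    linarith
  have e : kern φ ξ L ρ - kern φ η L' ρ = 1 / (∫ x, φ x) *
      ((φ ((ξ - ρ) / L) - φ ((η - ρ) / L')) * (1 / L)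
        + φ ((η - ρ) / L') * (1 / L - 1 / L')) := by
    unfold kern
    field_simp
    ring
  rw [e, abs_mul, abs_of_pos (by positivity : 0 < 1 / ∫ x, φ x)]
  have b3 : |(φ ((ξ - ρ) / L) - φ ((η - ρ) / L')) * (1 / L)
        + φ ((η - ρ) / L') * (1 / L - 1 / L')| ≤ (11 * G + 2) * (ζ / L ^ 2) := by
    refine (abs_add_le _ _).trans ?_
    rw [abs_mul, abs_mul, abs_of_pos (by positivity : 0 < 1 / L),
      abs_of_nonneg (hφ.nonneg ((η - ρ) / L'))]
    have c1 : |φ ((ξ - ρ) / L) - φ ((η - ρ) / L')| * (1 / L) ≤ G * (11 * (ζ / L)) * (1 / L) := by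
      gcongr
      exact (hG _ _).trans (by gcongr)
    have c2 : φ ((η - ρ) / L') * |1 / L - 1 / L'| ≤ 1 * (2 * (ζ / L ^ 2)) := by
      gcongr
      exact (hφ.mem_Icc _).2
    have c3 : G * (11 * (ζ / L)) * (1 / L) = 11 * G * (ζ / L ^ 2) := by field_simp
    linarith
  calc _ ≤ 1 / (∫ x, φ x) * ((11 * G + 2) * (ζ / L ^ 2)) := by gcongr
    _ = _ := by ring

theorem kern_eq_zero (hφ : IsMollifier φ) {ξ L ρ : ℝ} (hL : 0 < L) (h : 8 / 5 * L < |ρ - ξ|) :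
    kern φ ξ L ρ = 0 := by
  unfold kern
  rw [hφ.eq_zero, zero_mul]
  rw [abs_div, abs_of_pos hL, lt_div_iff₀ hL, abs_sub_comm]
  exact h

/-- Here the kernel is moved instead of the weight. Integrating the kernel bound over a window of
length 8L gives the gain |ξ-η|/L. -/
theorem abs_avg_sub_le (hφ : IsMollifier φ) {G : ℝ} (hG : ∀ x y, |φ x - φ y| ≤ G * |x - y|)
    (hW : Measurable W) (h0 : ∀ x, 0 < W x) (h1 : ∀ x, W x ≤ 1)
    {ξ η L L' m : ℝ} (hL : 0 < L) (hζ : |ξ - η| ≤ L / 2) (hLL : |L - L'| ≤ |ξ - η|)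
    (hm : ∀ ρ, |ρ - ξ| ≤ 4 * L → W ρ ≤ m) :
    |avg φ W ξ L - avg φ W η L'| ≤ m * (8 * ((11 * G + 2) / (∫ x, φ x)) * (|ξ - η| / L)) := by
  have hd := hφ.integral_pos
  have hL' : L / 2 ≤ L' := by
    have := abs_le.1 hLL
    linarith
  have hL'2 : L' ≤ 3 / 2 * L := by
    have := abs_le.1 hLL
    linarith
  have hL'0 : 0 < L' := by linarith
  have hm0 : 0 ≤ m := (h0 ξ).le.trans (hm ξ (by simp; linarith))
  set c := (11 * G + 2) / (∫ x, φ x) * (|ξ - η| / L ^ 2) with hc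
  rw [← integral_mul_kern hL, ← integral_mul_kern hL'0,
    ← integral_sub (integrable_mul_kern hφ hW h0 h1 hL) (integrable_mul_kern hφ hW h0 h1 hL'0)]
  have hint : Integrable ((Set.Icc (ξ - 4 * L) (ξ + 4 * L)).indicator fun _ : ℝ => m * c) :=
    (integrable_indicator_iff measurableSet_Icc).2 continuous_const.integrableOn_Icc
  have hbd := norm_integral_le_of_norm_le (μ := volume)
    (f := fun ρ => W ρ * kern φ ξ L ρ - W ρ * kern φ η L' ρ) hint
    (Filter.Eventually.of_forall fun ρ => by
      rw [Real.norm_eq_abs, ← mul_sub, abs_mul, abs_of_pos (h0 ρ)]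
      rcases le_or_gt |ρ - ξ| (4 * L) with hρ | hρ
      · rw [Set.indicator_of_mem (by
          rw [abs_le] at hρ
          constructor <;> linarith)]
        exact mul_le_mul (hm ρ hρ) (abs_kern_sub_le hφ hG hL hζ hLL hρ) (abs_nonneg _) hm0
      · have k1 := kern_eq_zero hφ hL (by linarith : 8 / 5 * L < |ρ - ξ|)
        -- The second support reaches at most (8/5)(3/2)L + L/2 from ξ, less than 4L.
        have k2 : kern φ η L' ρ = 0 := by
          apply kern_eq_zero hφ hL'0
          have : |ρ - ξ| ≤ |ρ - η| + |ξ - η| := by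
            rw [abs_sub_comm ξ η]
            exact abs_sub_le _ _ _
          linarith
        rw [k1, k2, sub_zero, abs_zero, mul_zero]
        rw [Set.indicator_of_notMem]
        intro hmem
        have : |ρ - ξ| ≤ 4 * L := by
          rw [abs_le]
          constructor <;> linarith [hmem.1, hmem.2]
        linarith)
  rw [Real.norm_eq_abs, integral_indicator measurableSet_Icc, setIntegral_const] at hbd
  refine hbd.trans (le_of_eq ?_)
  rw [Measure.real, Real.volume_Icc, ENNReal.toReal_ofReal (by linarith), smul_eq_mul, hc]
  field_simp
  ring

end

/-! ### The Japanese bracket and the averaging length -/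

theorem one_le_jap (x : ℝ) : 1 ≤ jap x := Real.one_le_sqrt.2 (by nlinarith [sq_nonneg x])

theorem abs_le_jap (x : ℝ) : |x| ≤ jap x := Real.abs_le_sqrt (by linarith)

theorem jap_le (x : ℝ) : jap x ≤ 1 + |x| := by
  unfold jap
  rw [Real.sqrt_le_left (by positivity)]
  nlinarith [sq_abs x, abs_nonneg x]

theorem abs_jap_sub_le (x y : ℝ) : |jap x - jap y| ≤ |x - y| := by
  have key : ∀ x y : ℝ, jap x ≤ jap y + |x - y| := by
    intro x y
    have h1 := abs_le_jap y
    have h2 := one_le_jap y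
    have h3 : jap y * jap y = 1 + y ^ 2 := Real.mul_self_sqrt (by positivity)
    unfold jap at *
    rw [Real.sqrt_le_left (by positivity)]
    have h4 : y * (x - y) ≤ |y| * |x - y| := by rw [← abs_mul]; exact le_abs_self _
    have h5 := mul_le_mul_of_nonneg_right h1 (abs_nonneg (x - y))
    nlinarith [sq_abs (x - y)]
  have h1 := key x y
  have h2 := key y x
  rw [abs_sub_comm] at h2
  rw [abs_le]
  constructor <;> linarith

section
variable {δ' t : ℝ}

theorem one_le_avgLength (hδ' : 0 < δ') (ht : 0 ≤ t) (ξ : ℝ) : 1 ≤ avgLength δ' t ξ := by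
  have := one_le_jap ξ
  unfold avgLength
  have : 0 ≤ δ' * jap ξ / (√(jap ξ) + δ' * t) := by positivity
  linarith

theorem avgLength_le (hδ' : 0 < δ') (hδ'1 : δ' ≤ 1) (ht : 0 ≤ t) (ξ : ℝ) :
    avgLength δ' t ξ ≤ 1 + √(jap ξ) := by
  have h1 := one_le_jap ξ
  have h2 : 0 < √(jap ξ) := Real.sqrt_pos.2 (by linarith)
  have h3 := Real.mul_self_sqrt (by linarith : 0 ≤ jap ξ)
  unfold avgLength
  gcongr
  rw [div_le_iff₀ (by positivity)]
  have : 0 ≤ √(jap ξ) * (δ' * t) := by positivity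
  nlinarith

theorem abs_avgLength_sub_le (hδ' : 0 < δ') (hδ'1 : δ' ≤ 1) (ht : 0 ≤ t) (ξ η : ℝ) :
    |avgLength δ' t ξ - avgLength δ' t η| ≤ |ξ - η| := by
  refine le_trans ?_ (abs_jap_sub_le ξ η)
  have h1 := one_le_jap ξ
  have h2 := one_le_jap η
  unfold avgLength
  generalize jap ξ = x at *
  generalize jap η = y at *
  wlog hxy : y ≤ x generalizing x y
  · rw [abs_sub_comm, abs_sub_comm x y]
    exact this y h2 x h1 (by linarith)
  have hs := Real.sqrt_le_sqrt hxy
  have hy : 1 ≤ √y := Real.one_le_sqrt.2 h2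
  have hxx := Real.mul_self_sqrt (by linarith : 0 ≤ x)
  have hyy := Real.mul_self_sqrt (by linarith : 0 ≤ y)
  have hc : 0 ≤ δ' * t := by positivity
  generalize δ' * t = c at *
  generalize √x = r at *
  generalize √y = s at *
  subst hxx hyy
  have hr : 1 ≤ r := hy.trans hs
  have e : 1 + δ' * (r * r) / (r + c) - (1 + δ' * (s * s) / (s + c)) =
      δ' * ((r - s) * (r * s + c * (r + s)) / ((r + c) * (s + c))) := by
    field_simp
    ring
  have hrs : 0 ≤ r - s := by linarith
  rw [e, abs_of_nonneg (by positivity), abs_of_nonneg (by linarith)]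
  have h5 : (r - s) * (r * s + c * (r + s)) / ((r + c) * (s + c)) ≤ r * r - s * s := by
    rw [div_le_iff₀ (by positivity)]
    have : r * r - s * s = (r - s) * (r + s) := by ring
    rw [this, mul_assoc]
    apply mul_le_mul_of_nonneg_left _ hrs
    have : 1 ≤ r + s := by linarith
    have h6 : 0 ≤ r * s + c * (r + s) := by positivity
    have h7 : r * s + c * (r + s) ≤ (r + c) * (s + c) := by nlinarith
    nlinarith
  have h6 : 0 ≤ (r - s) * (r * s + c * (r + s)) / ((r + c) * (s + c)) := by positivity
  exact (mul_le_of_le_one_left h6 hδ'1).trans h5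

end


/-! ### The mollified weights -/

section
variable {δ₀ δ δ' t : ℝ} {φ : ℝ → ℝ} {k : ℤ}

theorem bK_eq (hδ' : 0 < δ') (ht : 0 ≤ t) (ξ : ℝ) :
    bK δ₀ δ δ' φ k t ξ = avg φ (wK δ₀ δ k t) ξ (avgLength δ' t ξ) :=
  mollify_eq (by linarith [one_le_avgLength hδ' ht ξ])

theorem bK_pos (hφ : IsMollifier φ) (hδ₀ : 0 ≤ δ₀) (hδ : 0 < δ) (hδ' : 0 < δ') (ht : 0 ≤ t)
    (ξ : ℝ) : 0 < bK δ₀ δ δ' φ k t ξ := by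
  rw [bK_eq hδ' ht]
  exact avg_pos hφ (measurable_wK hδ k t) (wK_pos hδ k t) (wK_le_one hδ₀ hδ k ht) _ _

theorem bR_pos (hφ : IsMollifier φ) (hδ₀ : 0 ≤ δ₀) (hδ : 0 < δ) (hδ' : 0 < δ') (ht : 0 ≤ t)
    (ξ : ℝ) : 0 < bR δ₀ δ δ' φ t ξ := by
  unfold bR
  rw [mollify_eq (by linarith [one_le_avgLength hδ' ht ξ])]
  exact avg_pos hφ (measurable_wR hδ t) (wR_pos hδ t) (wR_le_one hδ₀ hδ ht) _ _

theorem bR_le_one (hφ : IsMollifier φ) (hδ₀ : 0 ≤ δ₀) (hδ : 0 < δ) (hδ' : 0 < δ') (ht : 0 ≤ t)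
    (ξ : ℝ) : bR δ₀ δ δ' φ t ξ ≤ 1 := by
  unfold bR
  rw [mollify_eq (by linarith [one_le_avgLength hδ' ht ξ])]
  exact avg_le_one hφ (measurable_wR hδ t) (wR_pos hδ t) (wR_le_one hδ₀ hδ ht) _ _

theorem bK_le_of_abs_bigPsi_sub_le (hφ : IsMollifier φ) (hδ₀ : 0 ≤ δ₀) (hδ : 0 < δ) (hδ' : 0 < δ')
    (ht : 0 ≤ t) {ξ η B : ℝ}
    (h : ∀ x, |x| ≤ 8 / 5 → |bigPsi δ₀ δ k t (ξ - avgLength δ' t ξ * x) -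
      bigPsi δ₀ δ k t (η - avgLength δ' t η * x)| ≤ B) :
    bK δ₀ δ δ' φ k t ξ ≤ Real.exp B * bK δ₀ δ δ' φ k t η := by
  rw [bK_eq hδ' ht, bK_eq hδ' ht]
  have hm := measurable_wK (δ₀ := δ₀) hδ k t
  have h0 := wK_pos (δ₀ := δ₀) hδ k t
  have h1 := wK_le_one hδ₀ hδ k ht
  refine avg_le_mul_avg hφ hm h0 h1 hm h0 h1 fun x hx => ?_
  rw [wK_eq hδ, wK_eq hδ, ← Real.exp_add, Real.exp_le_exp]
  have := (abs_le.1 (h x hx)).1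
  linarith

/-- The averaging length is 1-Lipschitz, so corresponding points of the two windows are as close as
their centres, up to the factor 1 + 8/5. The constant 2² is rounded up for taking square roots. -/
theorem abs_shift_sub_le (hδ' : 0 < δ') (hδ'1 : δ' ≤ 1) (ht : 0 ≤ t) {x : ℝ} (hx : |x| ≤ 8 / 5)
    (ξ η : ℝ) : |ξ - avgLength δ' t ξ * x - (η - avgLength δ' t η * x)| ≤ 2 ^ 2 * jap (ξ - η) := by
  have h1 := abs_avgLength_sub_le hδ' hδ'1 ht ξ η
  have h2 := abs_le_jap (ξ - η)
  have e : ξ - avgLength δ' t ξ * x - (η - avgLength δ' t η * x) =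
      (ξ - η) + -((avgLength δ' t ξ - avgLength δ' t η) * x) := by ring
  rw [e]
  refine (abs_add_le _ _).trans ?_
  rw [abs_neg, abs_mul]
  have := mul_le_mul h1 hx (abs_nonneg _) (abs_nonneg _)
  linarith [abs_nonneg (ξ - η)]

theorem exists_bK_le (hφ : IsMollifier φ) (hδ₀ : 0 ≤ δ₀) (hδ : 0 < δ) (hδ2 : δ ≤ 1 / 2) :
    ∃ M : ℝ, 0 ≤ M ∧ ∀ (δ' t : ℝ) (k : ℤ) (ξ η : ℝ), 0 < δ' → δ' ≤ 1 → 0 ≤ t →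
      bK δ₀ δ δ' φ k t ξ ≤
        Real.exp (M + 400 * (1 + 2 * δ₀) * √δ * √(jap (ξ - η))) * bK δ₀ δ δ' φ k t η := by
  obtain ⟨M, hM0, hM⟩ := exists_abs_bigPsi_sub_le hδ₀ hδ hδ2
  refine ⟨M, hM0, fun δ' t k ξ η hδ' hδ'1 ht => ?_⟩
  refine bK_le_of_abs_bigPsi_sub_le hφ hδ₀ hδ hδ' ht fun x hx => ?_
  refine (hM k t _ _ ht).trans ?_
  have := sqrt_le_two_mul (abs_shift_sub_le hδ' hδ'1 ht hx ξ η)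
  have := mul_le_mul_of_nonneg_left this (by positivity : 0 ≤ 200 * (1 + 2 * δ₀) * √δ)
  linarith

theorem exp_le_bK (hφ : IsMollifier φ) (hδ₀ : 0 ≤ δ₀) (hδ : 0 < δ) (hδ1 : δ ≤ 1) (hδ' : 0 < δ')
    (hδ'1 : δ' ≤ 1) (ht : 0 ≤ t) (ξ : ℝ) :
    Real.exp (-(30 * (1 + 2 * δ₀) * δ * √(jap ξ))) ≤ bK δ₀ δ δ' φ k t ξ := by
  rw [bK_eq hδ' ht]
  have h1 := one_le_jap ξ
  refine le_avg hφ (measurable_wK hδ k t) (wK_pos hδ k t) (wK_le_one hδ₀ hδ k ht)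
    (Real.exp_pos _) (Real.exp_le_one_iff.2 (neg_nonpos.2 (by positivity))) fun x hx => ?_
  rw [wK_eq hδ, Real.exp_le_exp, neg_le_neg_iff]
  refine (bigPsi_le hδ₀ hδ hδ1 ht _).trans ?_
  have h2 := avgLength_le hδ' hδ'1 ht ξ
  have h3 := one_le_avgLength hδ' ht ξ
  have h4 := abs_le_jap ξ
  have h5 : √(jap ξ) ≤ jap ξ := by
    rw [Real.sqrt_le_left (by linarith)]
    nlinarith
  have h6 : |ξ - avgLength δ' t ξ * x| ≤ 3 ^ 2 * jap ξ := by
    refine (abs_sub _ _).trans ?_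
    rw [abs_mul, abs_of_pos (by linarith : 0 < avgLength δ' t ξ)]
    have := mul_le_mul h2 hx (abs_nonneg _) (by positivity)
    linarith
  have h7 : √|ξ - avgLength δ' t ξ * x| ≤ 3 * √(jap ξ) :=
    (Real.sqrt_le_sqrt h6).trans
      (by rw [Real.sqrt_mul (by norm_num), Real.sqrt_sq (by norm_num)])
  have := mul_le_mul_of_nonneg_left h7 (by positivity : 0 ≤ 10 * (1 + 2 * δ₀) * δ)
  linarith

theorem avgLength_le_of_large (hδ' : 0 < δ') (hδ'1 : δ' ≤ 1) (ht : 0 ≤ t) {ξ : ℝ}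
    (hξ : 200 ≤ |ξ|) : 4 * avgLength δ' t ξ ≤ |ξ| / 3 := by
  have h1 := avgLength_le hδ' hδ'1 ht ξ
  have h2 := jap_le ξ
  have h3 : √(jap ξ) ≤ |ξ| / 12 - 1 := by
    rw [Real.sqrt_le_left (by linarith)]
    nlinarith
  linarith

/-- Late times: both windows stay within |ξ|/3 of ξ, and the constant-free bound compares the
weights at points with the same x. -/
theorem abs_bK_sub_le_of_ge (hφ : IsMollifier φ) (hδ₀ : 0 ≤ δ₀) (hδ : 0 < δ) (hδ2 : δ ≤ 1 / 2)
    (hδ' : 0 < δ') (hδ'1 : δ' ≤ 1) (ht : 0 ≤ t) {ξ η : ℝ} (hξ : 2 * δ ^ (-10 : ℤ) ≤ |ξ|)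
    (hξ' : 200 ≤ |ξ|) (hζ : |ξ - η| ≤ |ξ| / 20) (htξ : 8 * √|ξ| / (δ * √δ) ≤ t) :
    |bK δ₀ δ δ' φ k t η / bK δ₀ δ δ' φ k t ξ - 1| ≤
      Real.exp (80 * (1 + 2 * δ₀) * δ * √(jap (ξ - η))) - 1 := by
  have hL := avgLength_le_of_large hδ' hδ'1 ht hξ'
  have hL1 := one_le_avgLength hδ' ht ξ
  have hLL := abs_avgLength_sub_le hδ' hδ'1 ht ξ η
  have hL2 := one_le_avgLength hδ' ht η
  have w1 : ∀ x, |x| ≤ 8 / 5 → |ξ - avgLength δ' t ξ * x - ξ| ≤ |ξ| / 3 := by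
    intro x hx
    have e : ξ - avgLength δ' t ξ * x - ξ = -(avgLength δ' t ξ * x) := by ring
    rw [e, abs_neg, abs_mul, abs_of_pos (by linarith : 0 < avgLength δ' t ξ)]
    nlinarith
  have w2 : ∀ x, |x| ≤ 8 / 5 → |η - avgLength δ' t η * x - ξ| ≤ |ξ| / 3 := by
    intro x hx
    have e : η - avgLength δ' t η * x - ξ = -(ξ - η) + -(avgLength δ' t η * x) := by ring
    rw [e]
    refine (abs_add_le _ _).trans ?_
    rw [abs_neg, abs_neg, abs_mul, abs_of_pos (by linarith : 0 < avgLength δ' t η)]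
    have := (abs_le.1 hLL).1
    nlinarith
  have key : ∀ x, |x| ≤ 8 / 5 → |bigPsi δ₀ δ k t (ξ - avgLength δ' t ξ * x) -
      bigPsi δ₀ δ k t (η - avgLength δ' t η * x)| ≤
      80 * (1 + 2 * δ₀) * δ * √(jap (ξ - η)) := by
    intro x hx
    refine (abs_bigPsi_sub_le_of_ge hδ₀ hδ hδ2 hξ htξ (w1 x hx) (w2 x hx)).trans ?_
    have := sqrt_le_two_mul (abs_shift_sub_le hδ' hδ'1 ht hx ξ η)
    have := mul_le_mul_of_nonneg_left this (by positivity : 0 ≤ 40 * (1 + 2 * δ₀) * δ)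
    linarith
  have h1 := bK_le_of_abs_bigPsi_sub_le hφ hδ₀ hδ hδ' ht key
  have h2 := bK_le_of_abs_bigPsi_sub_le (ξ := η) (η := ξ) hφ hδ₀ hδ hδ' ht fun x hx => by
    rw [abs_sub_comm]
    exact key x hx
  have hb := bK_pos (k := k) hφ hδ₀ hδ hδ' ht ξ
  have hb' := bK_pos (k := k) hφ hδ₀ hδ hδ' ht η
  generalize bK δ₀ δ δ' φ k t ξ = b at *
  generalize bK δ₀ δ δ' φ k t η = b' at *
  generalize Real.exp (80 * (1 + 2 * δ₀) * δ * √(jap (ξ - η))) = E at *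
  have hE : 0 < E := pos_of_mul_pos_left (hb.trans_le h1) hb'.le
  rw [abs_le]
  constructor
  · have : 1 / E ≤ b' / b := by
      rw [div_le_div_iff₀ hE hb]
      linarith
    have h3 : 2 - E ≤ 1 / E := by
      rw [le_div_iff₀ hE]
      nlinarith [sq_nonneg (E - 1)]
    linarith
  · have : b' / b ≤ E := (div_le_iff₀ hb).2 h2
    linarith

/-- For t ≲ ⟨ξ⟩^{1/2} the denominator in the averaging length is comparable to ⟨ξ⟩^{1/2}. -/
theorem mul_sqrt_le_avgLength (hδ' : 0 < δ') (ht : 0 ≤ t) {ξ a : ℝ} (ha : 0 ≤ a)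
    (h : t ≤ a * √(jap ξ)) : δ' / (1 + δ' * a) * √(jap ξ) ≤ avgLength δ' t ξ := by
  have h1 := one_le_jap ξ
  have h2 := Real.sqrt_pos.2 (by linarith : 0 < jap ξ)
  have h3 := Real.mul_self_sqrt (by linarith : 0 ≤ jap ξ)
  have : δ' / (1 + δ' * a) * √(jap ξ) ≤ δ' * jap ξ / (√(jap ξ) + δ' * t) := by
    rw [div_mul_eq_mul_div, div_le_div_iff₀ (by positivity) (by positivity)]
    have := mul_le_mul_of_nonneg_left h (by positivity : 0 ≤ δ' * √(jap ξ) * δ')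
    generalize √(jap ξ) = r at *
    rw [← h3]
    linarith
  unfold avgLength
  linarith

/-- Early times: the weight is constant up to e^{±M} on a window of length about ⟨ξ⟩^{1/2}, so its
supremum there is comparable to b_k, and the smoothness of the kernel gives the decay. The constants
may depend on δ and δ'. -/
theorem exists_abs_bK_sub_le_of_le (hφ : IsMollifier φ) (hδ₀ : 0 ≤ δ₀) (hδ : 0 < δ)
    (hδ2 : δ ≤ 1 / 2) (hδ' : 0 < δ') (hδ'1 : δ' ≤ 1) :
    ∃ c N : ℝ, 0 < c ∧ c ≤ 1 ∧ 0 ≤ N ∧ ∀ (t : ℝ) (k : ℤ) (ξ η : ℝ), 0 ≤ t →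
      2 * δ ^ (-10 : ℤ) ≤ |ξ| → 200 ≤ |ξ| → jap (ξ - η) ≤ c / 2 * √(jap ξ) →
      t ≤ 8 * √|ξ| / (δ * √δ) →
      |bK δ₀ δ δ' φ k t η / bK δ₀ δ δ' φ k t ξ - 1| ≤ N * (jap (ξ - η) / √(jap ξ)) := by
  obtain ⟨G, hG0, hG⟩ := hφ.exists_lipschitz
  have hsδ := Real.sqrt_pos.2 hδ
  set a := 8 / (δ * √δ) with ha
  have ha0 : 0 < a := by positivity
  obtain ⟨M, hM0, hM⟩ := exists_abs_bigPsi_sub_le_of_le hδ₀ hδ hδ2 (12 + a)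
  have hd := hφ.integral_pos
  set c := δ' / (1 + δ' * a) with hc
  have hc0 : 0 < c := by positivity
  set Q := 8 * ((11 * G + 2) / (∫ x, φ x)) with hQ
  have hQ0 : 0 ≤ Q := by positivity
  refine ⟨c, Real.exp (2 * M) * Q / c, hc0, ?_, by positivity, ?_⟩
  · rw [hc, div_le_one (by positivity)]
    have : 0 ≤ δ' * a := by positivity
    linarith
  intro t k ξ η ht hξ hξ' hζ htξ
  have j1 := one_le_jap ξ
  have j2 := abs_le_jap ξ
  have j3 := jap_le ξ
  have j4 := abs_le_jap (ξ - η)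
  have js := Real.sqrt_pos.2 (by linarith : 0 < jap ξ)
  have hta : t ≤ a * √|ξ| := by
    rw [ha, div_mul_eq_mul_div]
    exact htξ
  have hL := avgLength_le_of_large hδ' hδ'1 ht hξ'
  have hL0 := one_le_avgLength hδ' ht ξ
  have hLc := mul_sqrt_le_avgLength (ξ := ξ) hδ' ht ha0.le
    (hta.trans (by gcongr))
  have hLL := abs_avgLength_sub_le hδ' hδ'1 ht ξ η
  have hLu := avgLength_le hδ' hδ'1 ht ξ
  set L := avgLength δ' t ξ with hLdef
  have hζL : |ξ - η| ≤ L / 2 := by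
    rw [← hc] at hLc
    linarith
  have hL12 : 4 * L ≤ (12 + a) * √|ξ| := by
    have s1 : √(jap ξ) ≤ 2 * √|ξ| := sqrt_le_two_mul (by linarith)
    have s2 : 1 ≤ √|ξ| := Real.one_le_sqrt.2 (by linarith)
    nlinarith
  have hloc : ∀ ρ, |ρ - ξ| ≤ 4 * L → |bigPsi δ₀ δ k t ρ - bigPsi δ₀ δ k t ξ| ≤ M := by
    intro ρ hρ
    refine hM k t ξ ρ ξ ht hξ (hta.trans ?_) (hρ.trans hL) (by simp; linarith) (hρ.trans hL12)
    gcongr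
    linarith
  have hm := measurable_wK (δ₀ := δ₀) hδ k t
  have h0 := wK_pos (δ₀ := δ₀) hδ k t
  have h1 := wK_le_one hδ₀ hδ k ht
  have hup : ∀ ρ, |ρ - ξ| ≤ 4 * L → wK δ₀ δ k t ρ ≤ Real.exp M * wK δ₀ δ k t ξ := by
    intro ρ hρ
    rw [wK_eq hδ, wK_eq hδ, ← Real.exp_add, Real.exp_le_exp]
    have := (abs_le.1 (hloc ρ hρ)).1
    linarith
  have hlow : Real.exp (-M) * wK δ₀ δ k t ξ ≤ bK δ₀ δ δ' φ k t ξ := by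
    rw [bK_eq hδ' ht]
    refine le_avg hφ hm h0 h1 (mul_pos (Real.exp_pos _) (h0 ξ)) ?_ fun x hx => ?_
    · exact mul_le_one₀ (Real.exp_le_one_iff.2 (by linarith)) (h0 ξ).le (h1 ξ)
    · have hx' : |ξ - L * x - ξ| ≤ 4 * L := by
        have e : ξ - L * x - ξ = -(L * x) := by ring
        rw [e, abs_neg, abs_mul, abs_of_pos (by linarith : 0 < L)]
        nlinarith
      rw [wK_eq hδ, wK_eq hδ, ← Real.exp_add, Real.exp_le_exp]
      have := (abs_le.1 (hloc _ hx')).2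
      linarith
  have hdiff := abs_avg_sub_le hφ hG hm h0 h1 (L' := avgLength δ' t η) (by linarith : 0 < L) hζL
    hLL hup
  rw [← bK_eq hδ' ht, ← bK_eq hδ' ht, ← hQ] at hdiff
  have hb := bK_pos (k := k) hφ hδ₀ hδ hδ' ht ξ
  rw [div_sub_one hb.ne', abs_div, abs_of_pos hb, div_le_iff₀ hb, abs_sub_comm]
  refine hdiff.trans ?_
  have e1 : |ξ - η| / L ≤ jap (ξ - η) / (c * √(jap ξ)) := by
    have := (abs_nonneg (ξ - η)).trans j4
    gcongr
  have e2 : wK δ₀ δ k t ξ ≤ Real.exp M * bK δ₀ δ δ' φ k t ξ := by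
    have := mul_le_mul_of_nonneg_left hlow (Real.exp_pos M).le
    rwa [← mul_assoc, ← Real.exp_add, add_neg_cancel, Real.exp_zero, one_mul] at this
  calc Real.exp M * wK δ₀ δ k t ξ * (Q * (|ξ - η| / L))
      ≤ Real.exp M * (Real.exp M * bK δ₀ δ δ' φ k t ξ) *
        (Q * (jap (ξ - η) / (c * √(jap ξ)))) := by gcongr
    _ = Real.exp (2 * M) * Q / c * (jap (ξ - η) / √(jap ξ)) * bK δ₀ δ δ' φ k t ξ := by
      rw [two_mul, Real.exp_add]
      field_simp

end


/-! ### The function `λ` -/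

/-- The bound ⟨s⟩ ≥ (1+s)/2 gives an explicit primitive; the total decrease is at most 4δ₀σ₀ ≤
δ₀/25. -/
theorem lam_bounds {δ₀ σ₀ t : ℝ} (hδ₀ : 0 < δ₀) (hσ₀ : 0 < σ₀) (hσ₀' : σ₀ ≤ 1 / 100) (ht : 0 ≤ t) :
    δ₀ ≤ lam δ₀ σ₀ t ∧ lam δ₀ σ₀ t ≤ 3 / 2 * δ₀ := by
  have hj : ∀ s, 0 < jap s := fun s => by linarith [one_le_jap s]
  have hcj : Continuous fun s => δ₀ * σ₀ ^ 2 / jap s ^ (1 + σ₀) := by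
    have h1 : Continuous jap := by
      unfold jap
      fun_prop
    exact continuous_const.div (h1.rpow_const fun s => Or.inl (hj s).ne')
      fun s => (Real.rpow_pos_of_pos (hj s) _).ne'
  have h0 : 0 ≤ ∫ s in (0 : ℝ)..t, δ₀ * σ₀ ^ 2 / jap s ^ (1 + σ₀) :=
    intervalIntegral.integral_nonneg ht fun s _ => by
      have := Real.rpow_pos_of_pos (hj s) (1 + σ₀)
      positivity
  have hder : ∀ s ∈ Set.uIcc 0 t, HasDerivAt (fun s : ℝ => -(4 * δ₀ * σ₀) * (1 + s) ^ (-σ₀))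
      (4 * δ₀ * σ₀ ^ 2 * (1 + s) ^ (-σ₀ - 1)) s := by
    intro s hs
    rw [Set.uIcc_of_le ht] at hs
    have h := (((hasDerivAt_id s).const_add 1).rpow_const (p := -σ₀)
      (Or.inl (by simp; linarith [hs.1]))).const_mul (-(4 * δ₀ * σ₀))
    refine h.congr_deriv ?_
    simp only [id]
    ring
  have hcont : ContinuousOn (fun s : ℝ => 4 * δ₀ * σ₀ ^ 2 * (1 + s) ^ (-σ₀ - 1))
      (Set.uIcc 0 t) := by
    rw [Set.uIcc_of_le ht]
    refine continuousOn_const.mul (ContinuousOn.rpow_const (by fun_prop) fun s hs => Or.inl ?_)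
    linarith [hs.1]
  have hint := intervalIntegral.integral_eq_sub_of_hasDerivAt hder hcont.intervalIntegrable
  have hle : ∫ s in (0 : ℝ)..t, δ₀ * σ₀ ^ 2 / jap s ^ (1 + σ₀) ≤
      ∫ s in (0 : ℝ)..t, 4 * δ₀ * σ₀ ^ 2 * (1 + s) ^ (-σ₀ - 1) := by
    refine intervalIntegral.integral_mono_on ht (hcj.intervalIntegrable _ _)
      hcont.intervalIntegrable fun s hs => ?_
    have hs0 : 0 < 1 + s := by linarith [hs.1]
    have h1 : (1 + s) / 2 ≤ jap s := by
      unfold jap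
      apply Real.le_sqrt_of_sq_le
      nlinarith [sq_nonneg (1 - s)]
    have h2 : ((1 + s) / 2) ^ (1 + σ₀) ≤ jap s ^ (1 + σ₀) := by
      apply Real.rpow_le_rpow (by positivity) h1 (by linarith)
    have h3 : (2 : ℝ) ^ (1 + σ₀) ≤ 4 := by
      calc (2 : ℝ) ^ (1 + σ₀) ≤ 2 ^ (2 : ℝ) :=
            Real.rpow_le_rpow_of_exponent_le (by norm_num) (by linarith)
        _ = 4 := by norm_num
    rw [Real.div_rpow hs0.le (by norm_num)] at h2
    have h4 := Real.rpow_pos_of_pos hs0 (1 + σ₀)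
    have h5 : (0 : ℝ) < 2 ^ (1 + σ₀) := by positivity
    have h6 : (1 + s) ^ (1 + σ₀) / 4 ≤ jap s ^ (1 + σ₀) := le_trans (by gcongr) h2
    have h7 : (1 + s) ^ (-σ₀ - 1) = 1 / (1 + s) ^ (1 + σ₀) := by
      rw [show -σ₀ - 1 = -(1 + σ₀) by ring, Real.rpow_neg hs0.le, one_div]
    rw [h7]
    calc δ₀ * σ₀ ^ 2 / jap s ^ (1 + σ₀) ≤ δ₀ * σ₀ ^ 2 / ((1 + s) ^ (1 + σ₀) / 4) := by gcongr
      _ = _ := by field_simp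
  rw [hint] at hle
  have h8 : 0 ≤ 4 * δ₀ * σ₀ * (1 + t) ^ (-σ₀) := by positivity
  have h9 : δ₀ * σ₀ ≤ δ₀ * (1 / 100) := by gcongr
  simp only [add_zero, Real.one_rpow] at hle
  unfold lam
  constructor <;> linarith

/-! ### The bracket `⟨k, ξ⟩` -/

theorem sq_jap₂ (k : ℤ) (ξ : ℝ) : jap₂ k ξ * jap₂ k ξ = 1 + (k : ℝ) ^ 2 + ξ ^ 2 :=
  Real.mul_self_sqrt (by positivity)

theorem jap_le_jap₂ (k : ℤ) (ξ : ℝ) : jap ξ ≤ jap₂ k ξ :=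
  Real.sqrt_le_sqrt (by nlinarith [sq_nonneg (k : ℝ)])

theorem jap₂_le (k : ℤ) (ξ : ℝ) : jap₂ k ξ ≤ |(k : ℝ)| + jap ξ := by
  have h1 := one_le_jap ξ
  have h2 : jap ξ * jap ξ = 1 + ξ ^ 2 := Real.mul_self_sqrt (by positivity)
  have h3 := abs_nonneg (k : ℝ)
  unfold jap₂
  rw [Real.sqrt_le_left (by positivity)]
  nlinarith [sq_abs (k : ℝ), mul_nonneg h3 (by linarith : 0 ≤ jap ξ)]

theorem abs_jap₂_sub_le (k : ℤ) (ξ η : ℝ) : |jap₂ k ξ - jap₂ k η| ≤ |ξ - η| := by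
  have key : ∀ x y : ℝ, jap₂ k x ≤ jap₂ k y + |x - y| := by
    intro x y
    have h2 : |y| ≤ jap₂ k y := (abs_le_jap y).trans (jap_le_jap₂ k y)
    have h3 := sq_jap₂ k y
    have h0 : 0 ≤ jap₂ k y := (abs_nonneg y).trans h2
    have h4 : y * (x - y) ≤ |y| * |x - y| := by rw [← abs_mul]; exact le_abs_self _
    have h5 := mul_le_mul_of_nonneg_right h2 (abs_nonneg (x - y))
    rw [jap₂, Real.sqrt_le_left (by positivity)]
    nlinarith [sq_abs (x - y)]
  have h1 := key ξ η
  have h2 := key η ξ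
  rw [abs_sub_comm] at h2
  rw [abs_le]
  constructor <;> linarith

theorem abs_sqrt_sub_sqrt_mul {x y : ℝ} (hx : 0 ≤ x) (hy : 0 ≤ y) :
    |√x - √y| * (√x + √y) = |x - y| := by
  rw [← abs_of_nonneg (by positivity : 0 ≤ √x + √y), ← abs_mul]
  congr 1
  have := Real.mul_self_sqrt hx
  have := Real.mul_self_sqrt hy
  linarith

theorem abs_sqrt_sub_sqrt_le_div {x y : ℝ} (hx : 0 < x) (hy : 0 ≤ y) :
    |√x - √y| ≤ |x - y| / √x := by
  rw [le_div_iff₀ (Real.sqrt_pos.2 hx), ← abs_sqrt_sub_sqrt_mul hx.le hy]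
  gcongr
  linarith [Real.sqrt_nonneg y]

/-- Since 1/8 ≤ (9/25)², the hypothesis gives √z ≤ (9/25)(√x+√y). A factor well below 1 leaves room
for the other exponential losses. -/
theorem abs_sqrt_sub_sqrt_le_of_le {x y z : ℝ} (hx : 0 < x) (hy : 0 ≤ y) (hz : 0 ≤ z)
    (h1 : |x - y| ≤ z) (h2 : z ≤ (x + y) / 8) : |√x - √y| ≤ 9 / 25 * √z := by
  have hxs := Real.sqrt_pos.2 hx
  have hys := Real.sqrt_nonneg y
  have hS : 0 < √x + √y := by linarith
  have a1 := abs_sqrt_sub_sqrt_mul hx.le hy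
  have a2 : √z ≤ 9 / 25 * (√x + √y) := by
    rw [Real.sqrt_le_left (by positivity)]
    nlinarith [Real.mul_self_sqrt hx.le, Real.mul_self_sqrt hy]
  have a3 := Real.mul_self_sqrt hz
  have : |√x - √y| * (√x + √y) ≤ 9 / 25 * √z * (√x + √y) := by
    rw [a1]
    have := mul_le_mul_of_nonneg_left a2 (Real.sqrt_nonneg z)
    linarith
  exact le_of_mul_le_mul_right this hS

theorem rpow_eighth_le_sqrt {x : ℝ} (hx : 1 ≤ x) : x ^ (1 / 8 : ℝ) ≤ √x := by
  rw [Real.sqrt_eq_rpow]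
  exact Real.rpow_le_rpow_of_exponent_le hx (by norm_num)

theorem rpow_eighth_le {x y : ℝ} (hx : 0 ≤ x) (hy : 0 ≤ y) (h : x ≤ y ^ 8) :
    x ^ (1 / 8 : ℝ) ≤ y := by
  calc x ^ (1 / 8 : ℝ) ≤ (y ^ 8) ^ (1 / 8 : ℝ) := Real.rpow_le_rpow hx h (by norm_num)
    _ = y := by
      rw [← Real.rpow_natCast, ← Real.rpow_mul hy]
      norm_num

theorem abs_exp_sub_one_le_mul (u : ℝ) : |Real.exp u - 1| ≤ |u| * Real.exp |u| := by
  have key : ∀ v : ℝ, 0 ≤ v → Real.exp v - 1 ≤ v * Real.exp v := by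
    intro v _
    have h1 := Real.add_one_le_exp (-v)
    have h2 := mul_le_mul_of_nonneg_right h1 (Real.exp_pos v).le
    rw [← Real.exp_add, neg_add_cancel, Real.exp_zero] at h2
    linarith
  rcases le_total 0 u with h | h
  · rw [abs_of_nonneg h, abs_of_nonneg (by linarith [Real.add_one_le_exp u])]
    exact key u h
  · rw [abs_of_nonpos h, abs_of_nonpos (by linarith [Real.exp_le_one_iff.2 h])]
    have h1 := Real.add_one_le_exp u
    have h2 : 1 ≤ Real.exp (-u) := Real.one_le_exp (by linarith)
    nlinarith

theorem le_exp_div {a s : ℝ} (ha : 0 < a) : s ≤ Real.exp (a * s) / a := by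
  rw [le_div_iff₀ ha]
  linarith [Real.add_one_le_exp (a * s)]

/-! ### The factor `e^{√δ⟨ξ⟩^{1/2}} / b_k` -/

/-- `e^{√δ⟨ξ⟩^{1/2}} / b_k(t, ξ)`. -/
noncomputable def expDivB (δ₀ δ δ' : ℝ) (φ : ℝ → ℝ) (k : ℤ) (t ξ : ℝ) : ℝ :=
  Real.exp (√δ * √(jap ξ)) / bK δ₀ δ δ' φ k t ξ

section
variable {δ₀ δ δ' t : ℝ} {φ : ℝ → ℝ} {k : ℤ}

theorem expDivB_pos (hφ : IsMollifier φ) (hδ₀ : 0 ≤ δ₀) (hδ : 0 < δ) (hδ' : 0 < δ') (ht : 0 ≤ t)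
    (ξ : ℝ) : 0 < expDivB δ₀ δ δ' φ k t ξ :=
  div_pos (Real.exp_pos _) (bK_pos hφ hδ₀ hδ hδ' ht ξ)

theorem expDivB_le {a M ξ η : ℝ} (hφ : IsMollifier φ) (hδ₀ : 0 ≤ δ₀) (hδ : 0 < δ) (hδ' : 0 < δ')
    (ht : 0 ≤ t) (ha : 401 * (1 + 2 * δ₀) * √δ ≤ a)
    (hM : bK δ₀ δ δ' φ k t η ≤
      Real.exp (M + 400 * (1 + 2 * δ₀) * √δ * √(jap (η - ξ))) * bK δ₀ δ δ' φ k t ξ) :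
    expDivB δ₀ δ δ' φ k t ξ ≤ Real.exp M * Real.exp (a * √(jap (ξ - η))) *
      expDivB δ₀ δ δ' φ k t η := by
  have hb := bK_pos (k := k) hφ hδ₀ hδ hδ' ht ξ
  have hb' := bK_pos (k := k) hφ hδ₀ hδ hδ' ht η
  have e : jap (η - ξ) = jap (ξ - η) := by unfold jap; congr 1; ring
  rw [e] at hM
  have j1 := one_le_jap η
  have j2 := one_le_jap (ξ - η)
  have j3 : √(jap ξ) ≤ √(jap η) + √(jap (ξ - η)) := by
    refine (Real.sqrt_le_sqrt ?_).trans (sqrt_add_le _ _ (by linarith) (by linarith))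
    have h1 := (abs_le.1 (abs_jap_sub_le ξ η)).2
    have h2 := abs_le_jap (ξ - η)
    linarith
  have hs := Real.sqrt_nonneg (jap (ξ - η))
  have hsδ := Real.sqrt_nonneg δ
  have hexp : Real.exp (√δ * √(jap ξ)) *
      Real.exp (M + 400 * (1 + 2 * δ₀) * √δ * √(jap (ξ - η))) ≤
      Real.exp M * Real.exp (a * √(jap (ξ - η))) * Real.exp (√δ * √(jap η)) := by
    rw [← Real.exp_add, ← Real.exp_add, ← Real.exp_add, Real.exp_le_exp]
    have h1 := mul_le_mul_of_nonneg_left j3 hsδ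
    have h2 := mul_le_mul_of_nonneg_right ha hs
    have h3 : 0 ≤ √δ * √(jap (ξ - η)) := by positivity
    nlinarith
  unfold expDivB
  rw [mul_div_assoc', div_le_div_iff₀ hb hb']
  calc Real.exp (√δ * √(jap ξ)) * bK δ₀ δ δ' φ k t η
      ≤ Real.exp (√δ * √(jap ξ)) * (Real.exp (M + 400 * (1 + 2 * δ₀) * √δ * √(jap (ξ - η))) *
        bK δ₀ δ δ' φ k t ξ) := by gcongr
    _ = Real.exp (√δ * √(jap ξ)) * Real.exp (M + 400 * (1 + 2 * δ₀) * √δ * √(jap (ξ - η))) *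
        bK δ₀ δ δ' φ k t ξ := by ring
    _ ≤ _ := by gcongr

/-- The lower bound on b_k makes the quotient at most e^{31(1+2δ₀)√δ⟨ξ⟩^{1/2}}; the constant 62
halves this against √δ|k|^{1/2}. -/
theorem expDivB_le_of_le {ξ : ℝ} (hφ : IsMollifier φ) (hδ₀ : 0 ≤ δ₀) (hδ : 0 < δ) (hδ1 : δ ≤ 1)
    (hδ' : 0 < δ') (hδ'1 : δ' ≤ 1) (ht : 0 ≤ t)
    (h : (62 * (1 + 2 * δ₀)) ^ 2 * jap ξ ≤ |(k : ℝ)|) :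
    expDivB δ₀ δ δ' φ k t ξ ≤ Real.exp (√δ * √|(k : ℝ)| / 2) := by
  have hb := bK_pos (k := k) hφ hδ₀ hδ hδ' ht ξ
  have h1 := exp_le_bK (k := k) hφ hδ₀ hδ hδ1 hδ' hδ'1 ht ξ
  have h2 : 62 * (1 + 2 * δ₀) * √(jap ξ) ≤ √|(k : ℝ)| := by
    have := Real.sqrt_le_sqrt h
    rwa [Real.sqrt_mul (by positivity), Real.sqrt_sq (by positivity)] at this
  have hsδ : δ ≤ √δ := by
    have := Real.mul_self_sqrt hδ.le
    nlinarith [Real.sqrt_le_one.2 hδ1, Real.sqrt_nonneg δ]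
  unfold expDivB
  rw [div_le_iff₀ hb]
  refine le_trans ?_ (mul_le_mul_of_nonneg_left h1 (Real.exp_pos _).le)
  rw [← Real.exp_add, Real.exp_le_exp]
  have h3 := mul_le_mul_of_nonneg_left h2 (Real.sqrt_nonneg δ)
  have h4 : δ * √(jap ξ) ≤ √δ * √(jap ξ) := by gcongr
  have h5 := mul_le_mul_of_nonneg_left h4 (by positivity : 0 ≤ 30 * (1 + 2 * δ₀))
  have h6 : 0 ≤ √δ * √(jap ξ) * δ₀ := by positivity
  nlinarith

theorem abs_expDivB_sub_div_le_of_le {ξ η : ℝ} (hφ : IsMollifier φ) (hδ₀ : 0 ≤ δ₀) (hδ : 0 < δ)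
    (hδ1 : δ ≤ 1) (hδ' : 0 < δ') (hδ'1 : δ' ≤ 1) (ht : 0 ≤ t)
    (h : (62 * (1 + 2 * δ₀)) ^ 2 * jap ξ ≤ |(k : ℝ)|)
    (h' : (62 * (1 + 2 * δ₀)) ^ 2 * jap η ≤ |(k : ℝ)|) :
    |expDivB δ₀ δ δ' φ k t ξ - expDivB δ₀ δ δ' φ k t η| /
      (expDivB δ₀ δ δ' φ k t η + Real.exp (√δ * √|(k : ℝ)|)) ≤ 2 / (√δ * √|(k : ℝ)|) := by
  have h1 := expDivB_le_of_le hφ hδ₀ hδ hδ1 hδ' hδ'1 ht h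
  have h2 := expDivB_le_of_le hφ hδ₀ hδ hδ1 hδ' hδ'1 ht h'
  have p1 := expDivB_pos (k := k) hφ hδ₀ hδ hδ' ht ξ
  have p2 := expDivB_pos (k := k) hφ hδ₀ hδ hδ' ht η
  have hk : 0 < |(k : ℝ)| := lt_of_lt_of_le (by have := one_le_jap ξ; positivity) h
  have hx : 0 < √δ * √|(k : ℝ)| := mul_pos (Real.sqrt_pos.2 hδ) (Real.sqrt_pos.2 hk)
  generalize √δ * √|(k : ℝ)| = x at *
  have e1 : Real.exp x = Real.exp (x / 2) * Real.exp (x / 2) := by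
    rw [← Real.exp_add]; ring_nf
  have e2 := Real.add_one_le_exp (x / 2)
  rw [div_le_div_iff₀ (by positivity) hx]
  have e3 : |expDivB δ₀ δ δ' φ k t ξ - expDivB δ₀ δ δ' φ k t η| ≤ Real.exp (x / 2) := by
    rw [abs_le]
    constructor <;> linarith
  calc _ ≤ Real.exp (x / 2) * x := by gcongr
    _ ≤ Real.exp (x / 2) * (2 * Real.exp (x / 2)) := by gcongr; linarith
    _ = 2 * Real.exp x := by rw [e1]; ring
    _ ≤ _ := by linarith

/-- The ratio of quotients minus 1 splits as (e^v - 1)·b_k(η)/b_k(ξ) plus (b_k(η)/b_k(ξ) - 1), with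
|v| ≤ ⟨ξ-η⟩/⟨ξ⟩^{1/2} ≤ 1. -/
theorem abs_expDivB_sub_div_le {ξ η P F : ℝ} (hφ : IsMollifier φ) (hδ₀ : 0 ≤ δ₀) (hδ : 0 < δ)
    (hδ1 : δ ≤ 1) (hδ' : 0 < δ') (ht : 0 ≤ t) (hz : jap (ξ - η) ≤ √(jap ξ))
    (hP : bK δ₀ δ δ' φ k t η ≤ P * bK δ₀ δ δ' φ k t ξ)
    (hF : |bK δ₀ δ δ' φ k t η / bK δ₀ δ δ' φ k t ξ - 1| ≤ F) :
    |expDivB δ₀ δ δ' φ k t ξ - expDivB δ₀ δ δ' φ k t η| /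
      (expDivB δ₀ δ δ' φ k t η + Real.exp (√δ * √|(k : ℝ)|)) ≤
      2 * P * (jap (ξ - η) / √(jap ξ)) + F := by
  have hb := bK_pos (k := k) hφ hδ₀ hδ hδ' ht ξ
  have hb' := bK_pos (k := k) hφ hδ₀ hδ hδ' ht η
  have p2 := expDivB_pos (k := k) hφ hδ₀ hδ hδ' ht η
  have j1 := one_le_jap ξ
  have j2 := one_le_jap η
  have hs := Real.sqrt_pos.2 (by linarith : 0 < jap ξ)
  have hq0 : 0 < jap (ξ - η) / √(jap ξ) := div_pos (by linarith [one_le_jap (ξ - η)]) hs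
  have hq1 : jap (ξ - η) / √(jap ξ) ≤ 1 := (div_le_one hs).2 hz
  set v := √δ * (√(jap ξ) - √(jap η)) with hv
  have hv1 : |v| ≤ jap (ξ - η) / √(jap ξ) := by
    rw [hv, abs_mul, abs_of_nonneg (Real.sqrt_nonneg δ)]
    have h1 := abs_sqrt_sub_sqrt_le_div (by linarith : 0 < jap ξ) (by linarith : 0 ≤ jap η)
    have h2 := (abs_jap_sub_le ξ η).trans (abs_le_jap (ξ - η))
    refine (mul_le_of_le_one_left (abs_nonneg _) (Real.sqrt_le_one.2 hδ1)).trans (h1.trans ?_)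
    gcongr
  have hv2 : |Real.exp v - 1| ≤ 2 * (jap (ξ - η) / √(jap ξ)) :=
    (Real.abs_exp_sub_one_le (hv1.trans hq1)).trans (by linarith)
  have hPq : bK δ₀ δ δ' φ k t η / bK δ₀ δ δ' φ k t ξ ≤ P := (div_le_iff₀ hb).2 hP
  have e : (expDivB δ₀ δ δ' φ k t ξ - expDivB δ₀ δ δ' φ k t η) / expDivB δ₀ δ δ' φ k t η =
      (Real.exp v - 1) * (bK δ₀ δ δ' φ k t η / bK δ₀ δ δ' φ k t ξ) +
      (bK δ₀ δ δ' φ k t η / bK δ₀ δ δ' φ k t ξ - 1) := by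
    rw [hv, mul_sub, Real.exp_sub]
    unfold expDivB
    field_simp
    ring
  calc _ ≤ |expDivB δ₀ δ δ' φ k t ξ - expDivB δ₀ δ δ' φ k t η| / expDivB δ₀ δ δ' φ k t η := by
        gcongr
        linarith [Real.exp_pos (√δ * √|(k : ℝ)|)]
    _ = |(expDivB δ₀ δ δ' φ k t ξ - expDivB δ₀ δ δ' φ k t η) / expDivB δ₀ δ δ' φ k t η| := by
        rw [abs_div, abs_of_pos p2]
    _ ≤ |Real.exp v - 1| * (bK δ₀ δ δ' φ k t η / bK δ₀ δ δ' φ k t ξ) + F := by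
        rw [e]
        refine (abs_add_le _ _).trans ?_
        rw [abs_mul, abs_of_pos (by positivity :
          0 < bK δ₀ δ δ' φ k t η / bK δ₀ δ δ' φ k t ξ)]
        gcongr
    _ ≤ 2 * (jap (ξ - η) / √(jap ξ)) * P + F := by gcongr
    _ = _ := by ring

end


/-! ### The three regimes for e^{√δ⟨ξ⟩^{1/2}}/b_k. -/

theorem abs_sub_div_le_two_mul {x y D P : ℝ} (hx : 0 < x) (hy : 0 < y) (hD : 0 < D) (hP : 1 ≤ P)
    (h : x ≤ P * y) : |x - y| / (y + D) ≤ 2 * P := by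
  rw [div_le_iff₀ (by positivity), abs_le]
  have := mul_pos (by linarith : 0 < P) hD
  constructor <;> nlinarith

theorem two_mul_le_of_le_mul {m E R a s V : ℝ} (hm : 0 ≤ m) (hE : 1 ≤ E) (hR : 0 ≤ R) (ha : 0 < a)
    (hV : 0 < V) (hVR : V ≤ R * s) (hs : s ≤ E / a) : 2 * (m * E) ≤ E ^ 3 * (2 * m * R / a / V) := by
  have hE2 : E ^ 2 ≤ E ^ 3 := pow_le_pow_right₀ hE (by norm_num)
  have h1 : V ≤ R * (E / a) := hVR.trans (by gcongr)
  calc 2 * (m * E) = 2 * m * E / V * V := by field_simp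
    _ ≤ 2 * m * E / V * (R * (E / a)) := by gcongr
    _ = E ^ 2 * (2 * m * R / a / V) := by field_simp
    _ ≤ _ := by gcongr

theorem combine_le {m N E a q V K W : ℝ} (hm : 0 ≤ m) (hN : 0 ≤ N) (hE : 1 ≤ E)
    (hW : 0 ≤ W) (hq0 : 0 ≤ q) (hq : q ≤ E ^ 2 / a ^ 2 * (K / V)) :
    2 * (m * E) * q + (N * q + W * E ^ 2) ≤ E ^ 3 * ((2 * m + N) * K / a ^ 2 / V + W) := by
  have hE2 : E ^ 2 ≤ E ^ 3 := pow_le_pow_right₀ hE (by norm_num)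
  have h1 : N ≤ N * E := le_mul_of_one_le_right hN hE
  calc 2 * (m * E) * q + (N * q + W * E ^ 2) = (2 * (m * E) + N) * q + W * E ^ 2 := by ring
    _ ≤ (2 * (m * E) + N * E) * (E ^ 2 / a ^ 2 * (K / V)) + W * E ^ 3 := by gcongr
    _ = _ := by ring

theorem exists_abs_expDivB_sub_div_le {δ₀ δ δ' a : ℝ} {φ : ℝ → ℝ} (hφ : IsMollifier φ)
    (hδ₀ : 0 ≤ δ₀) (hδ : 0 < δ) (hδ2 : δ ≤ 1 / 2) (hδ' : 0 < δ') (hδ'1 : δ' ≤ 1) (ha0 : 0 < a)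
    (ha : 401 * (1 + 2 * δ₀) * √δ ≤ a) :
    ∃ C₀ : ℝ, 0 ≤ C₀ ∧ ∀ (t : ℝ) (k : ℤ) (ξ η : ℝ), 0 ≤ t →
      |expDivB δ₀ δ δ' φ k t ξ - expDivB δ₀ δ δ' φ k t η| /
        (expDivB δ₀ δ δ' φ k t η + Real.exp (√δ * √|(k : ℝ)|)) ≤
      Real.exp (a * √(jap (ξ - η))) ^ 3 *
        (C₀ / jap₂ k ξ ^ (1 / 8 : ℝ) + 80 * (1 + 2 * δ₀) / a * √δ) := by
  have hδ1 : δ ≤ 1 := by linarith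
  obtain ⟨M, hM0, hM⟩ := exists_bK_le hφ hδ₀ hδ hδ2
  obtain ⟨c, N, hc0, hc1, hN0, hN⟩ := exists_abs_bK_sub_le_of_le hφ hδ₀ hδ hδ2 hδ' hδ'1
  have hD : 0 < δ ^ (-10 : ℤ) := by positivity
  have hsδ0 := Real.sqrt_pos.2 hδ
  have hsδ : δ ≤ √δ := by
    have := Real.mul_self_sqrt hδ.le
    nlinarith [Real.sqrt_le_one.2 hδ1]
  obtain ⟨p, hp⟩ : ∃ p, p = 1 + 2 * δ₀ := ⟨_, rfl⟩
  rw [← hp] at ha hM ⊢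
  have hp1 : 1 ≤ p := by linarith
  -- The factor 2 lets |k| dominate both ⟨ξ⟩ and ⟨ξ-η⟩, hence also ⟨η⟩.
  obtain ⟨K, hK⟩ : ∃ K, K = 2 * (62 * p) ^ 2 := ⟨_, rfl⟩
  have hK1 : 1 ≤ K := by
    have : 1 ≤ (62 * p) ^ 2 := one_le_pow₀ (by linarith)
    linarith
  -- When X > Rz⁴, the term 4/c² gives z ≤ (c/2)⟨ξ⟩^{1/2}, the next two make |ξ| large, and 2K
  -- serves the case of large |k|.
  obtain ⟨R, hR⟩ : ∃ R, R = (K + 2) * (4 / c ^ 2 + 2 * δ ^ (-10 : ℤ) + 202) + 2 * K := ⟨_, rfl⟩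
  have hc4 : 0 < 4 / c ^ 2 := by positivity
  have hR2 : 2 * K ≤ R := by
    have : 0 ≤ (K + 2) * (4 / c ^ 2 + 2 * δ ^ (-10 : ℤ) + 202) := by positivity
    linarith
  have hR1 : 1 ≤ R := by linarith
  obtain ⟨C1, dC1⟩ : ∃ x, x = 2 * Real.exp M * R / a := ⟨_, rfl⟩
  obtain ⟨C2, dC2⟩ : ∃ x, x = 4 / √δ := ⟨_, rfl⟩
  obtain ⟨C3, dC3⟩ : ∃ x, x = (2 * Real.exp M + N) * (K + 1) / a ^ 2 := ⟨_, rfl⟩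
  have hC1 : 0 ≤ C1 := by rw [dC1]; positivity
  have hC2 : 0 ≤ C2 := by rw [dC2]; positivity
  have hC3 : 0 ≤ C3 := by rw [dC3]; positivity
  refine ⟨C1 + C2 + C3, by positivity, ?_⟩
  intro t k ξ η ht
  have z1 := one_le_jap (ξ - η)
  have j1 := one_le_jap ξ
  have jX := jap_le_jap₂ k ξ
  have hX2 := jap₂_le k ξ
  have hζ := abs_le_jap (ξ - η)
  have hjη : jap η ≤ jap ξ + jap (ξ - η) := by
    have := (abs_le.1 (abs_jap_sub_le ξ η)).1
    linarith
  have p1 := expDivB_pos (k := k) hφ hδ₀ hδ hδ' ht ξ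
  have p2 := expDivB_pos (k := k) hφ hδ₀ hδ hδ' ht η
  have hB := expDivB_le (ξ := ξ) (η := η) (k := k) hφ hδ₀ hδ hδ' ht (a := a) (by rwa [← hp])
    (by rw [← hp]; exact hM δ' t k η ξ hδ' hδ'1 ht)
  have hbb := hM δ' t k η ξ hδ' hδ'1 ht
  have eζ : jap (η - ξ) = jap (ξ - η) := by unfold jap; congr 1; ring
  rw [eζ] at hbb
  set X := jap₂ k ξ with hXdef
  have hX1 : 1 ≤ X := j1.trans jX
  set z := jap (ξ - η) with hz
  have hs1 : 1 ≤ √z := Real.one_le_sqrt.2 z1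
  have hsz : √z ^ 2 = z := Real.sq_sqrt (by linarith)
  have hsE := le_exp_div (s := √z) ha0
  have hE1 : 1 ≤ Real.exp (a * √z) := Real.one_le_exp (by positivity)
  have hP : bK δ₀ δ δ' φ k t η ≤ Real.exp M * Real.exp (a * √z) * bK δ₀ δ δ' φ k t ξ := by
    refine hbb.trans ?_
    rw [← Real.exp_add]
    have := bK_pos (k := k) hφ hδ₀ hδ hδ' ht ξ
    gcongr
    have : 0 ≤ p * √δ := by positivity
    linarith
  set E := Real.exp (a * √z) with hE
  set Y := X ^ (1 / 8 : ℝ) with hY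
  have hY0 : 0 < Y := Real.rpow_pos_of_pos (by linarith) _
  have hYs : Y ≤ √X := rpow_eighth_le_sqrt hX1
  have hz2 : z ≤ E ^ 2 / a ^ 2 := by
    rw [← hsz, ← div_pow]
    gcongr
  have hfin : ∀ q, q ≤ E ^ 3 * (C1 / Y) ∨ q ≤ E ^ 3 * (C2 / Y) ∨
      q ≤ E ^ 3 * (C3 / Y + 80 * p / a * √δ) →
      q ≤ E ^ 3 * ((C1 + C2 + C3) / Y + 80 * p / a * √δ) := by
    intro q hq
    have e : (C1 + C2 + C3) / Y = C1 / Y + C2 / Y + C3 / Y := by ring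
    have h1 : 0 ≤ E ^ 3 * (C1 / Y) := by positivity
    have h2 : 0 ≤ E ^ 3 * (C2 / Y) := by positivity
    have h3 : 0 ≤ E ^ 3 * (C3 / Y) := by positivity
    have h4 : 0 ≤ E ^ 3 * (80 * p / a * √δ) := by positivity
    rw [e]
    simp only [mul_add] at *
    rcases hq with hq | hq | hq <;> linarith
  apply hfin
  have hE0 : 0 < E := by linarith
  clear_value X E Y
  -- This regime dictates the exponent 1/8: X ≲ z⁴ gives X^{1/8} ≲ √z. The other two yield decay
  -- X^{-1/2}.
  rcases le_or_gt X (R * z ^ 4) with hcase | hcase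
  · left
    have hYR : Y ≤ R * √z := by
      rw [hY]
      refine rpow_eighth_le (by linarith) (by positivity) (hcase.trans ?_)
      rw [mul_pow, show √z ^ 8 = (√z ^ 2) ^ 4 by ring, hsz]
      gcongr
      exact le_self_pow₀ hR1 (by norm_num)
    have hME : 1 ≤ Real.exp M * E :=
      one_le_mul_of_one_le_of_one_le (Real.one_le_exp hM0) hE1
    refine (abs_sub_div_le_two_mul p1 p2 (Real.exp_pos _) hME hB).trans ?_
    rw [dC1]
    exact two_mul_le_of_le_mul (Real.exp_pos M).le hE1 (by linarith) ha0 hY0 hYR hsE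
  have hz4 : z ≤ z ^ 4 := le_self_pow₀ z1 (by norm_num)
  have hz24 : z ^ 2 ≤ z ^ 4 := pow_le_pow_right₀ z1 (by norm_num)
  rcases le_or_gt (K * jap ξ) |(k : ℝ)| with hk | hk
  · right; left
    have hjk : jap ξ ≤ |(k : ℝ)| := (le_mul_of_one_le_left (by linarith) hK1).trans hk
    have hX3 : X ≤ 2 ^ 2 * |(k : ℝ)| := by linarith
    have hkz : K * z ≤ |(k : ℝ)| := by
      have h1 : R * z ≤ R * z ^ 4 := by gcongr
      have h2 : 2 * K * z ≤ R * z := by gcongr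
      linarith
    have hkξ : (62 * p) ^ 2 * jap ξ ≤ |(k : ℝ)| := by
      have : 0 ≤ (62 * p) ^ 2 * jap ξ := by positivity
      rw [hK] at hk
      linarith
    have hkη : (62 * p) ^ 2 * jap η ≤ |(k : ℝ)| := by
      have := mul_le_mul_of_nonneg_left hjη (sq_nonneg (62 * p))
      rw [hK] at hk hkz
      linarith
    have hq := abs_expDivB_sub_div_le_of_le hφ hδ₀ hδ hδ1 hδ' hδ'1 ht
      (ξ := ξ) (η := η) (k := k) (by rwa [← hp]) (by rwa [← hp])
    have hk0 : 0 < |(k : ℝ)| := lt_of_lt_of_le (by positivity) hk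
    have hsk := Real.sqrt_pos.2 hk0
    refine hq.trans ?_
    have hXk : Y ≤ 2 * √|(k : ℝ)| := hYs.trans (sqrt_le_two_mul hX3)
    have h3 : 2 / (√δ * √|(k : ℝ)|) ≤ C2 / Y := by
      rw [dC2]
      rw [div_div, div_le_div_iff₀ (by positivity) (by positivity)]
      have := mul_le_mul_of_nonneg_left hXk hsδ0.le
      linarith
    exact h3.trans (le_mul_of_one_le_left (by positivity) (one_le_pow₀ hE1))
  · right; right
    have hXj : X ≤ (K + 1) * jap ξ := by linarith
    have hj : (4 / c ^ 2 + 2 * δ ^ (-10 : ℤ) + 202) * z ^ 4 ≤ jap ξ := by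
      have h0 : 0 ≤ 2 * K * z ^ 4 := by positivity
      have h1 : (K + 2) * ((4 / c ^ 2 + 2 * δ ^ (-10 : ℤ) + 202) * z ^ 4) ≤ (K + 2) * jap ξ := by
        rw [hR] at hcase
        linarith
      exact le_of_mul_le_mul_left h1 (by linarith)
    have hz41 : 1 ≤ z ^ 4 := one_le_pow₀ z1
    have hj2 : 4 / c ^ 2 * z ^ 4 ≤ jap ξ := by
      have : 0 ≤ (2 * δ ^ (-10 : ℤ) + 202) * z ^ 4 := by positivity
      linarith
    have hj3 : 2 * δ ^ (-10 : ℤ) + 202 ≤ jap ξ := by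
      have h1 : 2 * δ ^ (-10 : ℤ) + 202 ≤ (2 * δ ^ (-10 : ℤ) + 202) * z ^ 4 :=
        le_mul_of_one_le_right (by positivity) hz41
      have : 0 ≤ 4 / c ^ 2 * z ^ 4 := by positivity
      linarith
    have hjξ := jap_le ξ
    have hjs := Real.sqrt_pos.2 (by linarith : 0 < jap ξ)
    have hjss := Real.mul_self_sqrt (by linarith : 0 ≤ jap ξ)
    have hzc2 : 4 * z ^ 2 ≤ c ^ 2 * jap ξ := by
      rw [div_mul_eq_mul_div, div_le_iff₀ (by positivity)] at hj2
      linarith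
    have hzc : z ≤ c / 2 * √(jap ξ) := by
      refine abs_le_of_sq_le_sq' (a := z) ?_ (by positivity) |>.2
      rw [mul_pow, Real.sq_sqrt (by linarith)]
      linarith
    have hz1s : z ≤ √(jap ξ) := hzc.trans (mul_le_of_le_one_left hjs.le (by linarith))
    have hξ200 : 200 ≤ |ξ| := by linarith
    have hξD : 2 * δ ^ (-10 : ℤ) ≤ |ξ| := by linarith
    have hζ20 : |ξ - η| ≤ |ξ| / 20 := by
      refine hζ.trans (abs_le_of_sq_le_sq' (a := z) ?_ (by positivity) |>.2)
      have : c ^ 2 * jap ξ ≤ 1 * jap ξ := by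
        gcongr
        exact pow_le_one₀ hc0.le hc1
      have := mul_le_mul_of_nonneg_right hξ200 (abs_nonneg ξ)
      linarith
    have hF : |bK δ₀ δ δ' φ k t η / bK δ₀ δ δ' φ k t ξ - 1| ≤
        N * (z / √(jap ξ)) + 80 * p / a * √δ * E ^ 2 := by
      rcases le_total t (8 * √|ξ| / (δ * √δ)) with htc | htc
      · refine (hN t k ξ η ht hξD hξ200 hzc htc).trans ?_
        have : 0 ≤ 80 * p / a * √δ * E ^ 2 := by positivity
        linarith
      · refine (abs_bK_sub_le_of_ge hφ hδ₀ hδ hδ2 hδ' hδ'1 ht hξD hξ200 hζ20 htc).trans ?_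
        rw [← hp, ← hz]
        have hu0 : 0 ≤ 80 * p * δ * √z := by positivity
        have h1 := (le_abs_self _).trans (abs_exp_sub_one_le_mul (80 * p * δ * √z))
        rw [abs_of_nonneg hu0] at h1
        have hpδ : 80 * p * δ ≤ a := by
          have := mul_le_mul_of_nonneg_left hsδ (by positivity : 0 ≤ 80 * p)
          have : 0 ≤ p * √δ := by positivity
          linarith
        have h2 : Real.exp (80 * p * δ * √z) ≤ E := by
          rw [hE, Real.exp_le_exp]
          gcongr
        have h3 : 80 * p * δ * √z * Real.exp (80 * p * δ * √z) ≤ 80 * p * √δ * (E / a) * E := by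
          gcongr
        have h4 : 80 * p * √δ * (E / a) * E = 80 * p / a * √δ * E ^ 2 := by ring
        have : 0 ≤ N * (z / √(jap ξ)) := by positivity
        linarith
    have hYj : Y ≤ (K + 1) * √(jap ξ) := by
      refine hYs.trans ?_
      rw [Real.sqrt_le_left (by positivity), mul_pow, Real.sq_sqrt (by linarith)]
      refine hXj.trans ?_
      gcongr
      exact le_self_pow₀ (by linarith) (by norm_num)
    have hzj : z / √(jap ξ) ≤ E ^ 2 / a ^ 2 * ((K + 1) / Y) := by
      have h1 : 1 / √(jap ξ) ≤ (K + 1) / Y := by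
        rw [div_le_div_iff₀ hjs hY0]
        linarith
      rw [div_eq_mul_one_div]
      exact mul_le_mul hz2 h1 (by positivity) (by positivity)
    refine (abs_expDivB_sub_div_le hφ hδ₀ hδ hδ1 hδ' ht hz1s hP hF).trans ?_
    rw [dC3]
    exact combine_le (Real.exp_pos M).le hN0 hE1 (by positivity) (by positivity) hzj

end ImbalancedWeights

/-! ### Assembly of the estimate for A_k. -/

open ImbalancedWeights in
theorem mainTheorem5 (δ₀ σ₀ : ℝ) (hδ₀ : 0 < δ₀) (hσ₀ : 0 < σ₀) (hσ₀' : σ₀ ≤ 1 / 100)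
    (φ : ℝ → ℝ) (hφ : IsMollifier φ) :
    ∃ C : ℝ, 0 < C ∧ ∃ δmax : ℝ, 0 < δmax ∧ ∀ δ : ℝ, 0 < δ → δ ≤ δmax →
      ∃ δ'max : ℝ, 0 < δ'max ∧ δ'max ≤ 1 ∧ ∀ δ' : ℝ, 0 < δ' → δ' ≤ δ'max →
        ∃ C₀ : ℝ, 1 ≤ C₀ ∧ ∀ (t : ℝ) (k : ℤ) (ξ η : ℝ), 0 ≤ t →
          jap (ξ - η) ≤ (jap₂ k ξ + jap₂ k η) / 8 →
          |AK δ₀ σ₀ δ δ' φ k t ξ - AK δ₀ σ₀ δ δ' φ k t η|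
            ≤ C * AR δ₀ σ₀ δ δ' φ t (ξ - η) * AK δ₀ σ₀ δ δ' φ k t η
              * Real.exp (-(lam δ₀ σ₀ t / 40) * √(jap (ξ - η)))
              * (C₀ / jap₂ k ξ ^ (1 / 8 : ℝ) + √δ) := by
  set a := δ₀ / 20 with ha
  have ha0 : 0 < a := by positivity
  set p := 1 + 2 * δ₀ with hp
  have hp0 : 0 < p := by positivity
  set C := 80 * p / a with hC
  have hC0 : 0 < C := by positivity
  -- The smallness of δ keeps the loss 400(1+2δ₀)√δ from b_k and √δ from the numerator below the
  -- budget a.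
  refine ⟨C, hC0, min (1 / 2) ((a / (401 * p)) ^ 2), by positivity, fun δ hδ hδm => ?_⟩
  have hδ2 : δ ≤ 1 / 2 := hδm.trans (min_le_left _ _)
  have hsa : 401 * p * √δ ≤ a := by
    have : √δ ≤ a / (401 * p) :=
      (Real.sqrt_le_left (by positivity)).2 (hδm.trans (min_le_right _ _))
    rw [le_div_iff₀ (by positivity)] at this
    linarith
  -- No further smallness of δ' is needed; it enters only through C₀.
  refine ⟨1, one_pos, le_rfl, fun δ' hδ' hδ'1 => ?_⟩
  obtain ⟨M, hM0, hM⟩ := exists_bK_le hφ hδ₀.le hδ hδ2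
  obtain ⟨C1, hC1, hq⟩ := exists_abs_expDivB_sub_div_le hφ hδ₀.le hδ hδ2 hδ' hδ'1 ha0 hsa
  -- The constant for varying e^{λ⟨k,·⟩^{1/2}}: 3δ₀/2 bounds λ, a^{-2} comes from z ≤ E²/a², and e^M
  -- from comparing the brackets at ξ and η.
  set C2 := 3 / 2 * δ₀ / a ^ 2 * Real.exp M with hC2
  have hC20 : 0 ≤ C2 := by positivity
  refine ⟨1 + (C1 + C2) / C, ?_, ?_⟩
  · have : 0 ≤ (C1 + C2) / C := by positivity
    linarith
  intro t k ξ η ht hz8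
  obtain ⟨l1, l2⟩ := lam_bounds hδ₀ hσ₀ hσ₀' ht
  have hq := hq t k ξ η ht
  have hB := expDivB_le (ξ := ξ) (η := η) (k := k) hφ hδ₀.le hδ hδ' ht hsa
    (hM δ' t k η ξ hδ' hδ'1 ht)
  have p1 := expDivB_pos (k := k) hφ hδ₀.le hδ hδ' ht ξ
  have p2 := expDivB_pos (k := k) hφ hδ₀.le hδ hδ' ht η
  have hAK : ∀ x, AK δ₀ σ₀ δ δ' φ k t x = Real.exp (lam δ₀ σ₀ t * √(jap₂ k x)) *
    (expDivB δ₀ δ δ' φ k t x + Real.exp (√δ * √|(k : ℝ)|)) := fun x => rfl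
  have hX1 : 1 ≤ jap₂ k ξ := (one_le_jap ξ).trans (jap_le_jap₂ k ξ)
  have hY1 : 1 ≤ jap₂ k η := (one_le_jap η).trans (jap_le_jap₂ k η)
  have hXY := (abs_jap₂_sub_le k ξ η).trans (abs_le_jap (ξ - η))
  have z1 := one_le_jap (ξ - η)
  have hAR : Real.exp (lam δ₀ σ₀ t * √(jap (ξ - η))) ≤ AR δ₀ σ₀ δ δ' φ t (ξ - η) := by
    have h1 := bR_pos hφ hδ₀.le hδ hδ' ht (ξ - η)
    have h2 := bR_le_one hφ hδ₀.le hδ hδ' ht (ξ - η)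
    have h3 : 1 ≤ Real.exp (√δ * √(jap (ξ - η))) := Real.one_le_exp (by positivity)
    unfold AR
    refine le_trans ?_ (le_mul_of_one_le_right (by positivity) h3)
    exact le_div_self (Real.exp_pos _).le h1 h2
  rw [hAK, hAK]
  have hDp := Real.exp_pos (√δ * √|(k : ℝ)|)
  generalize Real.exp (√δ * √|(k : ℝ)|) = D at *
  generalize expDivB δ₀ δ δ' φ k t ξ = Bξ at *
  generalize expDivB δ₀ δ δ' φ k t η = Bη at *
  generalize lam δ₀ σ₀ t = l at *
  generalize AR δ₀ σ₀ δ δ' φ t (ξ - η) = A at *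
  generalize jap (ξ - η) = z at *
  generalize jap₂ k ξ = X at *
  generalize jap₂ k η = Y at *
  have hl0 : 0 < l := by linarith
  have hXs := Real.sqrt_pos.2 (by linarith : 0 < X)
  set V := X ^ (1 / 8 : ℝ) with hV
  have hV0 : 0 < V := Real.rpow_pos_of_pos (by linarith) _
  have hVs : V ≤ √X := rpow_eighth_le_sqrt hX1
  have hsz : √z ^ 2 = z := Real.sq_sqrt (by linarith)
  have hsE := le_exp_div (s := √z) ha0
  have hE1 : 1 ≤ Real.exp (a * √z) := Real.one_le_exp (by positivity)
  -- The exponent budget closes: 3a ≤ 3λ/20, and 9/25 + 3/20 < 1 - 1/40.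
  have hEl : Real.exp (9 / 25 * (l * √z)) * Real.exp (a * √z) ^ 3 ≤
      Real.exp (l * √z) * Real.exp (-(l / 40) * √z) := by
    rw [← Real.exp_nat_mul, ← Real.exp_add, ← Real.exp_add, Real.exp_le_exp, ha]
    push_cast
    have := mul_le_mul_of_nonneg_right l1 (Real.sqrt_nonneg z)
    linarith [mul_nonneg hl0.le (Real.sqrt_nonneg z)]
  set E := Real.exp (a * √z) with hE
  have hz2 : z ≤ E ^ 2 / a ^ 2 := by
    rw [← hsz, ← div_pow]
    gcongr
  set u := l * (√X - √Y) with hu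
  set G := Real.exp (9 / 25 * (l * √z)) with hG
  have hG1 : 1 ≤ G := Real.one_le_exp (by positivity)
  have hu1 : |u| ≤ 3 / 2 * δ₀ * (E ^ 2 / a ^ 2 / V) := by
    rw [hu, abs_mul, abs_of_pos hl0]
    have h1 := abs_sqrt_sub_sqrt_le_div (by linarith : 0 < X) (by linarith : 0 ≤ Y)
    have h2 : |X - Y| / √X ≤ E ^ 2 / a ^ 2 / V := by
      gcongr
      exact hXY.trans hz2
    exact mul_le_mul l2 (h1.trans h2) (abs_nonneg _) (by positivity)
  have hu2 : Real.exp |u| ≤ G := by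
    rw [hG, Real.exp_le_exp, hu, abs_mul, abs_of_pos hl0]
    have := abs_sqrt_sub_sqrt_le_of_le (by linarith : 0 < X) (by linarith : 0 ≤ Y)
      (by linarith) hXY hz8
    have := mul_le_mul_of_nonneg_left this hl0.le
    linarith
  have hu3 : |Real.exp u - 1| ≤ 3 / 2 * δ₀ * (E ^ 2 / a ^ 2 / V) * G :=
    (abs_exp_sub_one_le_mul u).trans (by gcongr)
  have hQ : Bξ + D ≤ Real.exp M * E * (Bη + D) := by
    have h1 : 1 ≤ Real.exp M * E := one_le_mul_of_one_le_of_one_le (Real.one_le_exp hM0) hE1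
    nlinarith
  have hsum : 0 < Bη + D := by linarith
  rw [div_le_iff₀ hsum] at hq
  have e : Real.exp (l * √X) * (Bξ + D) - Real.exp (l * √Y) * (Bη + D) =
      Real.exp (l * √Y) * ((Real.exp u - 1) * (Bξ + D) + (Bξ - Bη)) := by
    have : Real.exp (l * √X) = Real.exp (l * √Y) * Real.exp u := by
      rw [← Real.exp_add, hu]
      ring_nf
    rw [this]
    ring
  have main : |(Real.exp u - 1) * (Bξ + D) + (Bξ - Bη)| ≤
      G * E ^ 3 * ((C1 + C2) / V + C * √δ) * (Bη + D) := by
    refine (abs_add_le _ _).trans ?_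
    rw [abs_mul, abs_of_pos (by linarith : 0 < Bξ + D)]
    have h1 : |Real.exp u - 1| * (Bξ + D) ≤
        3 / 2 * δ₀ * (E ^ 2 / a ^ 2 / V) * G * (Real.exp M * E * (Bη + D)) := by gcongr
    have h2 : 3 / 2 * δ₀ * (E ^ 2 / a ^ 2 / V) * G * (Real.exp M * E * (Bη + D)) =
        G * E ^ 3 * (C2 / V) * (Bη + D) := by
      rw [hC2]
      field_simp
    have h3 : E ^ 3 * (C1 / V + C * √δ) * (Bη + D) ≤
        G * (E ^ 3 * (C1 / V + C * √δ) * (Bη + D)) :=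
      le_mul_of_one_le_left (by positivity) hG1
    have h4 : G * E ^ 3 * ((C1 + C2) / V + C * √δ) * (Bη + D) =
        G * E ^ 3 * (C2 / V) * (Bη + D) + G * (E ^ 3 * (C1 / V + C * √δ) * (Bη + D)) := by ring
    linarith
  rw [e, abs_mul, abs_of_pos (Real.exp_pos _)]
  have hlast : (C1 + C2) / V + C * √δ ≤ C * ((1 + (C1 + C2) / C) / V + √δ) := by
    have : C * ((1 + (C1 + C2) / C) / V + √δ) = C / V + (C1 + C2) / V + C * √δ := by
      field_simp
    have : 0 < C / V := by positivity
    linarith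
  calc Real.exp (l * √Y) * |(Real.exp u - 1) * (Bξ + D) + (Bξ - Bη)|
      ≤ Real.exp (l * √Y) * (G * E ^ 3 * ((C1 + C2) / V + C * √δ) * (Bη + D)) := by gcongr
    _ ≤ Real.exp (l * √Y) * (Real.exp (l * √z) * Real.exp (-(l / 40) * √z) *
        (C * ((1 + (C1 + C2) / C) / V + √δ)) * (Bη + D)) := by gcongr
    _ ≤ Real.exp (l * √Y) * (A * Real.exp (-(l / 40) * √z) *
        (C * ((1 + (C1 + C2) / C) / V + √δ)) * (Bη + D)) := by gcongr
    _ = _ := by ring
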